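/- **Setting.** Let $d\ge 1$ and let $\Gamma_0$ be the set of finite subsets $\eta$ of $\mathbb R^d$, with its Borel $\sigma$-algebra and the Lebesgue–Poisson measure $\lambda=\sum_{n\ge 0}\frac1{n!}m^{(n)}$, where $m^{(n)}$ is the image of Lebesgue measure on $n$-tuples of distinct points. Write $e_\lambda(f,\eta)=\prod_{x\in\eta}f(x)$. Let $C>1$, $z>0$, and let $\phi:\mathbb R^d\to[0,\infty)$ be measurable, even, integrable and bounded; put $\beta=\int_{\mathbb R^d}\phi(x)\,dx$ and $\bar\phi=\sup\phi<\infty$. For $c>0$ let $$\mathcal L_c=L^1(\Gamma_0,c^{|\cdot|}d\lambda),\qquad \mathcal K_c=\{k: c^{-|\cdot|}k\in L^\infty(\Gamma_0,\lambda)\},\qquad \|k\|_{\mathcal K_c}=\|c^{-|\cdot|}k\|_{L^\infty(\Gamma_0,\lambda)}.$$ On the domain $\mathcal L_{2C}\subset\mathcal L_C$ consider, for $\varepsilon>0$, $$(\hat L_{\varepsilon,\mathrm{ren}}G)(\eta)=-|\eta|G(\eta)+z\sum_{\xi\subset\eta}\int_{\mathbb R^d}e_\lambda\bigl(e^{-\varepsilon\phi(x-\cdot)},\xi\bigr)\,e_\lambda\Bigl(\tfrac{e^{-\varepsilon\phi(x-\cdot)}-1}{\varepsilon},\eta\setminus\xi\Bigr)G(\xi\cup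 x)\,dx,$$ $$(\hat L_VG)(\eta)=-|\eta|G(\eta)+z\sum_{\xi\subset\eta}\int_{\mathbb R^d}G(\xi\cup x)\,e_\lambda(-\phi(x-\cdot),\eta\setminus\xi)\,dx.$$ **Theorem.** Assume $z\le\min\{Ce^{-C\beta},\,2Ce^{-2C\beta}\}$ and, if $C\beta=\ln 2$, also $z<C/2$. Set $\alpha_1=\max\{\frac12,\frac1{C\beta},\frac1C\}$ if $C\beta>1$, and $\alpha_1=\max\{\frac12,\frac{r}{C},\frac1C\}$ if $C\beta\le1$, where $r$ is the smallest nonnegative solution of $re^{-\beta r}=z$. Then $0<\alpha_1<1$ whenever $z\ne Ce^{-C\beta}$, and the following hold. 1. The operators $(\hat L_V,\mathcal L_{2C})$ and $(\hat L_{\varepsilon,\mathrm{ren}},\mathcal L_{2C})$, $\varepsilon>0$, are well defined and closable in $\mathcal L_C$, and their closures generate strongly continuous contraction semigroups $\hat T_V(t)$ and $\hat T_{\varepsilon,\mathrm{ren}}(t)$ on $\mathcal L_C$. 2. For every $\alpha\in(\alpha_1,1)$ the closure $\overline{\mathcal K_{\alpha C}}$ of $\mathcal K_{\alpha C}$ in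 $\mathcal K_C$ is invariant under the semigroups on $\mathcal K_C$ dual to $\hat T_V$ and $\hat T_{\varepsilon,\mathrm{ren}}$ with respect to $\langle\langle G,k\rangle\rangle=\int_{\Gamma_0}Gk\,d\lambda$, and the restrictions $\hat T_V^{\boxdot}(t)$, $\hat T^{\boxdot}_{\varepsilon,\mathrm{ren}}(t)$ of these dual semigroups to $\overline{\mathcal K_{\alpha C}}$ are strongly continuous contraction semigroups for $\|\cdot\|_{\mathcal K_C}$. 3. For every $\alpha\in(\alpha_1,1)$, $k\in\mathcal K_{\alpha C}$, $\varepsilon>0$ and $t\ge0$, $$\bigl\|\hat T^{\boxdot}_{\varepsilon,\mathrm{ren}}(t)k-\hat T^{\boxdot}_V(t)k\bigr\|_{\mathcal K_C}\le\varepsilon\,t\,A\,\|k\|_{\mathcal K_{\alpha C}},$$ where $A$ depends only on $\alpha$, $C$ and $\bar\phi$. -/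

import Mathlib

open MeasureTheory Filter Topology
open scoped NNReal ENNReal

noncomputable section

namespace GlauberVlasov

/-! ### Finite configurations and the Lebesgue–Poisson measure -/

/-- The underlying space `ℝ^d`. -/
abbrev Space (d : ℕ) : Type := EuclideanSpace ℝ (Fin d)

/-- The space `Γ₀` of finite configurations in `ℝ^d`. -/
@[ext] structure FinConf (d : ℕ) : Type where
  /-- The set of points of the configuration. -/
  points : Finset (Space d)

/-- The cardinality `|η|`. -/
def FinConf.card {d : ℕ} (η : FinConf d) : ℕ := η.points.card

open Classical in
/-- The configuration `{x₁, …, xₙ}` attached to an `n`-tuple of distinct points. -/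
def FinConf.ofTuple {d n : ℕ} (x : {x : Fin n → Space d // Function.Injective x}) : FinConf d :=
  ⟨Finset.univ.image x.1⟩

/-- A set of configurations is measurable if, for every `n`, its preimage in the space of
`n`-tuples of distinct points is a Borel set: `Γ₀` is the disjoint union of the spaces `Γ⁽ⁿ⁾`, and
`Γ⁽ⁿ⁾` is the symmetrization of the space of `n`-tuples of distinct points. -/
instance (d : ℕ) : MeasurableSpace (FinConf d) :=
  ⨅ n : ℕ, MeasurableSpace.map (FinConf.ofTuple (d := d) (n := n)) inferInstance

/-- The measure `m⁽ⁿ⁾` on `n`-point configurations: the image of Lebesgue measure on `n`-tuples of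
distinct points. For `n = 0` it is the unit mass at the empty configuration. -/
def configMeasure (d n : ℕ) : Measure (FinConf d) :=
  Measure.map FinConf.ofTuple
    (Measure.comap Subtype.val (volume : Measure (Fin n → Space d)))

/-- The Lebesgue–Poisson measure `λ = ∑ₙ m⁽ⁿ⁾ / n!` on `Γ₀`. -/
def lebesguePoisson (d : ℕ) : Measure (FinConf d) :=
  Measure.sum fun n : ℕ => ((n.factorial : ℝ≥0∞)⁻¹) • configMeasure d n

/-- The Lebesgue–Poisson exponent `e_λ(f, η) = ∏_{x ∈ η} f x`. -/
def lpExp {d : ℕ} (f : Space d → ℝ) (η : Finset (Space d)) : ℝ := ∏ x ∈ η, f x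

/-! ### The spaces `L_C` and `K_C` -/

/-- The measure `dλ_C = C^{|·|} dλ`. -/
def weightedMeasure (d : ℕ) (C : ℝ) : Measure (FinConf d) :=
  (lebesguePoisson d).withDensity fun η => ENNReal.ofReal (C ^ η.card)

/-- The Banach space `L_C = L¹(Γ₀, dλ_C)`. -/
abbrev LSpace (d : ℕ) (C : ℝ) : Type := Lp ℝ 1 (weightedMeasure d C)

/-- The function `C^{-|·|} k`. -/
def scaled {d : ℕ} (C : ℝ) (k : FinConf d → ℝ) : FinConf d → ℝ :=
  fun η => (C ^ η.card)⁻¹ * k η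

theorem scaled_add_ae {d : ℕ} (C : ℝ) (k l : FinConf d →ₘ[lebesguePoisson d] ℝ) :
    scaled C (k + l : FinConf d →ₘ[lebesguePoisson d] ℝ)
      =ᵐ[lebesguePoisson d] scaled C k + scaled C l := by
  filter_upwards [AEEqFun.coeFn_add k l] with η h
  simp only [scaled, Pi.add_apply, h, mul_add]

theorem scaled_smul_ae {d : ℕ} (C c : ℝ) (k : FinConf d →ₘ[lebesguePoisson d] ℝ) :
    scaled C (c • k : FinConf d →ₘ[lebesguePoisson d] ℝ)
      =ᵐ[lebesguePoisson d] c • scaled C k := by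
  filter_upwards [AEEqFun.coeFn_smul c k] with η h
  simp only [scaled, Pi.smul_apply, h, smul_eq_mul]
  ring

/-- The space `K_C` of (classes of) functions `k` on `Γ₀` with `C^{-|·|} k ∈ L^∞(Γ₀, λ)`. -/
def KSpace (d : ℕ) (C : ℝ) : Submodule ℝ (FinConf d →ₘ[lebesguePoisson d] ℝ) where
  carrier := {k | MemLp (scaled C k) ∞ (lebesguePoisson d)}
  add_mem' {k l} hk hl := (memLp_congr_ae (scaled_add_ae C k l)).2 (MemLp.add hk hl)
  zero_mem' := by
    have h : scaled C (0 : FinConf d →ₘ[lebesguePoisson d] ℝ)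
        =ᵐ[lebesguePoisson d] (0 : FinConf d → ℝ) := by
      filter_upwards [AEEqFun.coeFn_zero (μ := lebesguePoisson d) (α := FinConf d) (β := ℝ)]
        with η h
      simp only [scaled, h, Pi.zero_apply, mul_zero]
    exact (memLp_congr_ae h).2 MemLp.zero
  smul_mem' c k hk := (memLp_congr_ae (scaled_smul_ae C c k)).2 (MemLp.const_smul hk c)

/-- The norm `‖k‖_{K_C} = ‖C^{-|·|} k‖_{L^∞(Γ₀, λ)}`. -/
def kNorm {d : ℕ} (C : ℝ) (k : FinConf d →ₘ[lebesguePoisson d] ℝ) : ℝ :=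
  (eLpNorm (scaled C k) ∞ (lebesguePoisson d)).toReal

theorem KSpace.memLp {d : ℕ} {C : ℝ} (k : KSpace d C) :
    MemLp (scaled C k.1) ∞ (lebesguePoisson d) := k.2

/-- The linear map `k ↦ C^{-|·|} k` from `K_C` to `L^∞(Γ₀, λ)`. -/
def KSpace.toLinf (d : ℕ) (C : ℝ) : KSpace d C →ₗ[ℝ] Lp ℝ ∞ (lebesguePoisson d) where
  toFun k := (KSpace.memLp k).toLp (scaled C k.1)
  map_add' k l :=
    (MemLp.toLp_congr _ ((KSpace.memLp k).add (KSpace.memLp l)) (scaled_add_ae C k.1 l.1)).trans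
      (MemLp.toLp_add (KSpace.memLp k) (KSpace.memLp l))
  map_smul' c k :=
    (MemLp.toLp_congr _ ((KSpace.memLp k).const_smul c) (scaled_smul_ae C c k.1)).trans
      (MemLp.toLp_const_smul c (KSpace.memLp k))

theorem KSpace.toLinf_injective (d : ℕ) (C : ℝ) (hC : 0 < C) :
    Function.Injective (KSpace.toLinf d C) := by
  intro k l h
  have h' := (MemLp.toLp_eq_toLp_iff (KSpace.memLp k) (KSpace.memLp l)).1 h
  apply Subtype.ext
  apply AEEqFun.ext
  filter_upwards [h'] with η hη
  exact mul_left_cancel₀ (inv_ne_zero (pow_ne_zero _ hC.ne')) hη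

instance (d : ℕ) (C : ℝ) [hC : Fact (1 < C)] : NormedAddCommGroup (KSpace d C) :=
  NormedAddCommGroup.induced _ _ (KSpace.toLinf d C)
    (KSpace.toLinf_injective d C (zero_lt_one.trans hC.out))

instance (d : ℕ) (C : ℝ) [Fact (1 < C)] : NormedSpace ℝ (KSpace d C) :=
  NormedSpace.induced ℝ _ _ (KSpace.toLinf d C)

theorem KSpace.norm_eq {d : ℕ} {C : ℝ} [Fact (1 < C)] (k : KSpace d C) :
    ‖k‖ = kNorm C k.1 :=
  Lp.norm_toLp _ (KSpace.memLp k)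

/-- The subspace of the elements of `K_C` that lie in `K_{C'}`; for `C' = αC` with `0 < α < 1` this
is all of `K_{αC}`. -/
def KSub (d : ℕ) (C C' : ℝ) : Submodule ℝ (KSpace d C) :=
  (KSpace d C').comap (KSpace d C).subtype

/-- The closure in `K_C` of `K_{αC}`, with the norm of `K_C`. -/
abbrev KBar (d : ℕ) (C α : ℝ) [Fact (1 < C)] : Submodule ℝ (KSpace d C) :=
  (KSub d C (α * C)).topologicalClosure

/-! ### Strongly continuous contraction semigroups -/

/-- A strongly continuous semigroup of linear contractions. -/
structure ContractionSemigroup (E : Type*) [NormedAddCommGroup E] [NormedSpace ℝ E] where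
  /-- The operators of the semigroup. -/
  op : ℝ≥0 → E →L[ℝ] E
  op_zero : op 0 = ContinuousLinearMap.id ℝ E
  op_add : ∀ s t, op (s + t) = (op s).comp (op t)
  norm_le : ∀ t, ‖op t‖ ≤ 1
  strongCont : ∀ x, Tendsto (fun t => op t x) (𝓝 0) (𝓝 x)

/-- The graph of the (infinitesimal) generator: the pairs `(x, y)` with
`(T(t) x - x) / t → y` as `t → 0+`. -/
def ContractionSemigroup.generatorGraph {E : Type*} [NormedAddCommGroup E] [NormedSpace ℝ E]
    (T : ContractionSemigroup E) : Set (E × E) :=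
  {p | Tendsto (fun t : ℝ≥0 => (t : ℝ)⁻¹ • (T.op t p.1 - p.1)) (𝓝[>] 0) (𝓝 p.2)}

/-! ### The renormalized and the Vlasov operators -/

open Classical in
/-- The operator `L̂_{ε,ren}`:
`(L̂_{ε,ren} G)(η) = -|η| G(η) + z ∑_{ξ ⊆ η} ∫ e_λ(e^{-εφ(x-·)}, ξ)
  e_λ((e^{-εφ(x-·)} - 1)/ε, η ∖ ξ) G(ξ ∪ x) dx`. -/
def renOp {d : ℕ} (z : ℝ) (φ : Space d → ℝ) (ε : ℝ) (G : FinConf d → ℝ) (η : FinConf d) : ℝ :=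
  -(η.card : ℝ) * G η + z * ∑ ξ ∈ η.points.powerset, ∫ x : Space d,
    lpExp (fun y => Real.exp (-ε * φ (x - y))) ξ *
      lpExp (fun y => (Real.exp (-ε * φ (x - y)) - 1) / ε) (η.points \ ξ) *
      G ⟨insert x ξ⟩

open Classical in
/-- The operator `L̂_V`:
`(L̂_V G)(η) = -|η| G(η) + z ∑_{ξ ⊆ η} ∫ G(ξ ∪ x) e_λ(-φ(x-·), η ∖ ξ) dx`. -/
def vlasovOp {d : ℕ} (z : ℝ) (φ : Space d → ℝ) (G : FinConf d → ℝ) (η : FinConf d) : ℝ :=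
  -(η.card : ℝ) * G η + z * ∑ ξ ∈ η.points.powerset, ∫ x : Space d,
    G ⟨insert x ξ⟩ * lpExp (fun y => -φ (x - y)) (η.points \ ξ)

/-- The elements `G` of `L_C` that lie in `L_{2C}`. -/
def InL2C {d : ℕ} {C : ℝ} (G : LSpace d C) : Prop :=
  MemLp G 1 (weightedMeasure d (2 * C))

/-- The expression `𝓛` maps `L_{2C}` to `L_C`, the operator `(𝓛, L_{2C})` is closable in `L_C`, and
its closure is the generator of the contraction semigroup `T` (closability is part of `generator`,
since a generator is a single-valued operator). -/
structure IsGeneratedByClosure {d : ℕ} {C : ℝ} (T : ContractionSemigroup (LSpace d C))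
    (𝓛 : (FinConf d → ℝ) → FinConf d → ℝ) : Prop where
  maps : ∀ G : LSpace d C, InL2C G → MemLp (𝓛 G) 1 (weightedMeasure d C)
  generator : T.generatorGraph =
    closure {p : LSpace d C × LSpace d C | InL2C p.1 ∧ p.2 =ᵐ[lebesguePoisson d] 𝓛 p.1}

/-- `S` is the restriction to the closed subspace `KBar d C α` of `K_C` of the semigroup `T*` that
is dual to `T` with respect to `⟨⟨G, k⟩⟩ = ∫ G k dλ`, `G ∈ L_C`, `k ∈ K_C`. -/
def IsDualRestriction {d : ℕ} {C α : ℝ} [Fact (1 < C)] (T : ContractionSemigroup (LSpace d C))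
    (S : ContractionSemigroup (KBar d C α)) : Prop :=
  ∀ (t : ℝ≥0) (G : LSpace d C) (k : KBar d C α),
    ∫ η, T.op t G η * (k : KSpace d C).1 η ∂lebesguePoisson d =
      ∫ η, G η * (S.op t k : KSpace d C).1 η ∂lebesguePoisson d

/-! ### The threshold `α₁` -/

/-- The smallest nonnegative root `r` of `r e^{-βr} = z`. For `β > 0`, `x₁ = βr` is the smaller root
of `x e^{-x} = zβ`. -/
def smallestRoot (z β : ℝ) : ℝ := sInf {r : ℝ | 0 ≤ r ∧ r * Real.exp (-β * r) = z}

/-- The threshold `α₁(z, β, C)`: it is `max {1/2, 1/(Cβ), 1/C}` if `Cβ > 1` and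
`max {1/2, x₁/(Cβ), 1/C}` if `Cβ ≤ 1`, where `x₁/(Cβ)` is written as `smallestRoot z β / C`, which
makes sense for `β = 0` too. -/
def alphaOne (z β C : ℝ) : ℝ :=
  if 1 < C * β then max (max (1 / 2) (1 / (C * β))) (1 / C)
  else max (max (1 / 2) (smallestRoot z β / C)) (1 / C)

end GlauberVlasov

end

open MeasureTheory Filter Topology
open scoped NNReal ENNReal

noncomputable section

/-! Both operators have the form `L = -|·| + zB`, where `B = kernelOp a b` with `|a| ≤ 1` and `|b| ≤
φ`. Here `a = e^{-εφ}`, `b = (e^{-εφ} - 1)/ε` in the renormalized case, and `a = 1`, `b = -φ` in the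
Vlasov case. Everything rests on one combinatorial estimate, `lintegral_posOp_le`: for every weight
`c > 0`, `∫ |zBG| dλ_c ≤ (z e^{cβ}/c) ∫ |η| |G| dλ_c`. If `z ≤ c e^{-cβ}`, the gain term is
therefore dominated by the loss term in `L_c`, and `L` is dissipative for the norm of `L_c`
(`coreGraph_dissipative`). This holds at `c = C` by hypothesis, and `α > α₁` is what makes it hold
at `c = αC` as well.

Generation. The range of `1 - L/μ` is dense by the Neumann series of `zB(μ + |·|)⁻¹`, whose norm on
`L_c` is at most `z e^{cβ}/c`. A strict inequality is needed at one weight between `C` and `2C`. It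
can fail at both ends only if `e^{Cβ} = 2` and `z = C/2`, which is the excluded case. Dissipativity
and dense range then give the semigroup through resolvents and Yosida approximations
(`exists_resolvent_of_dissipative`, `IsResolvent.exists_semigroup`).

Duality. `K_C` is the dual of `L_C` (`dualEquiv`), and `k` lies in `K_{αC}` exactly when its pairing
is bounded by the weaker norm of `L_{αC}`. The semigroup contracts that norm too, so its dual
preserves `K_{αC}`. Since `L` is bounded from `L_C` to `L_{αC}`, the dual orbits of elements of
`K_{αC}` are Lipschitz at `t = 0`, which gives strong continuity on the closure.

Convergence. Comparing kernels factor by factor, `B_ren - B_V` is of size `ε φ̄ |η|` times the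
dominating positive operator. It loses two factors `|η|`, one paid for between `αC` and an
intermediate weight `c'`, the other between `c'` and `C`. The bound passes to resolvents with a
factor `1/μ`, and from there to semigroups: the exponential of a Yosida approximation is a Poisson
average of powers of `P μ` with mean `tμ`, so `1/μ` becomes `t`. -/

namespace GlauberVlasov

/-! ### Contraction semigroups: generation, and comparison in a weaker norm -/

section Semigroup

variable {E F : Type*} [NormedAddCommGroup E] [NormedSpace ℝ E]
  [NormedAddCommGroup F] [NormedSpace ℝ F]

/-- `P μ = μ (μ - A)⁻¹`, `μ > 0`, for the operator `A` with graph `Γ`. -/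
structure IsResolvent (Γ : Submodule ℝ (E × E)) (P : ℝ → E →L[ℝ] E) : Prop where
  norm_le : ∀ μ, 0 < μ → ‖P μ‖ ≤ 1
  mem : ∀ μ, 0 < μ → ∀ f, (P μ f, μ • (P μ f - f)) ∈ Γ
  apply : ∀ μ, 0 < μ → ∀ p ∈ Γ, P μ (p.1 - μ⁻¹ • p.2) = p.1

/-- The inequality is a closed condition on `p`. The map `j` allows a weaker norm: it is used with
the identity and with the inclusion of `L_C` in `L_c`. -/
theorem dissipative_topologicalClosure (j : E →L[ℝ] F) {M : Submodule ℝ (E × E)} {μ : ℝ}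
    (h : ∀ p ∈ M, ‖j p.1‖ ≤ ‖j (p.1 - μ⁻¹ • p.2)‖) :
    ∀ p ∈ M.topologicalClosure, ‖j p.1‖ ≤ ‖j (p.1 - μ⁻¹ • p.2)‖ := by
  intro p hp
  have hc : IsClosed {p : E × E | ‖j p.1‖ ≤ ‖j (p.1 - μ⁻¹ • p.2)‖} :=
    isClosed_le (by fun_prop) (by fun_prop)
  exact closure_minimal (s := (M : Set (E × E))) h hc hp

/-- The Lumer–Phillips argument. On the closed graph, `p ↦ p.1 - μ⁻¹ • p.2` is bounded below by
dissipativity, so its range is closed; being dense, it is everything. Then `P μ` is the first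
component of the inverse. -/
theorem exists_resolvent_of_dissipative [CompleteSpace E] (M : Submodule ℝ (E × E))
    (hdiss : ∀ μ : ℝ, 0 < μ → ∀ p ∈ M, ‖p.1‖ ≤ ‖p.1 - μ⁻¹ • p.2‖)
    (hrange : ∀ μ : ℝ, 0 < μ → ∀ f : E, f ∈ closure ((fun p : E × E => p.1 - μ⁻¹ • p.2) '' M)) :
    ∃ P, IsResolvent M.topologicalClosure P := by
  set Γ := M.topologicalClosure with hΓ
  have hΓc : IsClosed (Γ : Set (E × E)) := M.isClosed_topologicalClosure
  have : CompleteSpace Γ := hΓc.completeSpace_coe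
  have hd : ∀ μ : ℝ, 0 < μ → ∀ p ∈ Γ, ‖p.1‖ ≤ ‖p.1 - μ⁻¹ • p.2‖ := fun μ hμ p hp =>
    dissipative_topologicalClosure (ContinuousLinearMap.id ℝ E) (hdiss μ hμ) p hp
  have key : ∀ μ : ℝ, 0 < μ → ∃ P : E →L[ℝ] E, ‖P‖ ≤ 1 ∧ (∀ f, (P f, μ • (P f - f)) ∈ Γ) ∧
      ∀ p ∈ Γ, P (p.1 - μ⁻¹ • p.2) = p.1 := by
    intro μ hμ
    let Ψ : Γ →L[ℝ] E :=
      (ContinuousLinearMap.fst ℝ E E - μ⁻¹ • ContinuousLinearMap.snd ℝ E E).comp Γ.subtypeL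
    have hΨ : ∀ p : Γ, Ψ p = p.1.1 - μ⁻¹ • p.1.2 := fun p => rfl
    have h1 : ∀ p : Γ, ‖p.1.1‖ ≤ ‖Ψ p‖ := fun p => hd μ hμ p.1 p.2
    have h2 : ∀ p : Γ, p.1.2 = μ • (p.1.1 - Ψ p) := fun p => by
      rw [hΨ, sub_sub_cancel, smul_inv_smul₀ hμ.ne']
    -- Dissipativity controls `p.1`; solving `Ψ p` for `p.2` then costs the extra factor `2μ`.
    have hanti : AntilipschitzWith (Real.toNNReal (1 + 2 * μ)) Ψ := by
      refine ContinuousLinearMap.antilipschitz_of_bound Ψ fun p => ?_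
      rw [Real.coe_toNNReal _ (by positivity)]
      have h3 : ‖p.1.2‖ ≤ μ * (2 * ‖Ψ p‖) := by
        rw [h2, norm_smul, Real.norm_of_nonneg hμ.le]
        gcongr
        calc ‖p.1.1 - Ψ p‖ ≤ ‖p.1.1‖ + ‖Ψ p‖ := norm_sub_le _ _
          _ ≤ 2 * ‖Ψ p‖ := by linarith [h1 p]
      have h4 : ‖p‖ = max ‖p.1.1‖ ‖p.1.2‖ := rfl
      rw [h4]
      refine max_le ?_ ?_ <;> nlinarith [h1 p, norm_nonneg (Ψ p)]
    have hcl : IsClosed (Set.range Ψ) := hanti.isClosed_range Ψ.uniformContinuous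
    have hsurj : Function.Surjective Ψ := by
      intro f
      have : f ∈ closure (Set.range Ψ) := by
        refine closure_mono ?_ (hrange μ hμ f)
        rintro _ ⟨p, hp, rfl⟩
        exact ⟨⟨p, M.le_topologicalClosure hp⟩, rfl⟩
      rwa [hcl.closure_eq] at this
    let e : Γ ≃ₗ[ℝ] E := LinearEquiv.ofBijective Ψ.toLinearMap ⟨hanti.injective, hsurj⟩
    have he : ∀ p, e p = Ψ p := fun p => rfl
    let P : E →L[ℝ] E := LinearMap.mkContinuous
      ((LinearMap.fst ℝ E E).comp (Γ.subtype.comp e.symm.toLinearMap)) 1 (fun f => by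
        have := h1 (e.symm f)
        rw [← he, e.apply_symm_apply] at this
        simpa using this)
    have hP : ∀ f, P f = (e.symm f).1.1 := fun f => rfl
    refine ⟨P, LinearMap.mkContinuous_norm_le _ zero_le_one _, fun f => ?_, fun p hp => ?_⟩
    · have h5 : μ • (P f - f) = (e.symm f).1.2 := by
        rw [h2, ← he, e.apply_symm_apply, hP]
      rw [h5, hP]
      exact (e.symm f).2
    · have h6 : p.1 - μ⁻¹ • p.2 = e ⟨p, hp⟩ := rfl
      rw [h6, hP, e.symm_apply_apply]
  choose! P hP using key
  exact ⟨P, fun μ hμ => (hP μ hμ).1, fun μ hμ => (hP μ hμ).2.1, fun μ hμ => (hP μ hμ).2.2⟩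

/-! ### Yosida approximations and the Hille–Yosida theorem -/

section Resolvent

variable {Γ : Submodule ℝ (E × E)} {P : ℝ → E →L[ℝ] E}

theorem IsResolvent.norm_apply_le (h : IsResolvent Γ P) {μ : ℝ} (hμ : 0 < μ) (x : E) :
    ‖P μ x‖ ≤ ‖x‖ := by
  simpa using (P μ).le_of_opNorm_le (h.norm_le μ hμ) x

/-- The resolvent identity `(ν - μ) P_ν P_μ = ν P_μ - μ P_ν` has a right side that only changes sign
when `μ` and `ν` are exchanged. -/
theorem IsResolvent.commute (h : IsResolvent Γ P) {μ ν : ℝ} (hμ : 0 < μ) (hν : 0 < ν) :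
    Commute (P μ) (P ν) := by
  rcases eq_or_ne μ ν with rfl | hne
  · exact Commute.refl _
  have key : ∀ {μ ν : ℝ}, 0 < μ → 0 < ν → ∀ f,
      (ν - μ) • P ν (P μ f) = ν • P μ f - μ • P ν f := by
    intro μ ν hμ hν f
    have h1 := h.apply ν hν _ (h.mem μ hμ f)
    simp only [map_sub, map_smul] at h1
    have h2 : ν • P ν (P μ f) - μ • (P ν (P μ f) - P ν f) = ν • P μ f := by
      have h3 := congrArg (fun v => ν • v) h1
      simpa only [smul_sub, smul_inv_smul₀ hν.ne'] using h3
    rw [← h2, sub_smul, smul_sub]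
    abel
  ext f
  have h1 := key hμ hν f
  have h2 := key hν hμ f
  have h3 : (ν - μ) • P μ (P ν f) = (ν - μ) • P ν (P μ f) := by
    rw [h1, ← neg_sub μ ν, neg_smul, h2, neg_sub]
  exact smul_right_injective E (sub_ne_zero.2 hne.symm) h3

/-- The Yosida approximation `μ (P μ - 1)`. -/
def yosida (P : ℝ → E →L[ℝ] E) (μ : ℝ) : E →L[ℝ] E := μ • (P μ - 1)

/-- The left side is the mean of `Q n` under the Poisson law of parameter `s`, and the mean of `a +
nb` is `a + sb`. -/
theorem norm_exp_neg_smul_le_of_hasSum {s a b : ℝ} (hs : 0 ≤ s) {Q : ℕ → F} {S : F}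
    (h : HasSum (fun n : ℕ => ((n.factorial : ℝ)⁻¹ * s ^ n) • Q n) S)
    (hQ : ∀ n, ‖Q n‖ ≤ a + n * b) : ‖Real.exp (-s) • S‖ ≤ a + s * b := by
  have h0 : HasSum (fun n : ℕ => (n.factorial : ℝ)⁻¹ * s ^ n) (Real.exp s) := by
    have := NormedSpace.expSeries_div_hasSum_exp (𝔸 := ℝ) s
    rw [← Real.exp_eq_exp_ℝ] at this
    simpa [div_eq_inv_mul] using this
  have h1 : HasSum (fun n : ℕ => (n.factorial : ℝ)⁻¹ * s ^ n * n) (s * Real.exp s) := by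
    rw [← hasSum_nat_add_iff' 1]
    simp only [Finset.sum_range_one, Nat.cast_zero, mul_zero, sub_zero]
    refine (congrArg (HasSum · _) (funext fun n => ?_)).mpr (h0.mul_left s)
    rw [Nat.factorial_succ]
    push_cast
    field_simp
    ring
  have h2 := (h0.mul_left a).add (h1.mul_left b)
  have h3 : ‖S‖ ≤ a * Real.exp s + b * (s * Real.exp s) := by
    refine h.norm_le_of_bounded h2 fun n => ?_
    rw [norm_smul, Real.norm_of_nonneg (by positivity)]
    calc _ ≤ (n.factorial : ℝ)⁻¹ * s ^ n * (a + n * b) := by gcongr; exact hQ n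
      _ = _ := by ring
  rw [norm_smul, Real.norm_of_nonneg (Real.exp_pos _).le]
  calc _ ≤ Real.exp (-s) * (a * Real.exp s + b * (s * Real.exp s)) := by gcongr
    _ = (Real.exp (-s) * Real.exp s) * (a + s * b) := by ring
    _ = a + s * b := by rw [← Real.exp_add]; simp

/-- The scalar part of `μ (P μ - 1)` commutes with everything and factors out. The result is a
Poisson average of the powers of `P μ`, so that bounds on powers become bounds on the semigroup. -/
theorem exp_smul_yosida [CompleteSpace E] (P : ℝ → E →L[ℝ] E) (t μ : ℝ) :
    NormedSpace.exp (t • yosida P μ) =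
      Real.exp (-(t * μ)) • NormedSpace.exp ((t * μ) • P μ) := by
  let _ : NormedAlgebra ℚ (E →L[ℝ] E) := NormedAlgebra.restrictScalars ℚ ℝ _
  have h1 : t • yosida P μ = algebraMap ℝ (E →L[ℝ] E) (-(t * μ)) + (t * μ) • P μ := by
    rw [yosida, Algebra.algebraMap_eq_smul_one]
    module
  rw [h1, NormedSpace.exp_add_of_commute (Algebra.commutes _ _),
    ← NormedSpace.algebraMap_exp_comm, ← Real.exp_eq_exp_ℝ, Algebra.algebraMap_eq_smul_one,
    smul_mul_assoc, one_mul]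

theorem hasSum_exp_smul_apply [CompleteSpace E] (j : E →L[ℝ] F) (A : E →L[ℝ] E) (s : ℝ) (x : E) :
    HasSum (fun n : ℕ => ((n.factorial : ℝ)⁻¹ * s ^ n) • j ((A ^ n) x))
      (j (NormedSpace.exp (s • A) x)) := by
  have h := NormedSpace.exp_series_hasSum_exp' (𝕂 := ℝ) (s • A)
  have h2 := (j.comp (ContinuousLinearMap.apply ℝ E x)).hasSum h
  refine (congrArg (HasSum · _) (funext fun n => ?_)).mp h2
  simp [smul_pow, smul_smul]

/-- A bound `n b / μ` averaged over a Poisson variable of mean `tμ` is `tb`: the dependence on `μ`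
cancels, so the estimate survives `μ → ∞`. -/
theorem norm_exp_yosida_sub_le [CompleteSpace E] {P₁ P₂ : ℝ → E →L[ℝ] E} (j : E →L[ℝ] F)
    {μ t b : ℝ} (hμ : 0 < μ) (ht : 0 ≤ t) (x : E)
    (h : ∀ n : ℕ, ‖j ((P₁ μ ^ n) x - (P₂ μ ^ n) x)‖ ≤ n * (b / μ)) :
    ‖j (NormedSpace.exp (t • yosida P₁ μ) x - NormedSpace.exp (t • yosida P₂ μ) x)‖ ≤ t * b := by
  have hs := (hasSum_exp_smul_apply j (P₁ μ) (t * μ) x).sub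
    (hasSum_exp_smul_apply j (P₂ μ) (t * μ) x)
  simp only [← smul_sub, ← map_sub] at hs
  have h1 := norm_exp_neg_smul_le_of_hasSum (a := 0) (b := b / μ) (by positivity) hs
    (fun n => by simpa using h n)
  rw [exp_smul_yosida, exp_smul_yosida]
  simp only [smul_apply, ← smul_sub, map_smul]
  refine h1.trans (le_of_eq ?_)
  field_simp
  ring

theorem norm_exp_yosida_le [CompleteSpace E] (j : E →L[ℝ] F) {μ t : ℝ} (hμ : 0 < μ) (ht : 0 ≤ t)
    (h : ∀ x, ‖j (P μ x)‖ ≤ ‖j x‖) (x : E) :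
    ‖j (NormedSpace.exp (t • yosida P μ) x)‖ ≤ ‖j x‖ := by
  have hn : ∀ n : ℕ, ‖j ((P μ ^ n) x)‖ ≤ ‖j x‖ := by
    intro n
    induction n with
    | zero => simp
    | succ n ih =>
      rw [pow_succ']
      exact (h _).trans ih
  have h1 := norm_exp_neg_smul_le_of_hasSum (a := ‖j x‖) (b := 0) (by positivity)
    (hasSum_exp_smul_apply j (P μ) (t * μ) x) (fun n => by simpa using hn n)
  rw [exp_smul_yosida]
  simpa using h1

/-- Telescoping `A^{n+1} - B^{n+1} = A (A^n - B^n) + (A - B) B^n`. Only `A` has to contract the weak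
norm given by `j`; for `B` the strong norm is enough. -/
theorem norm_pow_sub_pow_le {A B : E →L[ℝ] E} (j : E →L[ℝ] F) {b : ℝ}
    (hA : ∀ x, ‖j (A x)‖ ≤ ‖j x‖) (hB : ∀ x, ‖B x‖ ≤ ‖x‖) (hb : 0 ≤ b)
    (h : ∀ x, ‖j (A x - B x)‖ ≤ b * ‖x‖) (n : ℕ) (x : E) :
    ‖j ((A ^ n) x - (B ^ n) x)‖ ≤ n * (b * ‖x‖) := by
  have hBn : ∀ n : ℕ, ‖(B ^ n) x‖ ≤ ‖x‖ := by
    intro n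
    induction n with
    | zero => simp
    | succ n ih =>
      rw [pow_succ']
      exact (hB _).trans ih
  induction n with
  | zero => simp
  | succ n ih =>
    have : (A ^ (n + 1)) x - (B ^ (n + 1)) x =
        A ((A ^ n) x - (B ^ n) x) + (A ((B ^ n) x) - B ((B ^ n) x)) := by
      rw [pow_succ', pow_succ', map_sub]
      simp
    rw [this, map_add]
    refine (norm_add_le _ _).trans ?_
    have h1 := (hA ((A ^ n) x - (B ^ n) x)).trans ih
    have h2 := (h ((B ^ n) x)).trans (mul_le_mul_of_nonneg_left (hBn n) hb)
    rw [Nat.cast_succ]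
    linarith

theorem tendsto_zero_of_dense {ι : Type*} {l : Filter ι} {B : ι → E →L[ℝ] F} {K : ℝ}
    (hB : ∀ᶠ i in l, ∀ x, ‖B i x‖ ≤ K * ‖x‖) {D : Set E} (hD : Dense D)
    (h : ∀ x ∈ D, Tendsto (fun i => B i x) l (𝓝 0)) (x : E) :
    Tendsto (fun i => B i x) l (𝓝 0) := by
  rw [Metric.tendsto_nhds]
  intro ε hε
  have hK : 0 < 2 * (|K| + 1) := by positivity
  obtain ⟨y, hy, hxy⟩ := Metric.mem_closure_iff.1 (hD x) (ε / (2 * (|K| + 1))) (by positivity)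
  filter_upwards [hB, Metric.tendsto_nhds.1 (h y hy) (ε / 2) (by positivity)] with i h1 h2
  rw [dist_zero_right] at h2 ⊢
  rw [dist_eq_norm, lt_div_iff₀ hK] at hxy
  have h3 : ‖B i (x - y)‖ ≤ |K| * ‖x - y‖ :=
    (h1 _).trans (mul_le_mul_of_nonneg_right (le_abs_self K) (norm_nonneg _))
  have h4 : B i x = B i (x - y) + B i y := by rw [map_sub, sub_add_cancel]
  have h5 := norm_add_le (B i (x - y)) (B i y)
  rw [h4]
  nlinarith [norm_nonneg (x - y)]

/-- The path `s ↦ e^{s(a-b)} e^b x` joins `e^b x` to `e^a x`. By commutation its derivative is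
`e^{sa} e^{(1-s)b} (a - b) x`, a product of contractions applied to `(a - b) x`. -/
theorem norm_exp_sub_exp_le [CompleteSpace E] {a b : E →L[ℝ] E} (hab : Commute a b)
    (ha : ∀ s : ℝ, 0 ≤ s → ∀ x, ‖NormedSpace.exp (s • a) x‖ ≤ ‖x‖)
    (hb : ∀ s : ℝ, 0 ≤ s → ∀ x, ‖NormedSpace.exp (s • b) x‖ ≤ ‖x‖) (x : E) :
    ‖NormedSpace.exp a x - NormedSpace.exp b x‖ ≤ ‖a x - b x‖ := by
  let _ : NormedAlgebra ℚ (E →L[ℝ] E) := NormedAlgebra.restrictScalars ℚ ℝ _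
  have hcb : Commute (a - b) b := hab.sub_left (Commute.refl b)
  have hexp : ∀ s : ℝ, NormedSpace.exp (s • (a - b)) * NormedSpace.exp b =
      NormedSpace.exp (s • a) * NormedSpace.exp ((1 - s) • b) := by
    intro s
    rw [← NormedSpace.exp_add_of_commute (hcb.smul_left s),
      ← NormedSpace.exp_add_of_commute ((hab.smul_left s).smul_right (1 - s))]
    congr 1
    module
  have hder : ∀ s ∈ Set.Icc (0 : ℝ) 1, HasDerivWithinAt
      (fun s : ℝ => NormedSpace.exp (s • (a - b)) (NormedSpace.exp b x))
      ((NormedSpace.exp (s • (a - b)) * (a - b)) (NormedSpace.exp b x)) (Set.Icc (0 : ℝ) 1) s := by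
    intro s _
    have h1 := (hasDerivAt_exp_smul_const (𝕂 := ℝ) (a - b) s).hasDerivWithinAt (s := Set.Icc 0 1)
    exact ((ContinuousLinearMap.apply ℝ E (NormedSpace.exp b x)).hasFDerivAt.comp_hasDerivWithinAt
      s h1)
  have h := norm_image_sub_le_of_norm_deriv_le_segment_01' hder (C := ‖a x - b x‖) (by
    intro s hs
    have h2 : (NormedSpace.exp (s • (a - b)) * (a - b)) * NormedSpace.exp b =
        NormedSpace.exp (s • a) * NormedSpace.exp ((1 - s) • b) * (a - b) := by
      rw [← hexp, mul_assoc, mul_assoc, (hcb.exp_right).eq]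
    have h3 : (NormedSpace.exp (s • (a - b)) * (a - b)) (NormedSpace.exp b x) =
        NormedSpace.exp (s • a) (NormedSpace.exp ((1 - s) • b) (a x - b x)) :=
      congrArg (fun T : E →L[ℝ] E => T x) h2
    rw [h3]
    exact (ha s hs.1 _).trans (hb (1 - s) (by linarith [hs.2]) _))
  simp only [one_smul, zero_smul, NormedSpace.exp_zero] at h
  have h4 := hexp 1
  simp only [one_smul, sub_self, zero_smul, NormedSpace.exp_zero, mul_one] at h4
  have h5 : NormedSpace.exp (a - b) (NormedSpace.exp b x) = NormedSpace.exp a x :=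
    congrArg (fun T : E →L[ℝ] E => T x) h4
  rw [h5] at h
  exact h

/-- Mean value inequality for `s ↦ e^{sa} x - s a x`, whose derivative is `e^{sa} (a x) - a x`. -/
theorem norm_exp_sub_sub_le [CompleteSpace E] {a : E →L[ℝ] E} {x : E} {S : ℝ}
    (h : ∀ s ∈ Set.Ico (0 : ℝ) 1, ‖NormedSpace.exp (s • a) (a x) - a x‖ ≤ S) :
    ‖NormedSpace.exp a x - x - a x‖ ≤ S := by
  have hder : ∀ s ∈ Set.Icc (0 : ℝ) 1, HasDerivWithinAt
      (fun s : ℝ => NormedSpace.exp (s • a) x - s • a x)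
      (NormedSpace.exp (s • a) (a x) - a x) (Set.Icc (0 : ℝ) 1) s := by
    intro s _
    have h1 := (hasDerivAt_exp_smul_const (𝕂 := ℝ) a s).hasDerivWithinAt (s := Set.Icc 0 1)
    have h2 := ((ContinuousLinearMap.apply ℝ E x).hasFDerivAt.comp_hasDerivWithinAt s h1)
    have h3 := ((hasDerivAt_id s).smul_const (a x)).hasDerivWithinAt (s := Set.Icc (0 : ℝ) 1)
    rw [one_smul] at h3
    exact h2.sub h3
  have h1 := norm_image_sub_le_of_norm_deriv_le_segment_01' hder h
  simp only [one_smul, zero_smul, NormedSpace.exp_zero, sub_zero] at h1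
  convert h1 using 2
  simp only [one_apply_eq_self]
  abel

namespace IsResolvent

theorem yosida_apply (h : IsResolvent Γ P) {μ : ℝ} (hμ : 0 < μ) {p : E × E} (hp : p ∈ Γ) :
    yosida P μ p.1 = P μ p.2 := by
  have h1 := congrArg (fun v => μ • v) (h.apply μ hμ p hp)
  simp only [map_sub, map_smul, smul_sub, smul_inv_smul₀ hμ.ne'] at h1
  simp only [yosida, smul_apply, sub_apply, one_apply_eq_self,
    smul_sub]
  rw [← h1]
  abel

/-- On the domain of `A`, `P μ x - x = μ⁻¹ P μ (A x) → 0`; uniform boundedness and density extend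
this to all `x`. -/
theorem tendsto_apply (h : IsResolvent Γ P) (hd : Dense (Prod.fst '' (Γ : Set (E × E)))) (x : E) :
    Tendsto (fun μ => P μ x) atTop (𝓝 x) := by
  have h1 : Tendsto (fun μ => (P μ - 1) x) atTop (𝓝 0) := by
    refine tendsto_zero_of_dense (K := 2) ?_ hd ?_ x
    · filter_upwards [eventually_gt_atTop 0] with μ hμ x
      calc ‖P μ x - x‖ ≤ ‖P μ x‖ + ‖x‖ := norm_sub_le _ _
        _ ≤ 2 * ‖x‖ := by linarith [h.norm_apply_le hμ x]
    · rintro _ ⟨p, hp, rfl⟩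
      have h2 : Tendsto (fun μ : ℝ => μ⁻¹ * ‖p.2‖) atTop (𝓝 0) := by
        simpa using tendsto_inv_atTop_zero.mul_const ‖p.2‖
      refine squeeze_zero_norm' ?_ h2
      filter_upwards [eventually_gt_atTop 0] with μ hμ
      have h3 : (P μ - 1) p.1 = μ⁻¹ • P μ p.2 := by
        rw [← h.yosida_apply hμ hp, yosida, smul_apply, inv_smul_smul₀ hμ.ne']
      rw [h3, norm_smul, norm_inv, Real.norm_of_nonneg hμ.le]
      gcongr
      exact h.norm_apply_le hμ _
  simpa using h1.add_const x

variable [CompleteSpace E]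

theorem norm_exp_le (h : IsResolvent Γ P) {μ t : ℝ} (hμ : 0 < μ) (ht : 0 ≤ t) (x : E) :
    ‖NormedSpace.exp (t • yosida P μ) x‖ ≤ ‖x‖ :=
  norm_exp_yosida_le (ContinuousLinearMap.id ℝ E) hμ ht (h.norm_apply_le hμ) x

theorem norm_exp_sub_le (h : IsResolvent Γ P) {μ t : ℝ} (hμ : 0 < μ) (ht : 0 ≤ t) (x : E) :
    ‖NormedSpace.exp (t • yosida P μ) x - x‖ ≤ t * ‖yosida P μ x‖ := by
  have h1 := norm_exp_sub_exp_le (a := t • yosida P μ) (b := 0) (Commute.zero_right _)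
    (fun s hs x => by rw [smul_smul]; exact h.norm_exp_le hμ (by positivity) x)
    (fun s hs x => by simp) x
  simpa [norm_smul, abs_of_nonneg ht] using h1

/-- The Yosida approximations commute, so for `(x, y)` in the graph two exponentials at `x` differ
by at most `t ‖P μ y - P ν y‖`, which tends to `0`. -/
theorem cauchy_exp (h : IsResolvent Γ P) (hd : Dense (Prod.fst '' (Γ : Set (E × E)))) {t : ℝ}
    (ht : 0 ≤ t) (x : E) :
    ∃ y, Tendsto (fun μ => NormedSpace.exp (t • yosida P μ) x) atTop (𝓝 y) := by
  refine cauchy_map_iff_exists_tendsto.1 ?_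
  refine cauchy_map_iff.2 ⟨inferInstance, ?_⟩
  rw [uniformity_eq_comap_nhds_zero, tendsto_comap_iff]
  have hpos : ∀ᶠ q : ℝ × ℝ in atTop ×ˢ atTop, 0 < q.1 ∧ 0 < q.2 :=
    (eventually_gt_atTop 0).prod_mk (eventually_gt_atTop 0)
  refine tendsto_zero_of_dense (K := 2)
    (B := fun q : ℝ × ℝ => NormedSpace.exp (t • yosida P q.2) - NormedSpace.exp (t • yosida P q.1))
    ?_ hd ?_ x
  · filter_upwards [hpos] with q hq x
    calc ‖NormedSpace.exp (t • yosida P q.2) x - NormedSpace.exp (t • yosida P q.1) x‖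
        ≤ ‖NormedSpace.exp (t • yosida P q.2) x‖ + ‖NormedSpace.exp (t • yosida P q.1) x‖ :=
          norm_sub_le _ _
      _ ≤ 2 * ‖x‖ := by linarith [h.norm_exp_le hq.1 ht x, h.norm_exp_le hq.2 ht x]
  · rintro _ ⟨p, hp, rfl⟩
    have h1 : Tendsto (fun q : ℝ × ℝ => t * ‖P q.2 p.2 - P q.1 p.2‖) (atTop ×ˢ atTop) (𝓝 0) := by
      have h2 := ((h.tendsto_apply hd p.2).comp tendsto_snd).sub
        ((h.tendsto_apply hd p.2).comp (tendsto_fst (f := atTop (α := ℝ)) (g := atTop (α := ℝ))))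
      simpa using (h2.norm).const_mul t
    refine squeeze_zero_norm' ?_ h1
    filter_upwards [hpos] with q hq
    have hc : Commute (yosida P q.2) (yosida P q.1) :=
      (((h.commute hq.2 hq.1).sub_left (Commute.one_left _)).sub_right
        (Commute.one_right _)).smul_left _ |>.smul_right _
    have h3 := norm_exp_sub_exp_le (a := t • yosida P q.2) (b := t • yosida P q.1)
      ((hc.smul_left t).smul_right t)
      (fun s hs x => by rw [smul_smul]; exact h.norm_exp_le hq.2 (by positivity) x)
      (fun s hs x => by rw [smul_smul]; exact h.norm_exp_le hq.1 (by positivity) x) p.1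
    refine h3.trans (le_of_eq ?_)
    rw [smul_apply, smul_apply, h.yosida_apply hq.1 hp, h.yosida_apply hq.2 hp, ← smul_sub,
      norm_smul, Real.norm_of_nonneg ht]

end IsResolvent

/-- `T(t) x = lim exp(t A_μ) x` for the Yosida approximations `A_μ`. -/
def IsYosidaLimit (P : ℝ → E →L[ℝ] E) (T : ContractionSemigroup E) : Prop :=
  ∀ (t : ℝ≥0) (x : E),
    Tendsto (fun μ => NormedSpace.exp ((t : ℝ) • yosida P μ) x) atTop (𝓝 (T.op t x))

theorem ContractionSemigroup.norm_op_le (T : ContractionSemigroup E) (t : ℝ≥0) (x : E) :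
    ‖T.op t x‖ ≤ ‖x‖ := by
  simpa using (T.op t).le_of_opNorm_le (T.norm_le t) x

/-- A generator has no proper extension that is a generator. -/
theorem ContractionSemigroup.generatorGraph_eq (T : ContractionSemigroup E) (h : IsResolvent Γ P)
    (hΓ : (Γ : Set (E × E)) ⊆ T.generatorGraph) : T.generatorGraph = Γ := by
  refine Set.Subset.antisymm ?_ hΓ
  rintro ⟨x, y⟩ hxy
  -- `x'` solves `(1 - A) x' = x - y` inside `Γ`, as `x` does for the generator. Hence `u = x - x'`
  -- satisfies `A u = u`, and dissipativity `‖u‖ ≤ ‖u - A u‖` forces `u = 0`.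
  have hq := h.mem 1 one_pos (x - y)
  set x' := P 1 (x - y) with hx'
  have h1 : Tendsto (fun t : ℝ≥0 => (t : ℝ)⁻¹ • (T.op t (x - x') - (x - x'))) (𝓝[>] 0)
      (𝓝 (x - x')) := by
    have h2 := (show Tendsto _ _ _ from hxy).sub (show Tendsto _ _ _ from hΓ hq)
    simp only [one_smul, ← smul_sub, map_sub] at h2 ⊢
    convert h2 using 2
    · congr 1; abel
    · abel
  set u := x - x' with hu
  have h0 : u = 0 := by
    have h3 : Tendsto (fun t : ℝ≥0 => ‖u + (t : ℝ)⁻¹ • (T.op t u - u)‖) (𝓝[>] 0) (𝓝 ‖u + u‖) :=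
      (h1.const_add u).norm
    have h4 : Tendsto (fun t : ℝ≥0 => ‖u - (t : ℝ)⁻¹ • (T.op t u - u)‖) (𝓝[>] 0) (𝓝 ‖u - u‖) :=
      (h1.const_sub u).norm
    have h5 : ‖u‖ ≤ ‖u - u‖ := by
      refine ge_of_tendsto h4 ?_
      filter_upwards [self_mem_nhdsWithin] with t ht
      have ht' : 0 < (t : ℝ) := ht
      have h6 : u - (t : ℝ)⁻¹ • (T.op t u - u) = (1 + (t : ℝ)⁻¹) • u - (t : ℝ)⁻¹ • T.op t u := by
        module
      have h7 : ‖(1 + (t : ℝ)⁻¹) • u‖ - ‖(t : ℝ)⁻¹ • T.op t u‖ ≤ _ := norm_sub_norm_le _ _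
      rw [← h6, norm_smul, norm_smul, Real.norm_of_nonneg (by positivity),
        Real.norm_of_nonneg (by positivity)] at h7
      have h8 := mul_le_mul_of_nonneg_left (T.norm_op_le t u) (inv_nonneg.2 ht'.le)
      nlinarith
    simpa using h5
  have hxx : x = x' := sub_eq_zero.1 h0
  have hyy : (1 : ℝ) • (x' - (x - y)) = y := by rw [← hxx, one_smul]; abel
  have : (x, y) = (x', (1 : ℝ) • (x' - (x - y))) := by rw [hyy, ← hxx]
  rw [this]
  exact hq

/-- The Hille–Yosida theorem for contraction semigroups. -/
theorem IsResolvent.exists_semigroup [CompleteSpace E] (h : IsResolvent Γ P)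
    (hd : Dense (Prod.fst '' (Γ : Set (E × E)))) :
    ∃ T : ContractionSemigroup E, T.generatorGraph = Γ ∧ IsYosidaLimit P T := by
  let _ : NormedAlgebra ℚ (E →L[ℝ] E) := NormedAlgebra.restrictScalars ℚ ℝ _
  have hex : ∀ (t : ℝ≥0) (x : E), ∃ y,
      Tendsto (fun μ => NormedSpace.exp ((t : ℝ) • yosida P μ) x) atTop (𝓝 y) :=
    fun t x => h.cauchy_exp hd t.coe_nonneg x
  choose S hS using hex
  let op : ℝ≥0 → E →L[ℝ] E := fun t => continuousLinearMapOfTendsto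
    (fun μ : ℝ => NormedSpace.exp ((t : ℝ) • yosida P μ)) (f := S t) (l := atTop)
    (tendsto_pi_nhds.2 (hS t))
  have hop : ∀ (t : ℝ≥0) (x : E), Tendsto (fun μ => NormedSpace.exp ((t : ℝ) • yosida P μ) x) atTop
    (𝓝 (op t x)) := hS
  have hle : ∀ t x, ‖op t x‖ ≤ ‖x‖ := fun t x => by
    refine le_of_tendsto (hop t x).norm ?_
    filter_upwards [eventually_gt_atTop 0] with μ hμ
    exact h.norm_exp_le hμ t.coe_nonneg x
  have hsub : ∀ (t : ℝ≥0), ∀ p ∈ Γ, ‖op t p.1 - p.1‖ ≤ t * ‖p.2‖ := fun t p hp => by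
    refine le_of_tendsto ((hop t p.1).sub_const p.1).norm ?_
    filter_upwards [eventually_gt_atTop 0] with μ hμ
    refine (h.norm_exp_sub_le hμ t.coe_nonneg p.1).trans ?_
    rw [h.yosida_apply hμ hp]
    gcongr
    exact h.norm_apply_le hμ _
  have hcont : ∀ x, Tendsto (fun t => op t x - x) (𝓝 0) (𝓝 0) := by
    intro x
    refine tendsto_zero_of_dense (K := 2) (B := fun t => op t - 1) ?_ hd ?_ x
    · refine Eventually.of_forall fun t x => ?_
      calc ‖op t x - x‖ ≤ ‖op t x‖ + ‖x‖ := norm_sub_le _ _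
        _ ≤ 2 * ‖x‖ := by linarith [hle t x]
    · rintro _ ⟨p, hp, rfl⟩
      have h2 : Tendsto (fun t : ℝ≥0 => (t : ℝ) * ‖p.2‖) (𝓝 0) (𝓝 0) := by
        have : Tendsto (fun t : ℝ≥0 => (t : ℝ)) (𝓝 0) (𝓝 0) :=
          NNReal.continuous_coe.tendsto' 0 0 NNReal.coe_zero
        simpa using this.mul_const ‖p.2‖
      exact squeeze_zero_norm (fun t => hsub t p hp) h2
  let T : ContractionSemigroup E :=
    { op := op
      op_zero := by
        ext x
        refine tendsto_nhds_unique (hop 0 x) ?_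
        simp
      op_add := by
        intro s t
        ext x
        refine tendsto_nhds_unique (hop (s + t) x) ?_
        -- Since the exponentials contract, the inner approximation may be replaced by its limit
        -- before the outer limit is taken.
        have h1 : Tendsto (fun μ => NormedSpace.exp ((s : ℝ) • yosida P μ)
            (NormedSpace.exp ((t : ℝ) • yosida P μ) x - op t x)) atTop (𝓝 0) := by
          have h2 := ((hop t x).sub_const (op t x)).norm
          rw [sub_self, norm_zero] at h2
          refine squeeze_zero_norm' ?_ h2
          filter_upwards [eventually_gt_atTop 0] with μ hμ
          exact h.norm_exp_le hμ s.coe_nonneg _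
        have h3 := h1.add (hop s (op t x))
        rw [zero_add] at h3
        refine h3.congr fun μ => ?_
        rw [map_sub, sub_add_cancel, NNReal.coe_add, add_smul, NormedSpace.exp_add_of_commute
          (((Commute.refl _).smul_left _).smul_right _)]
        rfl
      norm_le := fun t => ContinuousLinearMap.opNorm_le_bound _ zero_le_one
        (fun x => by rw [one_mul]; exact hle t x)
      strongCont := fun x => by simpa using (hcont x).add_const x }
  refine ⟨T, T.generatorGraph_eq h ?_, hop⟩
  rintro p hp
  -- `‖T(t) x - x - t y‖ ≤ t (2 ‖y - q‖ + t ‖A q‖)` for all `q` in the domain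
  have key : ∀ t : ℝ≥0, ∀ q ∈ Γ, ‖op t p.1 - p.1 - (t : ℝ) • p.2‖ ≤
      t * (2 * ‖p.2 - q.1‖ + t * ‖q.2‖) := by
    intro t q hq
    have hlim : Tendsto (fun μ => ‖NormedSpace.exp ((t : ℝ) • yosida P μ) p.1 - p.1
        - (t : ℝ) • P μ p.2‖) atTop (𝓝 ‖op t p.1 - p.1 - (t : ℝ) • p.2‖) :=
      (((hop t p.1).sub_const _).sub ((h.tendsto_apply hd p.2).const_smul (t : ℝ))).norm
    refine le_of_tendsto hlim ?_
    filter_upwards [eventually_gt_atTop 0] with μ hμ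
    have h1 : ((t : ℝ) • yosida P μ) p.1 = (t : ℝ) • P μ p.2 := by
      rw [smul_apply, h.yosida_apply hμ hp]
    rw [← h1]
    refine norm_exp_sub_sub_le fun s hs => ?_
    rw [h1, map_smul, ← smul_sub, norm_smul, Real.norm_of_nonneg t.coe_nonneg, smul_smul]
    refine mul_le_mul_of_nonneg_left ?_ t.coe_nonneg
    have hst : 0 ≤ s * (t : ℝ) := mul_nonneg hs.1 t.coe_nonneg
    have hst' : s * (t : ℝ) ≤ t := mul_le_of_le_one_left t.coe_nonneg hs.2.le
    have hc : Commute (NormedSpace.exp ((s * (t : ℝ)) • yosida P μ)) (P μ) :=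
      ((((Commute.refl (P μ)).sub_left (Commute.one_left _)).smul_left μ).smul_left _).exp_left
    have h2 : NormedSpace.exp ((s * (t : ℝ)) • yosida P μ) (P μ p.2) =
        P μ (NormedSpace.exp ((s * (t : ℝ)) • yosida P μ) p.2) :=
      congrArg (fun T : E →L[ℝ] E => T p.2) hc.eq
    rw [h2, ← map_sub]
    refine (h.norm_apply_le hμ _).trans ?_
    have h3 : NormedSpace.exp ((s * (t : ℝ)) • yosida P μ) p.2 - p.2 =
        NormedSpace.exp ((s * (t : ℝ)) • yosida P μ) (p.2 - q.1) - (p.2 - q.1) +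
          (NormedSpace.exp ((s * (t : ℝ)) • yosida P μ) q.1 - q.1) := by
      rw [map_sub]; abel
    rw [h3]
    refine (norm_add_le _ _).trans (add_le_add ?_ ?_)
    · refine (norm_sub_le _ _).trans ?_
      linarith [h.norm_exp_le hμ hst (p.2 - q.1)]
    · refine (h.norm_exp_sub_le hμ hst q.1).trans ?_
      rw [h.yosida_apply hμ hq]
      gcongr
      exact h.norm_apply_le hμ _
  change Tendsto (fun t : ℝ≥0 => (t : ℝ)⁻¹ • (op t p.1 - p.1)) (𝓝[>] 0) (𝓝 p.2)
  rw [Metric.tendsto_nhds]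
  intro ε hε
  -- `p.2` need not lie in the domain. It is replaced there by a nearby `q.1`; with `q` fixed, the
  -- remaining error `t ‖q.2‖` vanishes as `t → 0`.
  obtain ⟨_, ⟨q, hq, rfl⟩, hq'⟩ := Metric.mem_closure_iff.1 (hd p.2) (ε / 4) (by positivity)
  have h2 : Tendsto (fun t : ℝ≥0 => (t : ℝ) * ‖q.2‖) (𝓝[>] 0) (𝓝 0) := by
    have : Tendsto (fun t : ℝ≥0 => (t : ℝ)) (𝓝 0) (𝓝 0) :=
      NNReal.continuous_coe.tendsto' 0 0 NNReal.coe_zero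
    simpa using (this.mul_const ‖q.2‖).mono_left nhdsWithin_le_nhds
  filter_upwards [self_mem_nhdsWithin, h2.eventually_lt_const (show 0 < ε / 2 by positivity)]
    with t ht h3
  have ht' : 0 < (t : ℝ) := ht
  rw [dist_eq_norm] at hq' ⊢
  have h4 : (t : ℝ)⁻¹ • (op t p.1 - p.1) - p.2 =
      (t : ℝ)⁻¹ • (op t p.1 - p.1 - (t : ℝ) • p.2) := by
    rw [smul_sub _ _ ((t : ℝ) • p.2), inv_smul_smul₀ ht'.ne']
  rw [h4, norm_smul, norm_inv, Real.norm_of_nonneg ht'.le]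
  calc _ ≤ (t : ℝ)⁻¹ * (t * (2 * ‖p.2 - q.1‖ + t * ‖q.2‖)) := by gcongr; exact key t q hq
    _ = 2 * ‖p.2 - q.1‖ + t * ‖q.2‖ := by field_simp
    _ < ε := by linarith

/-! ### Comparison of semigroups through their resolvents -/

section Comparison

variable [CompleteSpace E] {T T₁ T₂ : ContractionSemigroup E} {P₁ P₂ : ℝ → E →L[ℝ] E}

theorem IsYosidaLimit.norm_apply_op_le (hT : IsYosidaLimit P T) (j : E →L[ℝ] F)
    (hj : ∀ μ, 0 < μ → ∀ x, ‖j (P μ x)‖ ≤ ‖j x‖) (t : ℝ≥0) (x : E) :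
    ‖j (T.op t x)‖ ≤ ‖j x‖ := by
  refine le_of_tendsto ((j.continuous.tendsto _).comp (hT t x)).norm ?_
  filter_upwards [eventually_gt_atTop 0] with μ hμ
  exact norm_exp_yosida_le j hμ t.coe_nonneg (hj μ hμ) x

/-- A weak-norm distance `K/μ` between the resolvents gives `nK/μ` between their `n`-th powers and,
after Poisson averaging, `tK` between the exponentials, uniformly in `μ`. -/
theorem IsYosidaLimit.norm_apply_op_sub_op_le (hT₁ : IsYosidaLimit P₁ T₁)
    (hT₂ : IsYosidaLimit P₂ T₂) (j : E →L[ℝ] F) {K : ℝ} (hK : 0 ≤ K)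
    (h₁ : ∀ μ, 0 < μ → ∀ x, ‖j (P₁ μ x)‖ ≤ ‖j x‖) (h₂ : ∀ μ, 0 < μ → ∀ x, ‖P₂ μ x‖ ≤ ‖x‖)
    (h : ∀ μ, 0 < μ → ∀ x, ‖j (P₁ μ x - P₂ μ x)‖ ≤ K / μ * ‖x‖) (t : ℝ≥0) (x : E) :
    ‖j (T₁.op t x - T₂.op t x)‖ ≤ t * (K * ‖x‖) := by
  refine le_of_tendsto ((j.continuous.tendsto _).comp ((hT₁ t x).sub (hT₂ t x))).norm ?_
  filter_upwards [eventually_gt_atTop 0] with μ hμ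
  refine norm_exp_yosida_sub_le j hμ t.coe_nonneg x fun n => ?_
  refine (norm_pow_sub_pow_le j (h₁ μ hμ) (h₂ μ hμ) (by positivity) (h μ hμ) n x).trans
    (le_of_eq ?_)
  ring

/-- Comparison with the constant semigroup, for which every `P μ` is the identity. -/
theorem IsYosidaLimit.norm_apply_op_sub_le (hT : IsYosidaLimit P T) (j : E →L[ℝ] F) {K : ℝ}
    (hK : 0 ≤ K) (h₁ : ∀ μ, 0 < μ → ∀ x, ‖j (P μ x)‖ ≤ ‖j x‖)
    (h : ∀ μ, 0 < μ → ∀ x, ‖j (P μ x - x)‖ ≤ K / μ * ‖x‖) (t : ℝ≥0) (x : E) :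
    ‖j (T.op t x - x)‖ ≤ t * (K * ‖x‖) := by
  let T₀ : ContractionSemigroup E :=
    { op := fun _ => ContinuousLinearMap.id ℝ E
      op_zero := rfl
      op_add := fun _ _ => rfl
      norm_le := fun _ => ContinuousLinearMap.norm_id_le
      strongCont := fun _ => tendsto_const_nhds }
  have hT₀ : IsYosidaLimit (fun _ => ContinuousLinearMap.id ℝ E) T₀ := by
    intro t x
    have h0 : ∀ μ, yosida (fun _ => ContinuousLinearMap.id ℝ E) μ = 0 := fun μ => by
      rw [yosida, ContinuousLinearMap.one_def, sub_self, smul_zero]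
    simp only [h0, smul_zero, NormedSpace.exp_zero]
    exact tendsto_const_nhds
  exact hT.norm_apply_op_sub_op_le hT₀ j hK h₁ (fun _ _ _ => le_rfl) h t x

end Comparison

/-- The pair `(P μ x, μ (P μ x - x))` lies in the closed graph, and `1 - μ⁻¹ A` maps it back to `x`.
-/
theorem IsResolvent.norm_apply_le_of_dissipative {M : Submodule ℝ (E × E)}
    (h : IsResolvent M.topologicalClosure P) (j : E →L[ℝ] F)
    (hj : ∀ μ : ℝ, 0 < μ → ∀ p ∈ M, ‖j p.1‖ ≤ ‖j (p.1 - μ⁻¹ • p.2)‖) {μ : ℝ} (hμ : 0 < μ) (x : E) :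
    ‖j (P μ x)‖ ≤ ‖j x‖ := by
  have h1 := dissipative_topologicalClosure j (hj μ hμ) _ (h.mem μ hμ x)
  simpa only [inv_smul_smul₀ hμ.ne', sub_sub_cancel] using h1

theorem IsResolvent.norm_apply_sub_le {M : Submodule ℝ (E × E)}
    (h : IsResolvent M.topologicalClosure P) (j : E →L[ℝ] F) {K : ℝ} (hK : 0 ≤ K)
    (hM : ∀ p ∈ M, ‖j p.2‖ ≤ K * ‖p.1‖) {μ : ℝ} (hμ : 0 < μ) (x : E) :
    ‖j (P μ x - x)‖ ≤ K / μ * ‖x‖ := by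
  have hc : IsClosed {p : E × E | ‖j p.2‖ ≤ K * ‖p.1‖} := isClosed_le (by fun_prop) (by fun_prop)
  have h1 : ‖j (μ • (P μ x - x))‖ ≤ K * ‖P μ x‖ :=
    closure_minimal (s := (M : Set (E × E))) hM hc (h.mem μ hμ x)
  rw [map_smul, norm_smul, Real.norm_of_nonneg hμ.le] at h1
  rw [div_mul_eq_mul_div, le_div_iff₀ hμ]
  nlinarith [mul_le_mul_of_nonneg_left (h.norm_apply_le hμ x) hK]

/-- A weak form of `P₁ - P₂ = μ⁻¹ P₁ (A₁ - A₂) P₂`. For `p` in the core of the second operator and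
`f = p.1 - μ⁻¹ • p.2`, weak dissipativity of the first is applied to `P₁ f - p.1`, whose image under
`1 - μ⁻¹ A₁` is `μ⁻¹ (A₁ - A₂) p.1`. The set of such `p` is closed, so `p.1` may be taken to be `P₂
x`. -/
theorem IsResolvent.norm_apply_sub_apply_le {M₁ M₂ : Submodule ℝ (E × E)}
    {P₁ P₂ : ℝ → E →L[ℝ] E} (h₁ : IsResolvent M₁.topologicalClosure P₁)
    (h₂ : IsResolvent M₂.topologicalClosure P₂) (j : E →L[ℝ] F) {K : ℝ} (hK : 0 ≤ K)
    (hj : ∀ μ : ℝ, 0 < μ → ∀ p ∈ M₁, ‖j p.1‖ ≤ ‖j (p.1 - μ⁻¹ • p.2)‖)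
    (hM : ∀ p ∈ M₂, ∃ y, (p.1, y) ∈ M₁ ∧ ‖j (y - p.2)‖ ≤ K * ‖p.1‖) {μ : ℝ} (hμ : 0 < μ) (x : E) :
    ‖j (P₁ μ x - P₂ μ x)‖ ≤ K / μ * ‖x‖ := by
  have hc : IsClosed {p : E × E |
      ‖j (P₁ μ (p.1 - μ⁻¹ • p.2) - p.1)‖ ≤ K / μ * ‖p.1‖} :=
    isClosed_le (by fun_prop) (by fun_prop)
  have h3 : ∀ p ∈ M₂, ‖j (P₁ μ (p.1 - μ⁻¹ • p.2) - p.1)‖ ≤ K / μ * ‖p.1‖ := by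
    intro p hp
    obtain ⟨y, hy, hyp⟩ := hM p hp
    set f := p.1 - μ⁻¹ • p.2 with hf
    have h4 := dissipative_topologicalClosure j (hj μ hμ) _
      (sub_mem (h₁.mem μ hμ f) (M₁.le_topologicalClosure hy))
    have h5 : P₁ μ f - p.1 - μ⁻¹ • (μ • (P₁ μ f - f) - y) = μ⁻¹ • (y - p.2) := by
      rw [smul_sub, inv_smul_smul₀ hμ.ne', smul_sub, hf]
      abel
    simp only [Prod.fst_sub, Prod.snd_sub] at h4
    rw [h5, map_smul, norm_smul, norm_inv, Real.norm_of_nonneg hμ.le] at h4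
    calc _ ≤ _ := h4
      _ ≤ μ⁻¹ * (K * ‖p.1‖) := by gcongr
      _ = _ := by ring
  have h6 : ‖j (P₁ μ (P₂ μ x - μ⁻¹ • μ • (P₂ μ x - x)) - P₂ μ x)‖ ≤ K / μ * ‖P₂ μ x‖ :=
    closure_minimal (s := (M₂ : Set (E × E))) h3 hc (h₂.mem μ hμ x)
  rw [inv_smul_smul₀ hμ.ne', sub_sub_cancel] at h6
  refine h6.trans ?_
  gcongr
  exact h₂.norm_apply_le hμ x

end Resolvent

end Semigroup

/-! ### Bounded functionals on `L¹` -/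

section DualLOne

variable {α : Type*} {m0 : MeasurableSpace α} {w : Measure α}

/-- Testing with `F = sign(g) (|g| - h)⁺` gives `∫ ((|g| - h)⁺)² ≤ 0`. Square integrability makes
all the integrals finite. -/
theorem abs_le_of_integral_mul_le {g h : α → ℝ} (hg : MemLp g 2 w) (hh : MemLp h 2 w)
    (hh0 : ∀ᵐ x ∂w, 0 ≤ h x)
    (H : ∀ F : α → ℝ, MemLp F 2 w → ∫ x, g x * F x ∂w ≤ ∫ x, |F x| * h x ∂w) :
    ∀ᵐ x ∂w, |g x| ≤ h x := by
  have hD : MemLp (fun x => max (|g x| - h x) 0) 2 w := (hg.abs.sub hh).pos_part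
  have hsm : AEStronglyMeasurable (fun x => (SignType.sign (g x) : ℝ)) w := by
    have h1 : Measurable fun y : ℝ => (SignType.sign y : ℝ) := by
      have : (fun y : ℝ => (SignType.sign y : ℝ)) =
          fun y => if 0 < y then 1 else if y < 0 then -1 else 0 := by
        ext y
        rw [sign_apply]
        split_ifs <;> simp
      rw [this]
      exact Measurable.ite measurableSet_Ioi measurable_const
        (Measurable.ite measurableSet_Iio measurable_const measurable_const)
    exact (h1.comp_aemeasurable hg.1.aemeasurable).aestronglyMeasurable
  have hF : MemLp (fun x => (SignType.sign (g x) : ℝ) * max (|g x| - h x) 0) 2 w := by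
    refine hD.mono ?_ (Eventually.of_forall fun x => ?_)
    · exact hsm.mul hD.1
    · rw [norm_mul]
      refine mul_le_of_le_one_left (norm_nonneg _) ?_
      rcases SignType.sign (g x) <;> simp
  have h1 := H _ hF
  have e1 : ∀ x, g x * ((SignType.sign (g x) : ℝ) * max (|g x| - h x) 0) =
      |g x| * max (|g x| - h x) 0 := fun x => by
    rw [← mul_assoc, self_mul_sign]
  have e2 : ∀ᵐ x ∂w, |(SignType.sign (g x) : ℝ) * max (|g x| - h x) 0| * h x =
      h x * max (|g x| - h x) 0 := by
    filter_upwards [hh0] with x hx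
    rcases eq_or_ne (g x) 0 with h0 | h0
    · simp [h0, hx]
    · have : |(SignType.sign (g x) : ℝ)| = 1 := by
        rcases lt_or_gt_of_ne h0 with h2 | h2
        · simp [sign_neg h2]
        · simp [sign_pos h2]
      rw [abs_mul, this, one_mul, abs_of_nonneg (le_max_right _ _), mul_comm]
  simp only [e1] at h1
  rw [integral_congr_ae e2] at h1
  have i1 : Integrable (fun x => |g x| * max (|g x| - h x) 0) w := hg.abs.integrable_mul hD
  have i2 : Integrable (fun x => h x * max (|g x| - h x) 0) w := hh.integrable_mul hD
  have h2 : ∫ x, max (|g x| - h x) 0 ^ 2 ∂w ≤ 0 := by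
    have h3 := integral_sub i1 i2
    have h4 : ∀ x, |g x| * max (|g x| - h x) 0 - h x * max (|g x| - h x) 0 =
        max (|g x| - h x) 0 ^ 2 := fun x => by
      rcases le_total 0 (|g x| - h x) with h5 | h5
      · rw [max_eq_left h5]; ring
      · rw [max_eq_right h5]; ring
    simp only [h4] at h3
    linarith
  have h5 : (fun x => max (|g x| - h x) 0 ^ 2) =ᵐ[w] 0 :=
    (integral_eq_zero_iff_of_nonneg (fun x => sq_nonneg _) hD.integrable_sq).1
      (le_antisymm h2 (integral_nonneg fun x => sq_nonneg _))
  filter_upwards [h5] with x hx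
  have : max (|g x| - h x) 0 = 0 := pow_eq_zero_iff two_ne_zero |>.1 hx
  linarith [le_max_left (|g x| - h x) 0]

variable {p : α → ℝ}

/-- Multiplication by the positive function `p ∈ L²` moves the bounded functions `κ`, `m` into `L²`,
and turns test functions `F ∈ L²` into elements `F p` of `L¹`. -/
theorem abs_le_of_pairing_le (hp : MemLp p 2 w) (hp0 : ∀ x, 0 < p x) {κ m : α → ℝ} {K : ℝ}
    (hκ : AEStronglyMeasurable κ w) (hm : AEStronglyMeasurable m w)
    (hκK : ∀ᵐ x ∂w, |κ x| ≤ K) (hmK : ∀ᵐ x ∂w, m x ≤ K) (hm0 : ∀ᵐ x ∂w, 0 ≤ m x)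
    (H : ∀ G : Lp ℝ 1 w, ∫ x, G x * κ x ∂w ≤ ∫ x, |G x| * m x ∂w) :
    ∀ᵐ x ∂w, |κ x| ≤ m x := by
  have h1 : MemLp (fun x => κ x * p x) 2 w := by
    refine (hp.const_mul K).mono (hκ.mul hp.1) ?_
    filter_upwards [hκK] with x hx
    rw [norm_mul, norm_mul]
    gcongr
    exact hx.trans (le_abs_self K)
  have h2 : MemLp (fun x => m x * p x) 2 w := by
    refine (hp.const_mul K).mono (hm.mul hp.1) ?_
    filter_upwards [hmK, hm0] with x hx hx0
    rw [norm_mul, norm_mul]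
    gcongr
    rw [Real.norm_of_nonneg hx0]
    exact hx.trans (le_abs_self K)
  have h3 := abs_le_of_integral_mul_le h1 h2
    (by filter_upwards [hm0] with x hx; exact mul_nonneg hx (hp0 x).le) (fun F hF => by
      have hi : Integrable (fun x => F x * p x) w := hF.integrable_mul hp
      have h4 := H (hi.toL1 _)
      have h5 := hi.coeFn_toL1
      calc ∫ x, κ x * p x * F x ∂w = ∫ x, (hi.toL1 _ : Lp ℝ 1 w) x * κ x ∂w := by
            refine integral_congr_ae ?_
            filter_upwards [h5] with x hx
            rw [hx]; ring
        _ ≤ _ := h4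
        _ = _ := by
            refine integral_congr_ae ?_
            filter_upwards [h5] with x hx
            rw [hx, abs_mul, abs_of_pos (hp0 x)]; ring)
  filter_upwards [h3] with x hx
  rw [abs_mul, abs_of_pos (hp0 x)] at hx
  exact le_of_mul_le_mul_right hx (hp0 x)

/-- Every bounded functional on `L¹(w)` is given by a bounded function. -/
theorem exists_density_of_functional (hp : MemLp p 2 w) (hp0 : ∀ x, 0 < p x)
    (ℓ : Lp ℝ 1 w →L[ℝ] ℝ) :
    ∃ κ : α → ℝ, AEStronglyMeasurable κ w ∧ (∀ᵐ x ∂w, |κ x| ≤ ‖ℓ‖) ∧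
      ∀ G : Lp ℝ 1 w, ∫ x, G x * κ x ∂w = ℓ G := by
  -- Multiplication by `p` maps `L²` into `L¹`, so `ℓ` pulls back to a Hilbert space, where Riesz
  -- representation gives `g`. The density sought is `g / p`.
  let S : Lp ℝ 2 w →L[ℝ] Lp ℝ 1 w := (ContinuousLinearMap.mul ℝ ℝ).holderL w 2 2 1 (hp.toLp p)
  have hS : ∀ F : Lp ℝ 2 w, S F =ᵐ[w] fun x => p x * F x := fun F => by
    have h1 := (ContinuousLinearMap.mul ℝ ℝ).coeFn_holder (r := 1) (hp.toLp p) F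
    filter_upwards [h1, hp.coeFn_toLp] with x hx hx2
    change (ContinuousLinearMap.holder 1 (ContinuousLinearMap.mul ℝ ℝ) (hp.toLp p) F) x = _
    rw [hx, hx2]
    rfl
  let g : Lp ℝ 2 w := (InnerProductSpace.toDual ℝ (Lp ℝ 2 w)).symm (ℓ.comp S)
  have hg : ∀ F : Lp ℝ 2 w, ∫ x, g x * F x ∂w = ℓ (S F) := fun F => by
    have h1 : inner ℝ g F = ℓ (S F) := InnerProductSpace.toDual_symm_apply
    rw [← h1, L2.inner_def]
    refine integral_congr_ae (Eventually.of_forall fun x => ?_)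
    simp [mul_comm]
  have hgp : ∀ᵐ x ∂w, |g x| ≤ ‖ℓ‖ * p x := by
    refine abs_le_of_integral_mul_le (Lp.memLp g) (hp.const_mul ‖ℓ‖)
      (Eventually.of_forall fun x => mul_nonneg (norm_nonneg _) (hp0 x).le) fun F hF => ?_
    calc ∫ x, g x * F x ∂w = ∫ x, g x * hF.toLp F x ∂w := by
          refine integral_congr_ae ?_
          filter_upwards [hF.coeFn_toLp] with x hx
          rw [hx]
      _ = ℓ (S (hF.toLp F)) := hg _
      _ ≤ ‖ℓ‖ * ‖S (hF.toLp F)‖ := (le_abs_self _).trans (ℓ.le_opNorm _)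
      _ = ‖ℓ‖ * ∫ x, |F x| * p x ∂w := by
          rw [L1.norm_eq_integral_norm]
          congr 1
          refine integral_congr_ae ?_
          filter_upwards [hF.coeFn_toLp, hS (hF.toLp F)] with x hx hx2
          rw [hx2, hx, norm_mul, Real.norm_of_nonneg (hp0 x).le, Real.norm_eq_abs, mul_comm]
      _ = ∫ x, |F x| * (‖ℓ‖ * p x) ∂w := by
          rw [← integral_const_mul]
          congr 1 with x
          ring
  have hκb : ∀ᵐ x ∂w, |g x / p x| ≤ ‖ℓ‖ := by
    filter_upwards [hgp] with x hx
    rwa [abs_div, abs_of_pos (hp0 x), div_le_iff₀ (hp0 x)]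
  have hκm : AEStronglyMeasurable (fun x => g x / p x) w :=
    ((Lp.aestronglyMeasurable g).aemeasurable.div hp.1.aemeasurable).aestronglyMeasurable
  refine ⟨fun x => g x / p x, hκm, hκb, fun G => ?_⟩
  have hGi : Integrable G w := L1.integrable_coeFn G
  -- truncations
  let s : ℕ → Set α := fun n => {x | |G x| ≤ n * hp.1.mk p x ^ 2}
  have hs : ∀ n, MeasurableSet (s n) := fun n =>
    measurableSet_le (Lp.stronglyMeasurable G).measurable.abs
      ((hp.1.stronglyMeasurable_mk.measurable.pow_const 2).const_mul _)
  have hlim : ∀ᵐ x ∂w, ∀ᶠ n in atTop, x ∈ s n := by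
    filter_upwards [hp.1.ae_eq_mk] with x hx
    obtain ⟨N, hN⟩ := exists_nat_ge (|G x| / p x ^ 2)
    filter_upwards [eventually_ge_atTop N] with n hn
    change |G x| ≤ n * hp.1.mk p x ^ 2
    rw [← hx, ← div_le_iff₀ (pow_pos (hp0 x) 2)]
    exact hN.trans (by exact_mod_cast hn)
  -- On `s n` one has `(G/p)² ≤ n |G|`, which is integrable; this dictates the truncation level `n
  -- p²`.
  have hFm : ∀ n, MemLp (fun x => (s n).indicator G x / p x) 2 w := by
    intro n
    have hm : AEStronglyMeasurable (fun x => (s n).indicator G x / p x) w :=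
      (((Lp.stronglyMeasurable G).measurable.indicator (hs n)).aemeasurable.div
        hp.1.aemeasurable).aestronglyMeasurable
    rw [memLp_two_iff_integrable_sq hm]
    refine (hGi.norm.const_mul (n : ℝ)).mono' (hm.pow 2) ?_
    filter_upwards [hp.1.ae_eq_mk] with x hx
    rw [Real.norm_of_nonneg (sq_nonneg _), div_pow, div_le_iff₀ (pow_pos (hp0 x) 2)]
    by_cases hxs : x ∈ s n
    · rw [Set.indicator_of_mem hxs, ← sq_abs, Real.norm_eq_abs]
      have h2 : |G x| ≤ n * hp.1.mk p x ^ 2 := hxs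
      rw [← hx] at h2
      nlinarith [abs_nonneg (G x)]
    · rw [Set.indicator_of_notMem hxs]
      simpa using mul_nonneg (mul_nonneg (Nat.cast_nonneg n) (norm_nonneg (G x)))
        (sq_nonneg (p x))
  have hSF : ∀ n, S ((hFm n).toLp _) =ᵐ[w] (s n).indicator G := fun n => by
    filter_upwards [hS ((hFm n).toLp _), (hFm n).coeFn_toLp] with x h1 h2
    rw [h1, h2, mul_div_cancel₀ _ (hp0 x).ne']
  have hid : ∀ᵐ x ∂w, Tendsto (fun n => (s n).indicator G x) atTop (𝓝 (G x)) := by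
    filter_upwards [hlim] with x hx
    refine tendsto_const_nhds.congr' ?_
    filter_upwards [hx] with n hn
    rw [Set.indicator_of_mem hn]
  have hle : ∀ n x, ‖(s n).indicator G x‖ ≤ ‖G x‖ := fun n x => norm_indicator_le_norm_self _ _
  have t1 : Tendsto (fun n => S ((hFm n).toLp _)) atTop (𝓝 G) := by
    rw [tendsto_iff_norm_sub_tendsto_zero]
    have h1 : Tendsto (fun n => ∫ x, ‖(s n).indicator G x - G x‖ ∂w) atTop (𝓝 (∫ x, 0 ∂w)) := by
      refine tendsto_integral_of_dominated_convergence (fun x => 2 * ‖G x‖) (fun n => ?_)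
        (hGi.norm.const_mul 2) (fun n => Eventually.of_forall fun x => ?_) ?_
      · exact (((hGi.1.indicator (hs n)).sub hGi.1).norm)
      · rw [norm_norm]
        exact (norm_sub_le _ _).trans (by linarith [hle n x])
      · filter_upwards [hid] with x hx
        simpa using (hx.sub_const (G x)).norm
    rw [integral_zero] at h1
    refine h1.congr fun n => ?_
    rw [L1.norm_eq_integral_norm]
    refine integral_congr_ae ?_
    filter_upwards [hSF n, Lp.coeFn_sub (S ((hFm n).toLp _)) G] with x h2 h3
    rw [h3, Pi.sub_apply, h2]
  have t2 := (ℓ.continuous.tendsto G).comp t1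
  refine tendsto_nhds_unique ?_ t2
  have t3 : Tendsto (fun n => ∫ x, (s n).indicator G x * (g x / p x) ∂w) atTop
      (𝓝 (∫ x, G x * (g x / p x) ∂w)) := by
    refine tendsto_integral_of_dominated_convergence (fun x => ‖ℓ‖ * ‖G x‖) (fun n => ?_)
      (hGi.norm.const_mul _) (fun n => ?_) ?_
    · exact (hGi.1.indicator (hs n)).mul hκm
    · filter_upwards [hκb] with x hx
      rw [norm_mul, mul_comm]
      gcongr
      · exact hx
      · exact hle n x
    · filter_upwards [hid] with x hx
      exact hx.mul_const _
  refine t3.congr fun n => ?_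
  change _ = ℓ (S _)
  rw [← hg]
  refine integral_congr_ae ?_
  filter_upwards [(hFm n).coeFn_toLp] with x hx
  rw [hx]
  ring

end DualLOne

/-! ### Integration over finite configurations -/

section Configurations

variable {d : ℕ}

open Classical in
/-- The configuration formed by the entries of a tuple. -/
def conf {n : ℕ} (x : Fin n → Space d) : FinConf d := ⟨Finset.univ.image x⟩

theorem measurableSet_finConf {A : Set (FinConf d)} :
    MeasurableSet A ↔ ∀ n, MeasurableSet (FinConf.ofTuple (d := d) (n := n) ⁻¹' A) := by
  rw [MeasurableSpace.measurableSet_iInf]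
  rfl

theorem measurable_ofTuple (n : ℕ) : Measurable (FinConf.ofTuple (d := d) (n := n)) :=
  fun _ hA => measurableSet_finConf.1 hA n

theorem measurable_of_comp_ofTuple {β : Type*} [MeasurableSpace β] {f : FinConf d → β}
    (h : ∀ n, Measurable fun x => f (FinConf.ofTuple (d := d) (n := n) x)) : Measurable f :=
  fun _ hA => measurableSet_finConf.2 fun n => h n hA

theorem ofTuple_eq_conf {n : ℕ} (x : {x : Fin n → Space d // Function.Injective x}) :
    FinConf.ofTuple x = conf x.1 := rfl

theorem measurableSet_injective (n : ℕ) :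
    MeasurableSet {x : Fin n → Space d | Function.Injective x} := by
  have : {x : Fin n → Space d | Function.Injective x} =
      ⋂ (i : Fin n) (j : Fin n) (_ : i ≠ j), {x | x i = x j}ᶜ := by
    ext x
    simp only [Set.mem_ofPred_eq, Set.mem_iInter, Set.mem_compl_iff]
    exact ⟨fun h i j hij he => hij (h he), fun h i j he => by
      by_contra hij
      exact h i j hij he⟩
  rw [this]
  refine MeasurableSet.iInter fun i => MeasurableSet.iInter fun j => MeasurableSet.iInter fun _ => ?_
  exact (measurableSet_eq_fun (measurable_pi_apply i) (measurable_pi_apply j)).compl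

/-- The σ-algebra sees only injective tuples. If `x i = x j` with `i ≠ j`, dropping the `i`-th entry
leaves the set of points unchanged, so the non-injective part reduces to shorter tuples. -/
theorem measurable_conf (n : ℕ) : Measurable (conf (d := d) (n := n)) := by
  induction n with
  | zero => exact Subsingleton.measurable
  | succ n ih =>
    intro A hA
    have h1 : conf (d := d) (n := n + 1) ⁻¹' A =
        (Subtype.val '' (FinConf.ofTuple (d := d) (n := n + 1) ⁻¹' A)) ∪
          ⋃ (i : Fin (n + 1)) (j : Fin (n + 1)) (_ : i ≠ j),
            {x | x i = x j} ∩ {x | conf (fun k => x (i.succAbove k)) ∈ A} := by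
      ext x
      have key : ∀ i j : Fin (n + 1), i ≠ j → x i = x j →
          conf (fun k => x (i.succAbove k)) = conf x := by
        intro i j hij he
        apply FinConf.ext
        ext y
        simp only [conf, Finset.mem_image, Finset.mem_univ, true_and]
        constructor
        · rintro ⟨k, rfl⟩
          exact ⟨_, rfl⟩
        · rintro ⟨k, rfl⟩
          by_cases hk : k = i
          · obtain ⟨l, hl⟩ := Fin.exists_succAbove_eq hij.symm
            exact ⟨l, by rw [hl, hk, he]⟩
          · obtain ⟨l, hl⟩ := Fin.exists_succAbove_eq hk
            exact ⟨l, by rw [hl]⟩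
      simp only [Set.mem_union, Set.mem_image, Set.mem_iUnion, Set.mem_inter_iff,
        Set.mem_preimage, Set.mem_ofPred_eq]
      constructor
      · intro hx
        by_cases hinj : Function.Injective x
        · exact Or.inl ⟨⟨x, hinj⟩, hx, rfl⟩
        · right
          simp only [Function.Injective, not_forall] at hinj
          obtain ⟨i, j, he, hij⟩ := hinj
          exact ⟨i, j, hij, he, by rwa [key i j hij he]⟩
      · rintro (⟨y, hy, rfl⟩ | ⟨i, j, hij, he, hx⟩)
        · exact hy
        · rwa [key i j hij he] at hx
    rw [h1]
    refine MeasurableSet.union ?_ ?_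
    · exact (measurableSet_injective _).subtype_image (measurable_ofTuple _ hA)
    · refine MeasurableSet.iUnion fun i => MeasurableSet.iUnion fun j =>
        MeasurableSet.iUnion fun _ => MeasurableSet.inter ?_ ?_
      · exact measurableSet_eq_fun (measurable_pi_apply i) (measurable_pi_apply j)
      · have h2 : Measurable fun x : Fin (n + 1) → Space d => conf fun k => x (i.succAbove k) :=
          ih.comp (measurable_pi_lambda _ fun k => measurable_pi_apply (i.succAbove k))
        exact h2 hA

theorem card_conf {n : ℕ} {x : Fin n → Space d} (hx : Function.Injective x) :
    (conf x).card = n := by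
  classical
  rw [FinConf.card, conf, Finset.card_image_of_injective _ hx, Finset.card_univ, Fintype.card_fin]

theorem measurable_card : Measurable (FinConf.card (d := d)) := by
  refine measurable_of_comp_ofTuple fun n => ?_
  simp only [ofTuple_eq_conf]
  have : (fun x : {x : Fin n → Space d // Function.Injective x} => (conf x.1).card) =
      fun _ => n := funext fun x => card_conf x.2
  rw [this]
  exact measurable_const

/-- For `d ≥ 1` each diagonal `x i = x j` is a proper linear subspace, hence Lebesgue null. -/
theorem ae_injective (hd : 1 ≤ d) (n : ℕ) :
    ∀ᵐ x : Fin n → Space d, Function.Injective x := by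
  have : Nonempty (Fin d) := ⟨⟨0, hd⟩⟩
  have h : ∀ i j : Fin n, i ≠ j → ∀ᵐ x : Fin n → Space d, x i ≠ x j := by
    intro i j hij
    let s : Submodule ℝ (Fin n → Space d) :=
      LinearMap.ker (LinearMap.proj (R := ℝ) (φ := fun _ : Fin n => Space d) i - LinearMap.proj j)
    have hs : s ≠ ⊤ := by
      obtain ⟨v, hv⟩ := exists_ne (0 : Space d)
      intro hs
      have h1 : Pi.single i v ∈ s := by rw [hs]; trivial
      have h2 : (Pi.single i v : Fin n → Space d) i - (Pi.single i v : Fin n → Space d) j = 0 := h1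
      rw [Pi.single_eq_same, Pi.single_eq_of_ne hij.symm, sub_zero] at h2
      exact hv h2
    have h3 := Measure.addHaar_submodule (volume : Measure (Fin n → Space d)) s hs
    refine measure_mono_null ?_ h3
    intro x hx
    have hx' : x i = x j := by simpa using hx
    change x i - x j = 0
    rw [hx', sub_self]
  have h' : ∀ᵐ x : Fin n → Space d, ∀ i j : Fin n, i ≠ j → x i ≠ x j := by
    rw [ae_all_iff]
    intro i
    rw [ae_all_iff]
    intro j
    rw [ae_all_iff]
    exact h i j
  filter_upwards [h'] with x hx i j he
  by_contra hij
  exact hx i j hij he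

/-- Stated as an inequality so that `f` need not be measurable. -/
theorem lintegral_configMeasure_le (n : ℕ) (f : FinConf d → ℝ≥0∞) :
    ∫⁻ η, f η ∂configMeasure d n ≤
      ∫⁻ x in {x : Fin n → Space d | Function.Injective x}, f (conf x) := by
  refine (lintegral_map_le _ _).trans (le_of_eq ?_)
  exact lintegral_subtype_comap (measurableSet_injective n) (fun x => f (conf x))

theorem lintegral_configMeasure (hd : 1 ≤ d) (n : ℕ) {f : FinConf d → ℝ≥0∞} (hf : Measurable f) :
    ∫⁻ η, f η ∂configMeasure d n = ∫⁻ x : Fin n → Space d, f (conf x) := by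
  rw [configMeasure, lintegral_map hf (measurable_ofTuple n)]
  have h1 := lintegral_subtype_comap (μ := volume) (measurableSet_injective (d := d) n)
    (fun x => f (conf x))
  refine h1.trans ?_
  rw [Measure.restrict_eq_self_of_ae_mem
    (s := {x : Fin n → Space d | Function.Injective x}) (ae_injective hd n)]

theorem measurable_weight (c : ℝ) :
    Measurable fun η : FinConf d => ENNReal.ofReal (c ^ η.card) :=
  (measurable_from_top (f := fun n : ℕ => ENNReal.ofReal (c ^ n))).comp measurable_card

theorem factorial_inv_mul_ofReal (n : ℕ) (c : ℝ) :
    (n.factorial : ℝ≥0∞)⁻¹ * ENNReal.ofReal (c ^ n) = ENNReal.ofReal (c ^ n / n.factorial) := by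
  rw [ENNReal.ofReal_div_of_pos (by positivity), ENNReal.ofReal_natCast, div_eq_mul_inv, mul_comm]

theorem lintegral_weighted_le (c : ℝ) (f : FinConf d → ℝ≥0∞) :
    ∫⁻ η, f η ∂weightedMeasure d c ≤ ∑' n : ℕ, ENNReal.ofReal (c ^ n / n.factorial) *
      ∫⁻ x in {x : Fin n → Space d | Function.Injective x}, f (conf x) := by
  refine (lintegral_withDensity_le_lintegral_mul _ (measurable_weight c) f).trans ?_
  rw [lebesguePoisson, lintegral_sum_measure]
  refine ENNReal.tsum_le_tsum fun n => ?_
  rw [lintegral_smul_measure, smul_eq_mul, ← factorial_inv_mul_ofReal, mul_assoc]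
  gcongr
  refine (lintegral_configMeasure_le n _).trans (le_of_eq ?_)
  rw [← lintegral_const_mul' _ _ ENNReal.ofReal_ne_top]
  refine setLIntegral_congr_fun (measurableSet_injective n) fun x hx => ?_
  simp only [Pi.mul_apply]
  rw [card_conf hx]

theorem lintegral_weighted (hd : 1 ≤ d) (c : ℝ) {f : FinConf d → ℝ≥0∞} (hf : Measurable f) :
    ∫⁻ η, f η ∂weightedMeasure d c = ∑' n : ℕ, ENNReal.ofReal (c ^ n / n.factorial) *
      ∫⁻ x : Fin n → Space d, f (conf x) := by
  rw [weightedMeasure, lintegral_withDensity_eq_lintegral_mul _ (measurable_weight c) hf,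
    lebesguePoisson, lintegral_sum_measure]
  refine tsum_congr fun n => ?_
  rw [lintegral_smul_measure, smul_eq_mul, ← factorial_inv_mul_ofReal, mul_assoc,
    lintegral_configMeasure hd n ((measurable_weight c).mul hf),
    ← lintegral_const_mul' _ _ ENNReal.ofReal_ne_top]
  congr 1
  refine lintegral_congr_ae ?_
  filter_upwards [ae_injective hd n] with x hx
  simp only [Pi.mul_apply]
  rw [card_conf hx]

/-- The density `c^{|η|}` is positive, so all the weighted measures share the null sets of `λ`. This
allows one class of functions to be read in several spaces `L_c`. -/
theorem ae_weighted_iff {c : ℝ} (hc : 0 < c) {p : FinConf d → Prop} :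
    (∀ᵐ η ∂weightedMeasure d c, p η) ↔ ∀ᵐ η ∂lebesguePoisson d, p η := by
  constructor
  · intro h
    refine (withDensity_absolutelyContinuous' (measurable_weight c).aemeasurable
      (Eventually.of_forall fun η => ?_)).ae_le h
    exact (ENNReal.ofReal_pos.2 (pow_pos hc _)).ne'
  · exact fun h => (withDensity_absolutelyContinuous _ _).ae_le h

theorem lintegral_pi_congr {ι κ : Type*} [Fintype ι] [Fintype κ] (e : ι ≃ κ)
    (F : (κ → Space d) → ℝ≥0∞) :
    ∫⁻ u : ι → Space d, F (fun k => u (e.symm k)) = ∫⁻ u : κ → Space d, F u := by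
  have h := (volume_measurePreserving_piCongrLeft (fun _ : κ => Space d) e).lintegral_comp_emb
    (MeasurableEquiv.measurableEmbedding _) F
  rw [← h]
  refine lintegral_congr fun u => congrArg F (funext fun k => ?_)
  obtain ⟨i, rfl⟩ := e.surjective k
  rw [e.symm_apply_apply, MeasurableEquiv.coe_piCongrLeft, Equiv.piCongrLeft_apply_apply]

theorem lintegral_cons {n : ℕ} {F : (Fin (n + 1) → Space d) → ℝ≥0∞} (hF : Measurable F) :
    ∫⁻ y : Space d, ∫⁻ u : Fin n → Space d, F (Fin.cons y u) = ∫⁻ x, F x := by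
  have h := (volume_preserving_piFinSuccAbove (fun _ : Fin (n + 1) => Space d) 0).symm
    |>.lintegral_comp hF
  rw [← h]
  rw [Measure.volume_eq_prod, lintegral_prod]
  · refine lintegral_congr fun y => lintegral_congr fun u => congrArg F ?_
    simp [MeasurableEquiv.piFinSuccAbove, Fin.insertNthEquiv]
  · exact (hF.comp (MeasurableEquiv.measurable _)).aemeasurable

theorem lintegral_prod_eq_pow {ι : Type*} [Fintype ι] {f : Space d → ℝ≥0∞} (hf : Measurable f) :
    ∫⁻ v : ι → Space d, ∏ i, f (v i) = (∫⁻ t, f t) ^ Fintype.card ι := by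
  have key : ∀ n : ℕ, ∫⁻ v : Fin n → Space d, ∏ i, f (v i) = (∫⁻ t, f t) ^ n := by
    intro n
    induction n with
    | zero => simp [volume_pi]
    | succ n ih =>
      rw [← lintegral_cons (by fun_prop)]
      simp only [Fin.prod_univ_succ, Fin.cons_zero, Fin.cons_succ]
      have : ∀ y, ∫⁻ u : Fin n → Space d, f y * ∏ i, f (u i) = f y * (∫⁻ t, f t) ^ n := fun y => by
        rw [lintegral_const_mul _ (by fun_prop), ih]
      simp only [this]
      rw [lintegral_mul_const _ hf, pow_succ, mul_comm]
  rw [← key, ← lintegral_pi_congr (Fintype.equivFin ι)]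
  refine lintegral_congr fun u => ?_
  exact (Equiv.prod_comp (Fintype.equivFin ι).symm (fun i => f (u i))).symm

theorem lintegral_split {ι : Type*} [Fintype ι] (p : ι → Prop) [DecidablePred p]
    {f : Space d → ℝ≥0∞} {H : ({i // p i} → Space d) → ℝ≥0∞} (hf : Measurable f)
    (hH : Measurable H) :
    ∫⁻ x : ι → Space d, (∏ i : {i // ¬ p i}, f (x i)) * H (fun i => x i) =
      (∫⁻ t, f t) ^ Fintype.card {i // ¬ p i} * ∫⁻ u, H u := by
  have h := (volume_preserving_piEquivPiSubtypeProd (fun _ : ι => Space d) p).lintegral_comp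
    (f := fun q => (∏ i, f (q.2 i)) * H q.1) (by fun_prop)
  refine h.trans ?_
  have h2 := lintegral_prod_mul (μ := (volume : Measure ({i // ¬ p i} → Space d)))
    (ν := (volume : Measure ({i // p i} → Space d)))
    (f := fun v => ∏ i, f (v i)) (g := H)
    (Finset.measurable_prod _ fun i _ => hf.comp (measurable_pi_apply i)).aemeasurable
    hH.aemeasurable
  rw [lintegral_prod_eq_pow hf] at h2
  rw [← h2, Measure.volume_eq_prod, ← lintegral_prod_swap]
  rfl

theorem conf_cons {n : ℕ} (y : Space d) (u : Fin n → Space d) [DecidableEq (Space d)] :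
    conf (Fin.cons y u : Fin (n + 1) → Space d) = ⟨insert y (Finset.univ.image u)⟩ := by
  apply FinConf.ext
  ext t
  simp [conf, Fin.exists_fin_succ, eq_comm]

/-- `∏ q(y)` for an integrable positive `q` is square integrable. -/
theorem exists_pos_memLp_two (hd : 1 ≤ d) (c : ℝ) :
    ∃ p : FinConf d → ℝ, MemLp p 2 (weightedMeasure d c) ∧ ∀ η, 0 < p η := by
  obtain ⟨q, hq0, hqm, hqi⟩ := exists_pos_lintegral_lt_of_sigmaFinite
    (volume : Measure (Space d)) one_ne_zero
  have hm : ∀ r : ℝ≥0 → ℝ, Measurable r →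
      Measurable fun η : FinConf d => ∏ y ∈ η.points, r (q y) := by
    intro r hr
    refine measurable_of_comp_ofTuple fun n => ?_
    have : (fun x : {x : Fin n → Space d // Function.Injective x} =>
        ∏ y ∈ (FinConf.ofTuple x).points, r (q y)) = fun x => ∏ i, r (q (x.1 i)) := by
      ext x
      rw [FinConf.ofTuple, Finset.prod_image (fun i _ j _ h => x.2 h)]
    rw [this]
    refine Finset.measurable_prod _ fun i _ => ?_
    exact hr.comp (hqm.comp ((measurable_pi_apply i).comp measurable_subtype_coe))
  -- The square of this product has integral `(∫ q)^n ≤ 1` over `n`-tuples, so its integral against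
  -- the weighted measure is bounded by the exponential series at `|c|`.
  refine ⟨fun η => ∏ y ∈ η.points, √(q y), ?_, fun η => Finset.prod_pos fun y _ =>
    Real.sqrt_pos.2 (hq0 y)⟩
  have hpm := hm (fun s => √(s : ℝ)) (by fun_prop)
  rw [memLp_two_iff_integrable_sq hpm.aestronglyMeasurable]
  refine ⟨(hpm.pow_const 2).aestronglyMeasurable, ?_⟩
  rw [hasFiniteIntegral_iff_enorm, lintegral_weighted hd c (by fun_prop)]
  have h1 : ∀ n : ℕ, ∫⁻ x : Fin n → Space d, ‖(∏ y ∈ (conf x).points, √(q y : ℝ)) ^ 2‖ₑ =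
      (∫⁻ t, (q t : ℝ≥0∞)) ^ n := by
    intro n
    have h2 := lintegral_prod_eq_pow (ι := Fin n) (f := fun t => (q t : ℝ≥0∞)) (by fun_prop)
    rw [Fintype.card_fin] at h2
    rw [← h2]
    refine lintegral_congr_ae ?_
    filter_upwards [ae_injective hd n] with x hx
    rw [conf, Finset.prod_image (fun i _ j _ h => hx h), ← Finset.prod_pow]
    simp only [Real.sq_sqrt (NNReal.coe_nonneg _)]
    rw [← NNReal.coe_prod, Real.enorm_of_nonneg (NNReal.coe_nonneg _),
      ENNReal.ofReal_coe_nnreal, ENNReal.ofNNReal_finsetProd]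
  simp only [h1]
  have h3 : Summable fun n : ℕ => |c| ^ n / n.factorial := Real.summable_pow_div_factorial _
  refine lt_of_le_of_lt (ENNReal.tsum_le_tsum (g := fun n : ℕ =>
    ENNReal.ofReal (|c| ^ n / n.factorial)) fun n => ?_) ?_
  · refine (mul_le_mul' (ENNReal.ofReal_le_ofReal ?_) (pow_le_one₀ zero_le hqi.le)).trans
      (le_of_eq (mul_one _))
    exact div_le_div_of_nonneg_right ((le_abs_self _).trans (abs_pow c n).le) (by positivity)
  · rw [← ENNReal.ofReal_tsum_of_nonneg (fun n => by positivity) h3]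
    exact ENNReal.ofReal_lt_top

end Configurations

/-! ### The dominating positive operator and the kernel operators -/

section Operators

variable {d : ℕ}

open Classical in
/-- The operator `g ↦ ∑_{ξ ⊆ η} ∫ e_λ(f(y - ·), η ∖ ξ) g(ξ ∪ y) dy` on nonnegative functions. -/
def posOp (f : Space d → ℝ≥0∞) (g : FinConf d → ℝ≥0∞) (η : FinConf d) : ℝ≥0∞ :=
  ∑ ξ ∈ η.points.powerset, ∫⁻ y, (∏ t ∈ η.points \ ξ, f (y - t)) * g ⟨insert y ξ⟩

open Classical in
/-- The operator `G ↦ ∑_{ξ ⊆ η} ∫ e_λ(a(y - ·), ξ) e_λ(b(y - ·), η ∖ ξ) G(ξ ∪ y) dy`. -/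
def kernelOp (a b : Space d → ℝ) (G : FinConf d → ℝ) (η : FinConf d) : ℝ :=
  ∑ ξ ∈ η.points.powerset, ∫ y : Space d,
    lpExp (fun t => a (y - t)) ξ * lpExp (fun t => b (y - t)) (η.points \ ξ) * G ⟨insert y ξ⟩

open Classical in
-- Reindexing by subsets of `Fin n` makes the range of summation independent of `x`, so that the sum
-- can be integrated or tested for measurability term by term.
theorem sum_powerset_conf {M : Type*} [AddCommMonoid M] {n : ℕ} {x : Fin n → Space d}
    (hx : Function.Injective x) (Φ : Finset (Space d) → Finset (Space d) → M) :
    ∑ ξ ∈ (conf x).points.powerset, Φ ξ ((conf x).points \ ξ) =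
      ∑ S : Finset (Fin n), Φ (S.image x) (Sᶜ.image x) := by
  symm
  refine Finset.sum_nbij (fun S => S.image x) (fun S _ => ?_) (fun S _ T _ h => ?_)
    (fun ξ hξ => ?_) (fun S _ => ?_)
  · exact Finset.mem_powerset.2 (Finset.image_subset_image (Finset.subset_univ _))
  · exact Finset.image_injective hx h
  · obtain ⟨S, _, rfl⟩ := Finset.subset_image_iff.1 (Finset.mem_powerset.1 hξ)
    exact ⟨S, Finset.mem_coe.2 (Finset.mem_univ _), rfl⟩
  · rw [conf, ← Finset.image_sdiff _ _ hx, Finset.compl_eq_univ_sdiff]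

open Classical in
theorem insert_image_eq_conf {n k : ℕ} {S : Finset (Fin n)} (e : {i // i ∈ S} ≃ Fin k)
    (x : Fin n → Space d) (y : Space d) :
    (⟨insert y (S.image x)⟩ : FinConf d) = conf (Fin.cons y fun j => x (e.symm j)) := by
  rw [conf_cons]
  congr 2
  ext t
  simp only [Finset.mem_image, Finset.mem_univ, true_and]
  constructor
  · rintro ⟨i, hi, rfl⟩
    exact ⟨e ⟨i, hi⟩, by simp⟩
  · rintro ⟨j, rfl⟩
    exact ⟨_, (e.symm j).2, rfl⟩

open Classical in
theorem measurable_insert_image {n : ℕ} (S : Finset (Fin n)) :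
    Measurable fun q : (Fin n → Space d) × Space d =>
      (⟨insert q.2 (S.image q.1)⟩ : FinConf d) := by
  let e : {i // i ∈ S} ≃ Fin S.card := S.equivFin
  simp only [insert_image_eq_conf e]
  refine (measurable_conf _).comp (measurable_pi_lambda _ fun j => ?_)
  refine Fin.cases ?_ (fun i => ?_) j
  · exact measurable_snd
  · simp only [Fin.cons_succ]
    exact (measurable_pi_apply _).comp measurable_fst

open Classical in
theorem posOp_conf (f : Space d → ℝ≥0∞) (g : FinConf d → ℝ≥0∞) {n : ℕ} {x : Fin n → Space d}
    (hx : Function.Injective x) :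
    posOp f g (conf x) = ∑ S : Finset (Fin n),
      ∫⁻ y, (∏ i ∈ Sᶜ, f (y - x i)) * g ⟨insert y (S.image x)⟩ := by
  rw [posOp, sum_powerset_conf hx (fun ξ ζ => ∫⁻ y, (∏ t ∈ ζ, f (y - t)) * g ⟨insert y ξ⟩)]
  refine Finset.sum_congr rfl fun S _ => lintegral_congr fun y => ?_
  rw [Finset.prod_image fun i _ j _ h => hx h]

open Classical in
-- For fixed `y`, each coordinate outside `S` contributes `∫ f(y - ·) = ∫ f`. The coordinates in `S`
-- together with `y` form a tuple of length `|S| + 1`.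
theorem lintegral_posOp_summand {f : Space d → ℝ≥0∞} {g : FinConf d → ℝ≥0∞} (hf : Measurable f)
    (hfi : ∫⁻ t, f t ≠ ∞) (hg : Measurable g) {n : ℕ} (S : Finset (Fin n)) :
    ∫⁻ x : Fin n → Space d, ∫⁻ y, (∏ i ∈ Sᶜ, f (y - x i)) * g ⟨insert y (S.image x)⟩ =
      (∫⁻ t, f t) ^ (n - S.card) * ∫⁻ x : Fin (S.card + 1) → Space d, g (conf x) := by
  have hm : Measurable fun q : (Fin n → Space d) × Space d =>
      (∏ i ∈ Sᶜ, f (q.2 - q.1 i)) * g ⟨insert q.2 (S.image q.1)⟩ :=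
    (Finset.measurable_prod _ fun i _ => hf.comp (by fun_prop)).mul
      (hg.comp (measurable_insert_image S))
  rw [lintegral_lintegral_swap hm.aemeasurable]
  let e : {i // i ∈ S} ≃ Fin S.card := S.equivFin
  have h1 : ∀ y : Space d,
      ∫⁻ x : Fin n → Space d, (∏ i ∈ Sᶜ, f (y - x i)) * g ⟨insert y (S.image x)⟩ =
      (∫⁻ t, f t) ^ (n - S.card) * ∫⁻ u : Fin S.card → Space d, g (conf (Fin.cons y u)) := by
    intro y
    have hgm : Measurable fun u : Fin S.card → Space d => g (conf (Fin.cons y u)) := by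
      refine hg.comp ((measurable_conf _).comp (measurable_pi_lambda _ fun j => ?_))
      refine Fin.cases ?_ (fun i => ?_) j
      · exact measurable_const
      · simpa only [Fin.cons_succ] using measurable_pi_apply i
    have h2 := lintegral_split (fun i => i ∈ S) (f := fun t => f (y - t))
      (H := fun u => g (conf (Fin.cons y fun j => u (e.symm j))))
      (hf.comp (by fun_prop)) (hgm.comp (by fun_prop))
    rw [@lintegral_pi_congr d _ _ (Subtype.fintype _) _ e (fun u => g (conf (Fin.cons y u))),
      lintegral_sub_left_eq_self f y] at h2
    have h3 : Fintype.card {i // i ∉ S} = n - S.card := by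
      rw [Fintype.card_subtype_compl, Fintype.card_fin, Fintype.card_coe]
    rw [h3] at h2
    rw [← h2]
    refine lintegral_congr fun x => ?_
    rw [insert_image_eq_conf e, Finset.prod_subtype (Sᶜ) (fun i => Finset.mem_compl)
      (fun i => f (y - x i))]
  simp only [h1]
  rw [lintegral_const_mul' _ _ (ENNReal.pow_ne_top hfi),
    lintegral_cons (F := fun x => g (conf x)) (hg.comp (measurable_conf _))]

theorem tsum_sum_antidiagonal_mul (A B : ℕ → ℝ≥0∞) :
    ∑' n, ∑ q ∈ Finset.HasAntidiagonal.antidiagonal n, A q.1 * B q.2 = (∑' n, A n) * ∑' n, B n := by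
  have h1 : (∑' n, A n) * ∑' n, B n = ∑' q : ℕ × ℕ, A q.1 * B q.2 := by
    rw [ENNReal.summable.tsum_prod' fun _ => ENNReal.summable, ← ENNReal.tsum_mul_right]
    exact tsum_congr fun n => ENNReal.tsum_mul_left.symm
  rw [h1, ← Finset.HasAntidiagonal.sigmaAntidiagonalEquivProd.tsum_eq, ENNReal.tsum_sigma']
  refine tsum_congr fun n => ?_
  rw [tsum_fintype, ← Finset.sum_coe_sort]
  rfl

theorem tsum_ofReal_pow_div_factorial {s : ℝ} (hs : 0 ≤ s) :
    ∑' n : ℕ, ENNReal.ofReal (s ^ n / n.factorial) = ENNReal.ofReal (Real.exp s) := by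
  rw [← ENNReal.ofReal_tsum_of_nonneg (fun n => by positivity) (Real.summable_pow_div_factorial s),
    Real.exp_eq_exp_ℝ, NormedSpace.exp_eq_tsum_div]

/-- The key estimate. Since `binom(n,k)/n! = 1/(k! (n-k)!)`, the sum over splittings `η = ξ ∪ ζ`
decouples. The points of `ζ` sum to `e^{cβ}`; the set `ξ ∪ y` has `k + 1` points but weight `c^k/k!
= c⁻¹ (k+1) c^{k+1}/(k+1)!`, which produces the factor `|η|/c`. -/
theorem lintegral_posOp_le (hd : 1 ≤ d) {c β : ℝ} (hc : 0 < c) (hβ : 0 ≤ β)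
    {f : Space d → ℝ≥0∞} {g : FinConf d → ℝ≥0∞} (hf : Measurable f)
    (hfi : ∫⁻ t, f t = ENNReal.ofReal β) (hg : Measurable g) :
    ∫⁻ η, posOp f g η ∂weightedMeasure d c ≤
      ENNReal.ofReal (Real.exp (c * β) / c) * ∫⁻ η, η.card * g η ∂weightedMeasure d c := by
  classical
  set J : ℕ → ℝ≥0∞ := fun m => ∫⁻ x : Fin m → Space d, g (conf x) with hJ
  have hfi' : ∫⁻ t, f t ≠ ∞ := by rw [hfi]; exact ENNReal.ofReal_ne_top
  have h1 : ∀ n : ℕ, ∫⁻ x in {x : Fin n → Space d | Function.Injective x}, posOp f g (conf x) ≤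
      ∑ k ∈ Finset.range (n + 1), (n.choose k) • (ENNReal.ofReal β ^ (n - k) * J (k + 1)) := by
    intro n
    rw [setLIntegral_congr_fun (measurableSet_injective n) fun x hx => posOp_conf f g hx]
    refine (setLIntegral_le_lintegral _ _).trans (le_of_eq ?_)
    rw [lintegral_finsetSum' _ fun S _ => ?_]
    · simp only [lintegral_posOp_summand hf hfi' hg, hfi]
      have h2 := Finset.sum_powerset_apply_card
        (fun k => ENNReal.ofReal β ^ (n - k) * J (k + 1)) (x := (Finset.univ : Finset (Fin n)))
      rw [Finset.powerset_univ, Finset.card_univ, Fintype.card_fin] at h2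
      exact h2
    · have hm : Measurable fun q : (Fin n → Space d) × Space d =>
          (∏ i ∈ Sᶜ, f (q.2 - q.1 i)) * g ⟨insert q.2 (S.image q.1)⟩ :=
        (Finset.measurable_prod _ fun i _ => hf.comp (by fun_prop)).mul
          (hg.comp (measurable_insert_image S))
      exact hm.lintegral_prod_right'.aemeasurable
  have h3 : ∀ n k : ℕ, k ≤ n → ENNReal.ofReal (c ^ n / n.factorial) *
      (n.choose k) • (ENNReal.ofReal β ^ (n - k) * J (k + 1)) =
      ENNReal.ofReal (c ^ k / k.factorial) * J (k + 1) *
        ENNReal.ofReal ((c * β) ^ (n - k) / (n - k).factorial) := by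
    intro n k hk
    rw [nsmul_eq_mul, ← ENNReal.ofReal_natCast, ← ENNReal.ofReal_pow hβ, ← mul_assoc, ← mul_assoc,
      ← ENNReal.ofReal_mul (by positivity), ← ENNReal.ofReal_mul (by positivity),
      mul_right_comm (ENNReal.ofReal (c ^ k / k.factorial)), ← ENNReal.ofReal_mul (by positivity)]
    congr 2
    rw [Nat.cast_choose ℝ hk, mul_pow]
    have h4 : c ^ n = c ^ k * c ^ (n - k) := by rw [← pow_add, Nat.add_sub_cancel' hk]
    rw [h4]
    field_simp
  calc ∫⁻ η, posOp f g η ∂weightedMeasure d c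
      ≤ ∑' n : ℕ, ENNReal.ofReal (c ^ n / n.factorial) *
        ∫⁻ x in {x : Fin n → Space d | Function.Injective x}, posOp f g (conf x) :=
        lintegral_weighted_le c _
    _ ≤ ∑' n : ℕ, ∑ q ∈ Finset.HasAntidiagonal.antidiagonal n, ENNReal.ofReal (c ^ q.1 / q.1.factorial) *
          J (q.1 + 1) * ENNReal.ofReal ((c * β) ^ q.2 / q.2.factorial) := by
        refine ENNReal.tsum_le_tsum fun n => ?_
        refine (mul_le_mul_right (h1 n) _).trans (le_of_eq ?_)
        rw [Finset.mul_sum, Finset.Nat.sum_antidiagonal_eq_sum_range_succ_mk]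
        refine Finset.sum_congr rfl fun k hk => ?_
        exact h3 n k (Nat.lt_succ_iff.1 (Finset.mem_range.1 hk))
    _ = (∑' k : ℕ, ENNReal.ofReal (c ^ k / k.factorial) * J (k + 1)) *
          ENNReal.ofReal (Real.exp (c * β)) := by
        rw [tsum_sum_antidiagonal_mul (fun k => ENNReal.ofReal (c ^ k / k.factorial) * J (k + 1))
          (fun m => ENNReal.ofReal ((c * β) ^ m / m.factorial)),
          tsum_ofReal_pow_div_factorial (by positivity)]
    _ = ENNReal.ofReal (Real.exp (c * β) / c) * ∫⁻ η, η.card * g η ∂weightedMeasure d c := by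
        have hm : Measurable fun η : FinConf d => (η.card : ℝ≥0∞) * g η :=
          ((measurable_from_top (f := fun n : ℕ => (n : ℝ≥0∞))).comp measurable_card).mul hg
        have h5 : ∀ n : ℕ, ∫⁻ x : Fin n → Space d, ((conf x).card : ℝ≥0∞) * g (conf x) =
            n * J n := by
          intro n
          rw [hJ, ← lintegral_const_mul' _ _ (ENNReal.natCast_ne_top n)]
          refine lintegral_congr_ae ?_
          filter_upwards [ae_injective hd n] with x hx
          rw [card_conf hx]
        rw [lintegral_weighted hd c hm]
        simp only [h5]
        rw [tsum_eq_zero_add' (f := fun n : ℕ =>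
          ENNReal.ofReal (c ^ n / n.factorial) * (n * J n)) ENNReal.summable]
        simp only [Nat.cast_zero, zero_mul, mul_zero, zero_add]
        rw [mul_comm, ← ENNReal.tsum_mul_left, ← ENNReal.tsum_mul_left]
        refine tsum_congr fun k => ?_
        rw [← ENNReal.ofReal_natCast (k + 1), ← mul_assoc, ← mul_assoc, ← mul_assoc,
          ← ENNReal.ofReal_mul (by positivity), ← ENNReal.ofReal_mul (by positivity),
          ← ENNReal.ofReal_mul (by positivity)]
        congr 2
        rw [Nat.factorial_succ]
        push_cast
        field_simp
        ring

theorem lintegral_weighted_eq (c : ℝ) {f : FinConf d → ℝ≥0∞} (hf : Measurable f) :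
    ∫⁻ η, f η ∂weightedMeasure d c =
      ∫⁻ η, ENNReal.ofReal (c ^ η.card) * f η ∂lebesguePoisson d := by
  rw [weightedMeasure, lintegral_withDensity_eq_lintegral_mul _ (measurable_weight c) hf]
  rfl

/-- The functions `a` and `b` defining `kernelOp a b` are bounded by `1` and by `φ`. -/
structure IsKernel (φ a b : Space d → ℝ) : Prop where
  measurable_left : Measurable a
  measurable_right : Measurable b
  abs_left_le : ∀ x, |a x| ≤ 1
  abs_right_le : ∀ x, |b x| ≤ φ x

theorem abs_lpExp_le_one {a : Space d → ℝ} (ha : ∀ x, |a x| ≤ 1) (ξ : Finset (Space d)) :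
    |lpExp a ξ| ≤ 1 := by
  rw [lpExp, Finset.abs_prod]
  exact Finset.prod_le_one (fun x _ => abs_nonneg _) fun x _ => ha x

theorem enorm_lpExp_le {b φ : Space d → ℝ} (hb : ∀ x, |b x| ≤ φ x) (ζ : Finset (Space d)) :
    ‖lpExp b ζ‖ₑ ≤ ∏ x ∈ ζ, ENNReal.ofReal (φ x) := by
  rw [lpExp, Real.enorm_eq_ofReal_abs, Finset.abs_prod,
    ENNReal.ofReal_prod_of_nonneg fun x _ => abs_nonneg _]
  exact Finset.prod_le_prod' fun x _ => ENNReal.ofReal_le_ofReal (hb x)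

variable {φ a b : Space d → ℝ}

theorem IsKernel.enorm_mul_le (hk : IsKernel φ a b) (y : Space d) (ξ ζ : Finset (Space d)) (s : ℝ) :
    ‖lpExp (fun t => a (y - t)) ξ * lpExp (fun t => b (y - t)) ζ * s‖ₑ ≤
      (∏ t ∈ ζ, ENNReal.ofReal (φ (y - t))) * ‖s‖ₑ := by
  rw [enorm_mul, enorm_mul]
  gcongr
  refine (mul_le_mul' ?_ (enorm_lpExp_le (fun t => hk.abs_right_le (y - t)) ζ)).trans
    (le_of_eq (one_mul _))
  rw [Real.enorm_eq_ofReal_abs, ← ENNReal.ofReal_one]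
  exact ENNReal.ofReal_le_ofReal (abs_lpExp_le_one (fun t => hk.abs_left_le (y - t)) ξ)

theorem IsKernel.enorm_kernelOp_le (hk : IsKernel φ a b) (G : FinConf d → ℝ) (η : FinConf d) :
    ‖kernelOp a b G η‖ₑ ≤ posOp (fun x => ENNReal.ofReal (φ x)) (fun η => ‖G η‖ₑ) η := by
  refine (enorm_sum_le _ _).trans (Finset.sum_le_sum fun ξ _ => ?_)
  refine (enorm_integral_le_lintegral_enorm _).trans (lintegral_mono fun y => ?_)
  exact hk.enorm_mul_le y _ _ _

open Classical in
theorem IsKernel.measurable_kernelOp (hk : IsKernel φ a b) {G : FinConf d → ℝ}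
    (hG : Measurable G) : Measurable (kernelOp a b G) := by
  refine measurable_of_comp_ofTuple fun n => ?_
  have h1 : (fun x : {x : Fin n → Space d // Function.Injective x} =>
      kernelOp a b G (FinConf.ofTuple x)) = fun x => ∑ S : Finset (Fin n), ∫ y : Space d,
        (∏ i ∈ S, a (y - x.1 i)) * (∏ i ∈ Sᶜ, b (y - x.1 i)) * G ⟨insert y (S.image x.1)⟩ := by
    ext x
    rw [ofTuple_eq_conf, kernelOp, sum_powerset_conf x.2 (fun ξ ζ => ∫ y : Space d,
      lpExp (fun t => a (y - t)) ξ * lpExp (fun t => b (y - t)) ζ * G ⟨insert y ξ⟩)]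
    refine Finset.sum_congr rfl fun S _ => integral_congr_ae (Eventually.of_forall fun y => ?_)
    simp only [lpExp]
    rw [Finset.prod_image fun i _ j _ h => x.2 h, Finset.prod_image fun i _ j _ h => x.2 h]
  rw [h1]
  refine Finset.measurable_sum _ fun S _ => ?_
  have ha := hk.measurable_left
  have hb := hk.measurable_right
  have hm : Measurable fun q : (Fin n → Space d) × Space d =>
      (∏ i ∈ S, a (q.2 - q.1 i)) * (∏ i ∈ Sᶜ, b (q.2 - q.1 i)) *
        G ⟨insert q.2 (S.image q.1)⟩ :=
    ((Finset.measurable_prod _ fun i _ => ha.comp (by fun_prop)).mul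
      (Finset.measurable_prod _ fun i _ => hb.comp (by fun_prop))).mul
        (hG.comp (measurable_insert_image S))
  exact (hm.stronglyMeasurable.integral_prod_right'.measurable).comp measurable_subtype_coe

open Classical in
theorem measurable_posOp {f : Space d → ℝ≥0∞} (hf : Measurable f) {g : FinConf d → ℝ≥0∞}
    (hg : Measurable g) : Measurable (posOp f g) := by
  refine measurable_of_comp_ofTuple fun n => ?_
  have h1 : (fun x : {x : Fin n → Space d // Function.Injective x} =>
      posOp f g (FinConf.ofTuple x)) = fun x => ∑ S : Finset (Fin n),
        ∫⁻ y, (∏ i ∈ Sᶜ, f (y - x.1 i)) * g ⟨insert y (S.image x.1)⟩ := by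
    ext x
    rw [ofTuple_eq_conf, posOp_conf f g x.2]
  rw [h1]
  refine Finset.measurable_sum _ fun S _ => ?_
  have hm : Measurable fun q : (Fin n → Space d) × Space d =>
      (∏ i ∈ Sᶜ, f (q.2 - q.1 i)) * g ⟨insert q.2 (S.image q.1)⟩ :=
    (Finset.measurable_prod _ fun i _ => hf.comp (by fun_prop)).mul
      (hg.comp (measurable_insert_image S))
  exact hm.lintegral_prod_right'.comp measurable_subtype_coe

open Classical in
theorem measurable_insert (ξ : Finset (Space d)) :
    Measurable fun y : Space d => (⟨insert y ξ⟩ : FinConf d) := by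
  have h := (measurable_insert_image (Finset.univ : Finset (Fin ξ.card))).comp
    (measurable_prodMk_left (x := fun i => (ξ.equivFin.symm i : Space d)))
  convert h using 3 with y
  simp only [Function.comp_apply]
  congr 1
  ext t
  simp only [Finset.mem_image, Finset.mem_univ, true_and]
  exact ⟨fun ht => ⟨ξ.equivFin ⟨t, ht⟩, by simp⟩, fun ⟨i, hi⟩ => hi ▸ (ξ.equivFin.symm i).2⟩

theorem measurable_lpExp {a : Space d → ℝ} (ha : Measurable a) (ξ : Finset (Space d)) :
    Measurable fun y : Space d => lpExp (fun t => a (y - t)) ξ :=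
  Finset.measurable_prod _ fun t _ => ha.comp (measurable_sub_const t)

open Classical in
theorem IsKernel.measurable_integrand (hk : IsKernel φ a b) {G : FinConf d → ℝ}
    (hG : Measurable G) (ξ ζ : Finset (Space d)) :
    Measurable fun y : Space d =>
      lpExp (fun t => a (y - t)) ξ * lpExp (fun t => b (y - t)) ζ * G ⟨insert y ξ⟩ :=
  ((measurable_lpExp hk.measurable_left ξ).mul (measurable_lpExp hk.measurable_right ζ)).mul
    (hG.comp (measurable_insert ξ))

open Classical in
theorem IsKernel.integrable (hk : IsKernel φ a b) {G : FinConf d → ℝ} (hG : Measurable G)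
    {η : FinConf d}
    (hη : posOp (fun x => ENNReal.ofReal (φ x)) (fun η => ‖G η‖ₑ) η < ∞)
    {ξ : Finset (Space d)} (hξ : ξ ∈ η.points.powerset) :
    Integrable fun y : Space d => lpExp (fun t => a (y - t)) ξ *
      lpExp (fun t => b (y - t)) (η.points \ ξ) * G ⟨insert y ξ⟩ := by
  refine ⟨(hk.measurable_integrand hG ξ _).aestronglyMeasurable, ?_⟩
  refine lt_of_le_of_lt (lintegral_mono fun y => hk.enorm_mul_le y _ _ _) ?_
  exact lt_of_le_of_lt (Finset.single_le_sum_of_canonicallyOrdered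
    (f := fun ξ => ∫⁻ y, (∏ t ∈ η.points \ ξ, ENNReal.ofReal (φ (y - t))) * ‖G ⟨insert y ξ⟩‖ₑ) hξ) hη

/-- The standing assumptions on the pair potential. -/
structure IsPotential (φ : Space d → ℝ) (β : ℝ) : Prop where
  one_le : 1 ≤ d
  measurable : Measurable φ
  nonneg : ∀ x, 0 ≤ φ x
  lintegral_eq : ∫⁻ x, ENNReal.ofReal (φ x) = ENNReal.ofReal β
  integral_nonneg : 0 ≤ β

variable {β : ℝ}

theorem IsPotential.lintegral_posOp_le (hφ : IsPotential φ β) {c : ℝ} (hc : 0 < c)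
    {g : FinConf d → ℝ≥0∞} (hg : Measurable g) :
    ∫⁻ η, posOp (fun x => ENNReal.ofReal (φ x)) g η ∂weightedMeasure d c ≤
      ENNReal.ofReal (Real.exp (c * β) / c) * ∫⁻ η, η.card * g η ∂weightedMeasure d c :=
  GlauberVlasov.lintegral_posOp_le hφ.one_le hc hφ.integral_nonneg hφ.measurable.ennreal_ofReal
    hφ.lintegral_eq hg

theorem IsPotential.ae_posOp_lt_top (hφ : IsPotential φ β) {c : ℝ} (hc : 0 < c)
    {g : FinConf d → ℝ≥0∞} (hg : Measurable g)
    (hfin : ∫⁻ η, η.card * g η ∂weightedMeasure d c ≠ ∞) :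
    ∀ᵐ η ∂lebesguePoisson d, posOp (fun x => ENNReal.ofReal (φ x)) g η < ∞ := by
  rw [← ae_weighted_iff hc]
  refine ae_lt_top (measurable_posOp hφ.measurable.ennreal_ofReal hg) ?_
  exact ne_top_of_le_ne_top (ENNReal.mul_ne_top ENNReal.ofReal_ne_top hfin)
    (hφ.lintegral_posOp_le hc hg)

/-- The key estimate shows that a null function is sent to a null function and that the integrals
defining `kernelOp` converge for almost every `η`. Keeping `K` separate from `rG + sH` gives
linearity and, with `r = 1`, `s = 0`, independence of the representative. -/
theorem kernelOp_linear_ae (hφ : IsPotential φ β) (hk : IsKernel φ a b) {c : ℝ} (hc : 0 < c)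
    {G H K : FinConf d → ℝ} (hG : Measurable G) (hH : Measurable H) (hK : Measurable K)
    (hGf : ∫⁻ η, η.card * ‖G η‖ₑ ∂weightedMeasure d c ≠ ∞)
    (hHf : ∫⁻ η, η.card * ‖H η‖ₑ ∂weightedMeasure d c ≠ ∞) (r s : ℝ)
    (h : ∀ᵐ η ∂lebesguePoisson d, K η = r * G η + s * H η) :
    ∀ᵐ η ∂lebesguePoisson d,
      kernelOp a b K η = r * kernelOp a b G η + s * kernelOp a b H η := by
  classical
  have hD : Measurable fun η => ‖K η - (r * G η + s * H η)‖ₑ := by fun_prop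
  have h0 : ∀ᵐ η ∂lebesguePoisson d, posOp (fun x => ENNReal.ofReal (φ x))
      (fun η => ‖K η - (r * G η + s * H η)‖ₑ) η = 0 := by
    rw [← ae_weighted_iff hc] at h ⊢
    have h1 := hφ.lintegral_posOp_le hc hD
    have h2 : ∫⁻ η, η.card * ‖K η - (r * G η + s * H η)‖ₑ ∂weightedMeasure d c = 0 := by
      rw [← lintegral_zero (μ := weightedMeasure d c)]
      refine lintegral_congr_ae ?_
      filter_upwards [h] with η hη
      rw [hη, sub_self, enorm_zero, mul_zero]
    rw [h2, mul_zero, nonpos_iff_eq_zero,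
      lintegral_eq_zero_iff (measurable_posOp hφ.measurable.ennreal_ofReal hD)] at h1
    exact h1
  filter_upwards [h0, hφ.ae_posOp_lt_top hc hG.enorm hGf, hφ.ae_posOp_lt_top hc hH.enorm hHf]
    with η h1 h2 h3
  rw [kernelOp, kernelOp, kernelOp, Finset.mul_sum, Finset.mul_sum, ← Finset.sum_add_distrib]
  refine Finset.sum_congr rfl fun ξ hξ => ?_
  rw [← integral_const_mul, ← integral_const_mul, ← integral_add
    ((hk.integrable hG h2 hξ).const_mul r) ((hk.integrable hH h3 hξ).const_mul s)]
  refine integral_congr_ae ?_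
  have h4 := (Finset.sum_eq_zero_iff.1 h1) ξ hξ
  rw [lintegral_eq_zero_iff] at h4
  · filter_upwards [h4] with y hy
    have h5 : ‖lpExp (fun t => a (y - t)) ξ * lpExp (fun t => b (y - t)) (η.points \ ξ) *
        (K ⟨insert y ξ⟩ - (r * G ⟨insert y ξ⟩ + s * H ⟨insert y ξ⟩))‖ₑ = 0 :=
      le_antisymm ((hk.enorm_mul_le y _ _ _).trans hy.le) zero_le
    rw [enorm_eq_zero] at h5
    linear_combination h5
  · exact (Finset.measurable_prod _ fun t _ => hφ.measurable.ennreal_ofReal.comp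
      (measurable_sub_const t)).mul (hD.comp (measurable_insert ξ))

theorem abs_lpExp_sub_one_le {a : Space d → ℝ} {δ : ℝ} (ha : ∀ x, |a x| ≤ 1)
    (had : ∀ x, |a x - 1| ≤ δ) (ξ : Finset (Space d)) : |lpExp a ξ - 1| ≤ δ * ξ.card := by
  classical
  induction ξ using Finset.induction_on with
  | empty => simp [lpExp]
  | insert x ξ hx ih =>
    have h1 : lpExp a (insert x ξ) - 1 = a x * (lpExp a ξ - 1) + (a x - 1) := by
      rw [lpExp, Finset.prod_insert hx, lpExp]; ring
    rw [h1, Finset.card_insert_of_notMem hx]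
    refine (abs_add_le _ _).trans ?_
    rw [abs_mul]
    have h2 : |a x| * |lpExp a ξ - 1| ≤ 1 * (δ * ξ.card) := by
      gcongr
      exact ha x
    push_cast
    linarith [had x]

theorem abs_lpExp_le {b φ : Space d → ℝ} (hb : ∀ x, |b x| ≤ φ x) (ζ : Finset (Space d)) :
    |lpExp b ζ| ≤ ∏ x ∈ ζ, φ x := by
  rw [lpExp, Finset.abs_prod]
  exact Finset.prod_le_prod (fun x _ => abs_nonneg _) fun x _ => hb x

/-- Replacing `b` by `b'` one factor at a time costs `δ φ` at that factor, while the others stay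
bounded by `φ`. -/
theorem abs_lpExp_sub_lpExp_le {b b' φ : Space d → ℝ} {δ : ℝ} (hφ : ∀ x, 0 ≤ φ x)
    (hb : ∀ x, |b x| ≤ φ x) (hb' : ∀ x, |b' x| ≤ φ x) (hbd : ∀ x, |b x - b' x| ≤ δ * φ x)
    (ζ : Finset (Space d)) : |lpExp b ζ - lpExp b' ζ| ≤ δ * ζ.card * ∏ x ∈ ζ, φ x := by
  classical
  induction ζ using Finset.induction_on with
  | empty => simp [lpExp]
  | insert x ζ hx ih =>
    have h1 : lpExp b (insert x ζ) - lpExp b' (insert x ζ) =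
        b x * (lpExp b ζ - lpExp b' ζ) + (b x - b' x) * lpExp b' ζ := by
      rw [lpExp, Finset.prod_insert hx, lpExp, Finset.prod_insert hx, lpExp, lpExp]; ring
    rw [h1, Finset.card_insert_of_notMem hx, Finset.prod_insert hx]
    refine (abs_add_le _ _).trans ?_
    rw [abs_mul, abs_mul]
    have h2 : |b x| * |lpExp b ζ - lpExp b' ζ| ≤ φ x * (δ * ζ.card * ∏ x ∈ ζ, φ x) :=
      mul_le_mul (hb x) ih (abs_nonneg _) (hφ x)
    have h3 : |b x - b' x| * |lpExp b' ζ| ≤ (δ * φ x) * ∏ x ∈ ζ, φ x :=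
      mul_le_mul (hbd x) (abs_lpExp_le hb' ζ) (abs_nonneg _) ((abs_nonneg _).trans (hbd x))
    push_cast
    linarith

/-- From `AB - B' = (A - 1) B + (B - B')`, the points of `ξ` cost `δ |ξ|` and those of `η \ ξ` cost
`δ |η \ ξ|`, in total `δ |η|`. -/
theorem enorm_kernelOp_sub_le {b' : Space d → ℝ} {δ : ℝ} (hφ : ∀ x, 0 ≤ φ x)
    (hk : IsKernel φ a b) (hk' : IsKernel φ 1 b') (had : ∀ x, |a x - 1| ≤ δ)
    (hbd : ∀ x, |b x - b' x| ≤ δ * φ x) {G : FinConf d → ℝ} (hG : Measurable G) {η : FinConf d}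
    (hη : posOp (fun x => ENNReal.ofReal (φ x)) (fun η => ‖G η‖ₑ) η < ∞) :
    ‖kernelOp a b G η - kernelOp 1 b' G η‖ₑ ≤
      ENNReal.ofReal δ * (η.card * posOp (fun x => ENNReal.ofReal (φ x)) (fun η => ‖G η‖ₑ) η) := by
  classical
  have hδ : 0 ≤ δ := (abs_nonneg _).trans (had 0)
  rw [kernelOp, kernelOp, ← Finset.sum_sub_distrib, posOp, Finset.mul_sum, Finset.mul_sum]
  refine (enorm_sum_le _ _).trans (Finset.sum_le_sum fun ξ hξ => ?_)
  rw [← integral_sub (hk.integrable hG hη hξ) (hk'.integrable hG hη hξ), ← mul_assoc,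
    ← lintegral_const_mul' _ _ (ENNReal.mul_ne_top ENNReal.ofReal_ne_top (ENNReal.natCast_ne_top _))]
  refine (enorm_integral_le_lintegral_enorm _).trans (lintegral_mono fun y => ?_)
  rw [← sub_mul, enorm_mul, ← mul_assoc]
  gcongr
  set ζ := η.points \ ξ with hζ
  set A := lpExp (fun t => a (y - t)) ξ with hA
  set B := lpExp (fun t => b (y - t)) ζ with hB
  set B' := lpExp (fun t => b' (y - t)) ζ with hB'
  have h1 : lpExp (fun t => (1 : Space d → ℝ) (y - t)) ξ = 1 := by simp [lpExp]
  have h2 : |A - 1| ≤ δ * ξ.card :=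
    abs_lpExp_sub_one_le (fun t => hk.abs_left_le (y - t)) (fun t => had (y - t)) ξ
  have h3 : |B| ≤ ∏ t ∈ ζ, φ (y - t) := abs_lpExp_le (fun t => hk.abs_right_le (y - t)) ζ
  have h4 : |B - B'| ≤ δ * ζ.card * ∏ t ∈ ζ, φ (y - t) :=
    abs_lpExp_sub_lpExp_le (fun t => hφ (y - t)) (fun t => hk.abs_right_le (y - t))
      (fun t => hk'.abs_right_le (y - t)) (fun t => hbd (y - t)) ζ
  have h5 : (ξ.card : ℝ) + ζ.card = η.card := by
    have := Finset.card_sdiff_add_card_eq_card (Finset.mem_powerset.1 hξ)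
    rw [FinConf.card, ← this]
    push_cast
    ring
  have h6 : |A * B - 1 * B'| ≤ δ * η.card * ∏ t ∈ ζ, φ (y - t) := by
    have : A * B - 1 * B' = (A - 1) * B + (B - B') := by ring
    rw [this, ← h5]
    refine (abs_add_le _ _).trans ?_
    rw [abs_mul]
    have := mul_le_mul h2 h3 (abs_nonneg _) (by positivity)
    linarith
  rw [h1, Real.enorm_eq_ofReal_abs]
  refine (ENNReal.ofReal_le_ofReal h6).trans (le_of_eq ?_)
  rw [ENNReal.ofReal_mul (by positivity), ENNReal.ofReal_mul hδ, ENNReal.ofReal_natCast,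
    ENNReal.ofReal_prod_of_nonneg fun t _ => hφ _]

/-- Both bounds come from `0 ≤ 1 - e^{-u} ≤ u` with `u = εφ`, so they are uniform in `ε`. -/
theorem isKernel_ren (hφm : Measurable φ) (hφ : ∀ x, 0 ≤ φ x) {ε : ℝ} (hε : 0 < ε) :
    IsKernel φ (fun u => Real.exp (-ε * φ u)) (fun u => (Real.exp (-ε * φ u) - 1) / ε) where
  measurable_left := by fun_prop
  measurable_right := by fun_prop
  abs_left_le x := by
    rw [abs_of_pos (Real.exp_pos _), Real.exp_le_one_iff]
    nlinarith [hφ x]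
  abs_right_le x := by
    have h1 : Real.exp (-ε * φ x) ≤ 1 := Real.exp_le_one_iff.2 (by nlinarith [hφ x])
    have h2 := Real.add_one_le_exp (-ε * φ x)
    rw [abs_div, abs_of_pos hε, div_le_iff₀ hε, abs_le]
    constructor <;> nlinarith [hφ x]

theorem isKernel_vlasov (hφm : Measurable φ) (hφ : ∀ x, 0 ≤ φ x) :
    IsKernel φ 1 (fun u => -φ u) where
  measurable_left := measurable_const
  measurable_right := hφm.neg
  abs_left_le x := by simp
  abs_right_le x := by rw [abs_neg, abs_of_nonneg (hφ x)]

theorem exp_neg_le_one_sub_add_sq {u : ℝ} (hu : 0 ≤ u) : Real.exp (-u) ≤ 1 - u + u ^ 2 := by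
  rcases le_total u 1 with h | h
  · have h1 := Real.abs_exp_sub_one_sub_id_le (x := -u) (by rwa [abs_neg, abs_of_nonneg hu])
    have h2 := le_abs_self (Real.exp (-u) - 1 - -u)
    nlinarith
  · have : Real.exp (-u) ≤ 1 := Real.exp_le_one_iff.2 (by linarith)
    nlinarith

theorem ren_sub_vlasov_left (hφ : ∀ x, 0 ≤ φ x) {ε M : ℝ} (hε : 0 < ε) (hM : ∀ x, φ x ≤ M)
    (x : Space d) : |Real.exp (-ε * φ x) - 1| ≤ ε * M := by
  have h1 : Real.exp (-ε * φ x) ≤ 1 := Real.exp_le_one_iff.2 (by nlinarith [hφ x])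
  have h2 := Real.add_one_le_exp (-ε * φ x)
  rw [abs_le]
  constructor <;> nlinarith [hφ x, hM x, mul_le_mul_of_nonneg_left (hM x) hε.le]

/-- With `u = εφ`, `0 ≤ e^{-u} - 1 + u ≤ u²`; dividing by `ε` leaves `ε φ² ≤ ε M φ`. The same `δ = ε
M` therefore serves for `a` and for `b`. -/
theorem ren_sub_vlasov_right (hφ : ∀ x, 0 ≤ φ x) {ε M : ℝ} (hε : 0 < ε) (hM : ∀ x, φ x ≤ M)
    (x : Space d) : |(Real.exp (-ε * φ x) - 1) / ε - -φ x| ≤ ε * M * φ x := by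
  have h1 := exp_neg_le_one_sub_add_sq (mul_nonneg hε.le (hφ x))
  have h2 := Real.add_one_le_exp (-ε * φ x)
  have h3 : (Real.exp (-ε * φ x) - 1) / ε - -φ x = (Real.exp (-ε * φ x) - 1 + ε * φ x) / ε := by
    field_simp
    ring
  have h4 : φ x * φ x ≤ M * φ x := mul_le_mul_of_nonneg_right (hM x) (hφ x)
  have h5 : ε ^ 2 * (φ x * φ x) ≤ ε ^ 2 * (M * φ x) := mul_le_mul_of_nonneg_left h4 (sq_nonneg ε)
  rw [← neg_mul] at h1
  rw [h3, abs_div, abs_of_pos hε, div_le_iff₀ hε, abs_le]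
  constructor <;> nlinarith

end Operators

/-! ### Dissipativity, dense range and generation in `L_C` -/

section Generators

variable {d : ℕ}

/-- Each of the `n` terms `r^0, …, r^{n-1}` is at least `r^n`, and the geometric sum is at most `(1
- r)⁻¹`. -/
theorem natCast_mul_pow_le {r : ℝ} (h0 : 0 ≤ r) (h1 : r < 1) (n : ℕ) :
    n * r ^ n ≤ (1 - r)⁻¹ := by
  have h2 : (n : ℝ) * r ^ n ≤ ∑ k ∈ Finset.range n, r ^ k := by
    have : ∑ k ∈ Finset.range n, r ^ n = (n : ℝ) * r ^ n := by simp
    rw [← this]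
    exact Finset.sum_le_sum fun k hk =>
      pow_le_pow_of_le_one h0 h1.le (Finset.mem_range.1 hk).le
  have h3 : (∑ k ∈ Finset.range n, r ^ k) * (1 - r) = 1 - r ^ n := geom_sum_mul_neg r n
  have h4 : 0 < 1 - r := by linarith
  rw [← one_div, le_div_iff₀ h4]
  nlinarith [pow_nonneg h0 n]

theorem natCast_mul_pow_le_mul_pow {c c' : ℝ} (h0 : 0 ≤ c) (h1 : c < c') (n : ℕ) :
    n * c ^ n ≤ (1 - c / c')⁻¹ * c' ^ n := by
  have hc' : 0 < c' := h0.trans_lt h1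
  have h2 := natCast_mul_pow_le (div_nonneg h0 hc'.le) ((div_lt_one hc').2 h1) n
  rwa [div_pow, ← mul_div_assoc, div_le_iff₀ (pow_pos hc' n)] at h2

theorem measurable_natCast_card : Measurable fun η : FinConf d => (η.card : ℝ≥0∞) :=
  (measurable_from_top (f := fun n : ℕ => (n : ℝ≥0∞))).comp measurable_card

theorem measurable_realCast_card : Measurable fun η : FinConf d => (η.card : ℝ) :=
  (measurable_from_top (f := fun n : ℕ => (n : ℝ))).comp measurable_card

/-- A factor `|η|` is paid for by raising the weight from `c` to `c'`. This is the only mechanism by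
which unbounded factors are absorbed in the comparison estimates. -/
theorem lintegral_card_mul_le {c c' : ℝ} (h0 : 0 ≤ c) (h1 : c < c') {g : FinConf d → ℝ≥0∞}
    (hg : Measurable g) :
    ∫⁻ η, η.card * g η ∂weightedMeasure d c ≤
      ENNReal.ofReal (1 - c / c')⁻¹ * ∫⁻ η, g η ∂weightedMeasure d c' := by
  have hc' : 0 < c' := h0.trans_lt h1
  have h2 : 0 ≤ (1 - c / c')⁻¹ :=
    inv_nonneg.2 (sub_nonneg.2 ((div_le_one hc').2 h1.le))
  rw [lintegral_weighted_eq c (f := fun η => η.card * g η) (measurable_natCast_card.mul hg),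
    lintegral_weighted_eq c' hg,
    ← lintegral_const_mul' _ _ ENNReal.ofReal_ne_top]
  refine lintegral_mono fun η => ?_
  rw [← mul_assoc, ← mul_assoc, ← ENNReal.ofReal_natCast, ← ENNReal.ofReal_mul (by positivity),
    ← ENNReal.ofReal_mul h2]
  refine mul_le_mul_left (ENNReal.ofReal_le_ofReal ?_) _
  rw [mul_comm]
  exact natCast_mul_pow_le_mul_pow h0 h1 _

theorem weightedMeasure_mono {c c' : ℝ} (h0 : 0 ≤ c) (h1 : c ≤ c') :
    weightedMeasure d c ≤ weightedMeasure d c' :=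
  withDensity_mono (Eventually.of_forall fun _ =>
    ENNReal.ofReal_le_ofReal (pow_le_pow_left₀ h0 h1 _))

theorem weightedMeasure_ac {c c' : ℝ} (h1 : 0 < c') :
    weightedMeasure d c ≪ weightedMeasure d c' :=
  Measure.AbsolutelyContinuous.mk fun s _ hs => by
    have : ∀ᵐ η ∂weightedMeasure d c', η ∉ s := measure_eq_zero_iff_ae_notMem.1 hs
    rw [ae_weighted_iff h1] at this
    exact measure_eq_zero_iff_ae_notMem.2 ((withDensity_absolutelyContinuous _ _).ae_le this)

/-- The inclusion `L_C ⊆ L_c` for `c ≤ C`. -/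
def incl (d : ℕ) {c C : ℝ} (h0 : 0 < c) (h1 : c ≤ C) : LSpace d C →L[ℝ] LSpace d c :=
  LinearMap.mkContinuous
    { toFun := fun G => ((Lp.memLp G).mono_measure (weightedMeasure_mono h0.le h1)).toLp G
      map_add' := fun G H => by
        rw [← MemLp.toLp_add]
        exact MemLp.toLp_congr _ _
          ((weightedMeasure_ac (h0.trans_le h1)).ae_le (Lp.coeFn_add G H))
      map_smul' := fun r G => by
        rw [RingHom.id_apply, ← MemLp.toLp_const_smul]
        exact MemLp.toLp_congr _ _
          ((weightedMeasure_ac (h0.trans_le h1)).ae_le (Lp.coeFn_smul r G)) }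
    1 (fun G => by
      rw [one_mul]
      change ‖((Lp.memLp G).mono_measure (weightedMeasure_mono h0.le h1)).toLp G‖ ≤ _
      rw [Lp.norm_toLp, Lp.norm_def]
      exact ENNReal.toReal_mono (Lp.memLp G).2.ne
        (eLpNorm_mono_measure _ (weightedMeasure_mono h0.le h1)))

theorem enorm_LSpace {C : ℝ} (G : LSpace d C) : ‖G‖ₑ = ∫⁻ η, ‖G η‖ₑ ∂weightedMeasure d C := by
  rw [Lp.enorm_def, eLpNorm_one_eq_lintegral_enorm]

theorem coeFn_incl {c C : ℝ} (h0 : 0 < c) (h1 : c ≤ C) (G : LSpace d C) :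
    ∀ᵐ η ∂lebesguePoisson d, incl d h0 h1 G η = G η := by
  rw [← ae_weighted_iff h0]
  exact ((Lp.memLp G).mono_measure (weightedMeasure_mono h0.le h1)).coeFn_toLp

theorem enorm_incl {c C : ℝ} (h0 : 0 < c) (h1 : c ≤ C) (G : LSpace d C) :
    ‖incl d h0 h1 G‖ₑ = ∫⁻ η, ‖G η‖ₑ ∂weightedMeasure d c := by
  rw [enorm_LSpace]
  refine lintegral_congr_ae ?_
  filter_upwards [(ae_weighted_iff h0).2 (coeFn_incl h0 h1 G)] with η hη
  rw [hη]

theorem incl_self {C : ℝ} (h0 : 0 < C) (G : LSpace d C) : incl d h0 le_rfl G = G := by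
  apply Lp.ext
  exact (ae_weighted_iff h0).2 (coeFn_incl h0 le_rfl G)

theorem measurable_LSpace {C : ℝ} (G : LSpace d C) : Measurable G :=
  (Lp.stronglyMeasurable G).measurable

theorem inL2C_iff {C : ℝ} {G : LSpace d C} :
    InL2C G ↔ ∫⁻ η, ‖G η‖ₑ ∂weightedMeasure d (2 * C) ≠ ∞ := by
  rw [InL2C, memLp_one_iff_integrable, ← lt_top_iff_ne_top]
  exact ⟨fun h => h.2, fun h => ⟨(Lp.stronglyMeasurable G).aestronglyMeasurable, h⟩⟩

/-- `(L G)(η) = -|η| G(η) + z (B G)(η)` with `B = kernelOp a b`. -/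
def glauberOp (z : ℝ) (a b : Space d → ℝ) (G : FinConf d → ℝ) (η : FinConf d) : ℝ :=
  -(η.card : ℝ) * G η + z * kernelOp a b G η

theorem vlasovOp_eq (z : ℝ) (φ : Space d → ℝ) :
    vlasovOp z φ = glauberOp z 1 (fun u => -φ u) := by
  ext G η
  simp [vlasovOp, glauberOp, kernelOp, lpExp, mul_comm]

variable {φ a b : Space d → ℝ} {β z : ℝ}

theorem lintegral_card_ne_top {C : ℝ} (hC : 0 < C) {g : FinConf d → ℝ≥0∞} (hg : Measurable g)
    (h : ∫⁻ η, g η ∂weightedMeasure d (2 * C) ≠ ∞) :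
    ∫⁻ η, η.card * g η ∂weightedMeasure d C ≠ ∞ :=
  ne_top_of_le_ne_top (ENNReal.mul_ne_top ENNReal.ofReal_ne_top h)
    (lintegral_card_mul_le hC.le (by linarith) hg)

theorem lintegral_enorm_kernelOp_le (hφ : IsPotential φ β) (hk : IsKernel φ a b) (hz : 0 < z)
    {c : ℝ} (hc : 0 < c) {G : FinConf d → ℝ} (hG : Measurable G) :
    ∫⁻ η, ‖z * kernelOp a b G η‖ₑ ∂weightedMeasure d c ≤
      ENNReal.ofReal (z * Real.exp (c * β) / c) *
        ∫⁻ η, η.card * ‖G η‖ₑ ∂weightedMeasure d c := by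
  simp only [enorm_mul]
  rw [lintegral_const_mul' _ _ enorm_ne_top, mul_div_assoc, ENNReal.ofReal_mul hz.le, mul_assoc,
    Real.enorm_of_nonneg hz.le]
  gcongr
  exact (lintegral_mono (hk.enorm_kernelOp_le G)).trans (hφ.lintegral_posOp_le hc hG.enorm)

theorem lintegral_enorm_kernelOp_le' (hφ : IsPotential φ β) (hk : IsKernel φ a b) (hz : 0 < z)
    {c : ℝ} (hc : 0 < c) (hκ : z * Real.exp (c * β) / c ≤ 1) {G : FinConf d → ℝ}
    (hG : Measurable G) :
    ∫⁻ η, ‖z * kernelOp a b G η‖ₑ ∂weightedMeasure d c ≤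
      ∫⁻ η, η.card * ‖G η‖ₑ ∂weightedMeasure d c := by
  refine (lintegral_enorm_kernelOp_le hφ hk hz hc hG).trans ?_
  refine (mul_le_mul_left (ENNReal.ofReal_le_ofReal hκ) _).trans (le_of_eq ?_)
  rw [ENNReal.ofReal_one, one_mul]

theorem measurable_glauberOp (hk : IsKernel φ a b) {G : FinConf d → ℝ} (hG : Measurable G) :
    Measurable (glauberOp z a b G) :=
  (measurable_realCast_card.neg.mul hG).add ((hk.measurable_kernelOp hG).const_mul z)

theorem lintegral_enorm_glauberOp_le (hφ : IsPotential φ β) (hk : IsKernel φ a b) (hz : 0 < z)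
    {c : ℝ} (hc : 0 < c) (hκ : z * Real.exp (c * β) / c ≤ 1) {G : FinConf d → ℝ}
    (hG : Measurable G) :
    ∫⁻ η, ‖glauberOp z a b G η‖ₑ ∂weightedMeasure d c ≤
      2 * ∫⁻ η, η.card * ‖G η‖ₑ ∂weightedMeasure d c := by
  calc _ ≤ ∫⁻ η, ((η.card : ℝ≥0∞) * ‖G η‖ₑ + ‖z * kernelOp a b G η‖ₑ) ∂weightedMeasure d c := by
        refine lintegral_mono fun η => (enorm_add_le _ _).trans ?_
        rw [enorm_mul, enorm_neg, Real.enorm_natCast]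
    _ = ∫⁻ η, η.card * ‖G η‖ₑ ∂weightedMeasure d c +
        ∫⁻ η, ‖z * kernelOp a b G η‖ₑ ∂weightedMeasure d c :=
        lintegral_add_left (measurable_natCast_card.mul hG.enorm) _
    _ ≤ _ := by
        rw [two_mul]
        exact add_le_add_right (lintegral_enorm_kernelOp_le' hφ hk hz hc hκ hG) _

theorem memLp_glauberOp (hφ : IsPotential φ β) (hk : IsKernel φ a b) (hz : 0 < z) {C : ℝ}
    (hC : 0 < C) (hκ : z * Real.exp (C * β) / C ≤ 1) {G : FinConf d → ℝ} (hG : Measurable G)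
    (hGf : ∫⁻ η, ‖G η‖ₑ ∂weightedMeasure d (2 * C) ≠ ∞) :
    MemLp (glauberOp z a b G) 1 (weightedMeasure d C) := by
  rw [memLp_one_iff_integrable]
  refine ⟨(measurable_glauberOp hk hG).aestronglyMeasurable, ?_⟩
  refine lt_of_le_of_lt (lintegral_enorm_glauberOp_le hφ hk hz hC hκ hG) ?_
  exact ENNReal.mul_lt_top ENNReal.ofNat_lt_top
    (lintegral_card_ne_top hC hG.enorm hGf).lt_top

theorem glauberOp_linear_ae (hφ : IsPotential φ β) (hk : IsKernel φ a b) {C : ℝ} (hC : 0 < C)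
    {G H K : FinConf d → ℝ} (hG : Measurable G) (hH : Measurable H) (hK : Measurable K)
    (hGf : ∫⁻ η, ‖G η‖ₑ ∂weightedMeasure d (2 * C) ≠ ∞)
    (hHf : ∫⁻ η, ‖H η‖ₑ ∂weightedMeasure d (2 * C) ≠ ∞) (r s : ℝ)
    (h : ∀ᵐ η ∂lebesguePoisson d, K η = r * G η + s * H η) :
    ∀ᵐ η ∂lebesguePoisson d,
      glauberOp z a b K η = r * glauberOp z a b G η + s * glauberOp z a b H η := by
  filter_upwards [h, kernelOp_linear_ae hφ hk hC hG hH hK (lintegral_card_ne_top hC hG.enorm hGf)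
    (lintegral_card_ne_top hC hH.enorm hHf) r s h] with η h1 h2
  rw [glauberOp, glauberOp, glauberOp, h1, h2]
  ring

theorem InL2C.add_smul {C : ℝ} (hC : 0 < C) {G H : LSpace d C} (hG : InL2C G) (hH : InL2C H)
    (r s : ℝ) : InL2C (r • G + s • H) := by
  have h : (r • G + s • H : LSpace d C) =ᵐ[weightedMeasure d (2 * C)] r • ⇑G + s • ⇑H := by
    refine (weightedMeasure_ac hC).ae_le ?_
    filter_upwards [Lp.coeFn_add (r • G) (s • H), Lp.coeFn_smul r G, Lp.coeFn_smul s H]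
      with η h1 h2 h3
    rw [h1, Pi.add_apply, h2, h3, Pi.add_apply]
  exact (memLp_congr_ae h).2 ((MemLp.const_smul hG r).add (MemLp.const_smul hH s))

/-- The graph of `(L, L_{2C})` as a subspace of `L_C × L_C`. -/
def coreGraph (hφ : IsPotential φ β) (hk : IsKernel φ a b) (z : ℝ) {C : ℝ} (hC : 0 < C) :
    Submodule ℝ (LSpace d C × LSpace d C) where
  carrier := {p | InL2C p.1 ∧ p.2 =ᵐ[lebesguePoisson d] glauberOp z a b p.1}
  add_mem' := by
    rintro ⟨G, G'⟩ ⟨H, H'⟩ ⟨hG, hG'⟩ ⟨hH, hH'⟩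
    have h1 := InL2C.add_smul hC hG hH 1 1
    rw [one_smul, one_smul] at h1
    refine ⟨h1, ?_⟩
    have h2 := (ae_weighted_iff hC).1 (Lp.coeFn_add G H)
    have h3 := (ae_weighted_iff hC).1 (Lp.coeFn_add G' H')
    have h4 := glauberOp_linear_ae (z := z) hφ hk hC (measurable_LSpace G) (measurable_LSpace H)
      (measurable_LSpace (G + H)) (inL2C_iff.1 hG) (inL2C_iff.1 hH) 1 1
      (by filter_upwards [h2] with η hη; rw [hη, Pi.add_apply, one_mul, one_mul])
    filter_upwards [h3, h4, hG', hH'] with η h5 h6 h7 h8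
    simp only [Prod.mk_add_mk] at h5 h6 h7 h8 ⊢
    rw [h5, Pi.add_apply, h6, h7, h8, one_mul, one_mul]
  zero_mem' := by
    have h2 := (ae_weighted_iff hC).1 (Lp.coeFn_zero ℝ 1 (weightedMeasure d C))
    have hf : ∫⁻ η, ‖(0 : FinConf d → ℝ) η‖ₑ ∂weightedMeasure d (2 * C) ≠ ∞ := by simp
    refine ⟨?_, ?_⟩
    · rw [inL2C_iff]
      have : ∫⁻ η, ‖(0 : LSpace d C) η‖ₑ ∂weightedMeasure d (2 * C) = 0 := by
        rw [← lintegral_zero (μ := weightedMeasure d (2 * C))]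
        refine lintegral_congr_ae ?_
        filter_upwards [(ae_weighted_iff (by positivity)).2 h2] with η hη
        rw [hη, Pi.zero_apply, enorm_zero]
      exact this ▸ ENNReal.zero_ne_top
    · have h4 := glauberOp_linear_ae (z := z) hφ hk hC measurable_zero measurable_zero
        (measurable_LSpace (0 : LSpace d C)) hf hf 0 0
        (by filter_upwards [h2] with η hη; rw [hη]; simp)
      filter_upwards [h2, h4] with η h5 h6
      simp only [Prod.fst_zero, Prod.snd_zero]
      rw [h5, h6]
      simp
  smul_mem' := by
    rintro r ⟨G, G'⟩ ⟨hG, hG'⟩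
    have h1 := InL2C.add_smul hC hG hG r 0
    rw [zero_smul, add_zero] at h1
    refine ⟨h1, ?_⟩
    have h2 := (ae_weighted_iff hC).1 (Lp.coeFn_smul r G)
    have h3 := (ae_weighted_iff hC).1 (Lp.coeFn_smul r G')
    have h4 := glauberOp_linear_ae (z := z) hφ hk hC (measurable_LSpace G) (measurable_LSpace G)
      (measurable_LSpace (r • G)) (inL2C_iff.1 hG) (inL2C_iff.1 hG) r 0
      (by filter_upwards [h2] with η hη; rw [hη, Pi.smul_apply, smul_eq_mul, zero_mul, add_zero])
    filter_upwards [h3, h4, hG'] with η h5 h6 h7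
    simp only [Prod.smul_mk] at h5 h6 h7 ⊢
    rw [h5, Pi.smul_apply, h6, h7, smul_eq_mul, zero_mul, add_zero]

/-- Every function in `L_{2C}` gives an element of the graph. -/
theorem exists_mem_coreGraph (hφ : IsPotential φ β) (hk : IsKernel φ a b) (hz : 0 < z) {C : ℝ}
    (hC : 0 < C) (hκ : z * Real.exp (C * β) / C ≤ 1) {G : FinConf d → ℝ} (hG : Measurable G)
    (hGf : ∫⁻ η, ‖G η‖ₑ ∂weightedMeasure d (2 * C) ≠ ∞) :
    ∃ p ∈ coreGraph hφ hk z hC, (∀ᵐ η ∂lebesguePoisson d, p.1 η = G η) ∧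
      ∀ᵐ η ∂lebesguePoisson d, p.2 η = glauberOp z a b G η := by
  have hG2 : MemLp G 1 (weightedMeasure d (2 * C)) := by
    rw [memLp_one_iff_integrable]
    exact ⟨hG.aestronglyMeasurable, hGf.lt_top⟩
  have hG1 : MemLp G 1 (weightedMeasure d C) :=
    hG2.mono_measure (weightedMeasure_mono hC.le (by linarith))
  have hL := memLp_glauberOp hφ hk hz hC hκ hG hGf
  have h1 := (ae_weighted_iff hC).1 hG1.coeFn_toLp
  have h2 := (ae_weighted_iff hC).1 hL.coeFn_toLp
  refine ⟨(hG1.toLp G, hL.toLp _), ⟨?_, ?_⟩, h1, h2⟩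
  · exact (memLp_congr_ae ((ae_weighted_iff (by positivity)).2 h1)).2 hG2
  · have h4 := glauberOp_linear_ae (z := z) hφ hk hC hG hG (measurable_LSpace (hG1.toLp G))
      hGf hGf 1 0 (by filter_upwards [h1] with η hη; rw [hη]; ring)
    filter_upwards [h2, h4] with η h5 h6
    rw [h5, h6]
    ring

/-- From `(1 + |η|/μ) G = (G - μ⁻¹ L G) + μ⁻¹ z B G`, integration produces `μ⁻¹ ∫ |η| |G|` on the
left and at most the same quantity on the right. It is finite because `G ∈ L_{2C}`, so it cancels.
-/
theorem coreGraph_dissipative (hφ : IsPotential φ β) (hk : IsKernel φ a b) (hz : 0 < z) {c C : ℝ}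
    (hc : 0 < c) (hcC : c ≤ C) (hκ : z * Real.exp (c * β) / c ≤ 1) {μ : ℝ} (hμ : 0 < μ)
    {p : LSpace d C × LSpace d C} (hp : p ∈ coreGraph hφ hk z (hc.trans_le hcC)) :
    ‖incl d hc hcC p.1‖ ≤ ‖incl d hc hcC (p.1 - μ⁻¹ • p.2)‖ := by
  have hC := hc.trans_le hcC
  rw [← enorm_le_iff_norm_le, enorm_incl, enorm_incl]
  have hGm := measurable_LSpace p.1
  have hfin : ∫⁻ η, η.card * ‖p.1 η‖ₑ ∂weightedMeasure d c ≠ ∞ :=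
    ne_top_of_le_ne_top (lintegral_card_ne_top hC hGm.enorm (inL2C_iff.1 hp.1))
      (lintegral_mono' (weightedMeasure_mono hc.le hcC) le_rfl)
  have hm1 : Measurable fun η => ENNReal.ofReal μ⁻¹ * ((η.card : ℝ≥0∞) * ‖p.1 η‖ₑ) :=
    (measurable_natCast_card.mul hGm.enorm).const_mul _
  have h1 : ∫⁻ η, ‖p.1 η‖ₑ ∂weightedMeasure d c +
      ENNReal.ofReal μ⁻¹ * ∫⁻ η, η.card * ‖p.1 η‖ₑ ∂weightedMeasure d c ≤
      ∫⁻ η, ‖(p.1 - μ⁻¹ • p.2) η‖ₑ ∂weightedMeasure d c +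
      ENNReal.ofReal μ⁻¹ * ∫⁻ η, ‖z * kernelOp a b p.1 η‖ₑ ∂weightedMeasure d c := by
    rw [← lintegral_const_mul' _ _ ENNReal.ofReal_ne_top,
      ← lintegral_const_mul' _ _ ENNReal.ofReal_ne_top, ← lintegral_add_left hGm.enorm,
      ← lintegral_add_left (measurable_LSpace _).enorm]
    refine lintegral_mono_ae ?_
    rw [ae_weighted_iff hc]
    filter_upwards [hp.2, (ae_weighted_iff hC).1 (Lp.coeFn_sub p.1 (μ⁻¹ • p.2)),
      (ae_weighted_iff hC).1 (Lp.coeFn_smul μ⁻¹ p.2)] with η h2 h3 h4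
    have h5 : (p.1 - μ⁻¹ • p.2) η = (1 + μ⁻¹ * η.card) * p.1 η - μ⁻¹ * (z * kernelOp a b p.1 η) := by
      rw [h3, Pi.sub_apply, h4, Pi.smul_apply, h2, glauberOp, smul_eq_mul]
      ring
    have h6 : ‖p.1 η‖ₑ + ENNReal.ofReal μ⁻¹ * (η.card * ‖p.1 η‖ₑ) =
        ‖(1 + μ⁻¹ * η.card) * p.1 η‖ₑ := by
      have h0 : 0 ≤ 1 + μ⁻¹ * (η.card : ℝ) := by positivity
      rw [enorm_mul, Real.enorm_of_nonneg h0, ENNReal.ofReal_add zero_le_one (by positivity), ENNReal.ofReal_mul (by positivity), ENNReal.ofReal_one,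
        ENNReal.ofReal_natCast]
      ring
    have h7 : ENNReal.ofReal μ⁻¹ * ‖z * kernelOp a b p.1 η‖ₑ =
        ‖μ⁻¹ * (z * kernelOp a b p.1 η)‖ₑ := by
      rw [enorm_mul μ⁻¹, Real.enorm_of_nonneg (inv_nonneg.2 hμ.le)]
    rw [h6, h7, h5]
    refine le_trans (le_of_eq ?_) (enorm_add_le _ _)
    rw [sub_add_cancel]
  have h8 := h1.trans (add_le_add_right (mul_le_mul_right
    (lintegral_enorm_kernelOp_le' hφ hk hz hc hκ hGm) (ENNReal.ofReal μ⁻¹)) _)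
  exact (ENNReal.add_le_add_iff_right (ENNReal.mul_ne_top ENNReal.ofReal_ne_top hfin)).1 h8

/-- Truncation to `|η| ≤ n`, where the weights for `C` and `2C` differ by a factor of at most `2^n`.
-/
theorem dense_inL2C {C : ℝ} (hC : 0 < C) : Dense {G : LSpace d C | InL2C G} := by
  intro G
  have hGm := measurable_LSpace G
  have hs : ∀ n : ℕ, MeasurableSet {η : FinConf d | η.card ≤ n} := fun n =>
    measurable_card (measurableSet_Iic (a := n))
  have hmem : ∀ n : ℕ, MemLp ({η : FinConf d | η.card ≤ n}.indicator G) 1 (weightedMeasure d C) :=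
    fun n => (Lp.memLp G).indicator (hs n)
  have hL : ∀ n : ℕ, InL2C ((hmem n).toLp _) := by
    intro n
    rw [inL2C_iff]
    have h1 : ∫⁻ η, ‖(hmem n).toLp _ η‖ₑ ∂weightedMeasure d (2 * C) ≤
        ENNReal.ofReal (2 ^ n) * ∫⁻ η, ‖G η‖ₑ ∂weightedMeasure d C := by
      rw [lintegral_weighted_eq _ (measurable_LSpace _).enorm, lintegral_weighted_eq _ hGm.enorm,
        ← lintegral_const_mul' _ _ ENNReal.ofReal_ne_top]
      refine lintegral_mono_ae ?_
      filter_upwards [(ae_weighted_iff hC).1 (hmem n).coeFn_toLp] with η hη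
      rw [hη]
      by_cases hc : η.card ≤ n
      · rw [Set.indicator_of_mem (show η ∈ {η : FinConf d | η.card ≤ n} from hc), ← mul_assoc,
          ← ENNReal.ofReal_mul (by positivity), mul_pow]
        gcongr
        norm_num
      · rw [Set.indicator_of_notMem (show η ∉ {η : FinConf d | η.card ≤ n} from hc)]
        simp
    refine ne_top_of_le_ne_top (ENNReal.mul_ne_top ENNReal.ofReal_ne_top ?_) h1
    rw [← enorm_LSpace]
    exact enorm_ne_top
  refine mem_closure_of_tendsto (f := fun n : ℕ => (hmem n).toLp _) (b := atTop) ?_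
    (Eventually.of_forall hL)
  rw [tendsto_iff_norm_sub_tendsto_zero]
  have hGi : Integrable G (weightedMeasure d C) := L1.integrable_coeFn G
  have h1 : Tendsto (fun n : ℕ => ∫ η, ‖{η : FinConf d | η.card ≤ n}.indicator G η - G η‖
      ∂weightedMeasure d C) atTop (𝓝 (∫ η, 0 ∂weightedMeasure d C)) := by
    refine tendsto_integral_of_dominated_convergence (fun η => 2 * ‖G η‖) (fun n => ?_)
      (hGi.norm.const_mul 2) (fun n => Eventually.of_forall fun η => ?_)
      (Eventually.of_forall fun η => ?_)
    · exact ((hGi.1.indicator (hs n)).sub hGi.1).norm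
    · rw [norm_norm]
      refine (norm_sub_le _ _).trans ?_
      linarith [norm_indicator_le_norm_self (s := {η : FinConf d | η.card ≤ n}) (f := G) η]
    · refine tendsto_const_nhds.congr' ?_
      filter_upwards [eventually_ge_atTop η.card] with n hn
      rw [Set.indicator_of_mem (show η ∈ {η : FinConf d | η.card ≤ n} from hn), sub_self, norm_zero]
  rw [integral_zero] at h1
  refine h1.congr fun n => ?_
  rw [L1.norm_eq_integral_norm]
  refine integral_congr_ae ?_
  filter_upwards [(hmem n).coeFn_toLp, Lp.coeFn_sub ((hmem n).toLp _) G] with η h2 h3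
  rw [h3, Pi.sub_apply, h2]

/-- The operator `F ↦ z B (μ + |·|)⁻¹ F` whose Neumann series gives the resolvent. -/
def neumannOp (z : ℝ) (a b : Space d → ℝ) (μ : ℝ) (F : FinConf d → ℝ) (η : FinConf d) : ℝ :=
  μ⁻¹ * (z * kernelOp a b (fun η => F η / (1 + μ⁻¹ * η.card)) η)

theorem measurable_div_card {μ : ℝ} {F : FinConf d → ℝ} (hF : Measurable F) :
    Measurable fun η : FinConf d => F η / (1 + μ⁻¹ * η.card) :=
  hF.div ((measurable_realCast_card.const_mul _).const_add _)

theorem measurable_neumannOp (hk : IsKernel φ a b) (z μ : ℝ) {F : FinConf d → ℝ}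
    (hF : Measurable F) : Measurable (neumannOp z a b μ F) :=
  ((hk.measurable_kernelOp (measurable_div_card hF)).const_mul z).const_mul _

theorem enorm_div_card_le {μ : ℝ} (hμ : 0 < μ) (s : ℝ) (n : ℕ) :
    ‖s / (1 + μ⁻¹ * n)‖ₑ ≤ ‖s‖ₑ := by
  rw [enorm_le_iff_norm_le, norm_div]
  refine div_le_self (norm_nonneg _) ?_
  have : 0 ≤ μ⁻¹ * (n : ℝ) := by positivity
  rw [Real.norm_of_nonneg (by positivity)]
  linarith

/-- The factor `|η|` of the key estimate is absorbed by `(|η|/μ) / (1 + |η|/μ) ≤ 1`. -/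
theorem lintegral_enorm_neumannOp_le (hφ : IsPotential φ β) (hk : IsKernel φ a b) (hz : 0 < z)
    {c : ℝ} (hc : 0 < c) {μ : ℝ} (hμ : 0 < μ) {F : FinConf d → ℝ} (hF : Measurable F) :
    ∫⁻ η, ‖neumannOp z a b μ F η‖ₑ ∂weightedMeasure d c ≤
      ENNReal.ofReal (z * Real.exp (c * β) / c) * ∫⁻ η, ‖F η‖ₑ ∂weightedMeasure d c := by
  have h1 : ∀ η, ‖neumannOp z a b μ F η‖ₑ = ENNReal.ofReal μ⁻¹ *
      ‖z * kernelOp a b (fun η => F η / (1 + μ⁻¹ * η.card)) η‖ₑ := fun η => by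
    rw [neumannOp, enorm_mul μ⁻¹, Real.enorm_of_nonneg (inv_nonneg.2 hμ.le)]
  simp only [h1]
  rw [lintegral_const_mul' _ _ ENNReal.ofReal_ne_top]
  refine (mul_le_mul_right (lintegral_enorm_kernelOp_le hφ hk hz hc
    (measurable_div_card hF)) _).trans ?_
  rw [mul_left_comm, ← lintegral_const_mul' _ _ ENNReal.ofReal_ne_top]
  refine mul_le_mul_right (lintegral_mono fun η => ?_) _
  have h2 : 0 ≤ μ⁻¹ * (η.card : ℝ) := by positivity
  have h3 : ENNReal.ofReal μ⁻¹ * (η.card * ‖F η / (1 + μ⁻¹ * η.card)‖ₑ) =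
      ‖μ⁻¹ * η.card * (F η / (1 + μ⁻¹ * η.card))‖ₑ := by
    rw [enorm_mul (μ⁻¹ * (η.card : ℝ)), Real.enorm_of_nonneg h2,
      ENNReal.ofReal_mul (inv_nonneg.2 hμ.le), ENNReal.ofReal_natCast, mul_assoc]
  rw [h3, enorm_le_iff_norm_le, norm_mul, norm_div, Real.norm_of_nonneg h2,
    Real.norm_of_nonneg (by positivity : (0 : ℝ) ≤ 1 + μ⁻¹ * η.card), mul_div_assoc',
    div_le_iff₀ (by positivity)]
  nlinarith [norm_nonneg (F η)]

/-- Let `F n` be the iterates of `neumannOp` on `f ∈ L_{2C}`. They stay in `L_{2C}`, and `F n - F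
(n+1)` is the image under `1 - μ⁻¹ L` of `F n / (1 + |·|/μ)`. Hence `f - F n` lies in the range by
telescoping, and `F n → 0` in `L_C` because the iteration contracts strictly at some weight between
`C` and `2C`. -/
theorem coreGraph_range (hφ : IsPotential φ β) (hk : IsKernel φ a b) (hz : 0 < z) {C : ℝ}
    (hC : 0 < C) (hκ : z * Real.exp (C * β) / C ≤ 1)
    (hlt : ∃ c, C ≤ c ∧ c ≤ 2 * C ∧ z * Real.exp (c * β) / c < 1) {μ : ℝ} (hμ : 0 < μ)
    (f : LSpace d C) :
    f ∈ closure ((fun p : LSpace d C × LSpace d C => p.1 - μ⁻¹ • p.2) ''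
      (coreGraph hφ hk z hC : Set (LSpace d C × LSpace d C))) := by
  let Λ : (LSpace d C × LSpace d C) →ₗ[ℝ] LSpace d C :=
    LinearMap.fst ℝ _ _ - μ⁻¹ • LinearMap.snd ℝ _ _
  let R : Submodule ℝ (LSpace d C) := (coreGraph hφ hk z hC).map Λ
  have hR : ((fun p : LSpace d C × LSpace d C => p.1 - μ⁻¹ • p.2) ''
      (coreGraph hφ hk z hC : Set (LSpace d C × LSpace d C))) = R := rfl
  rw [hR]
  suffices h : ∀ f : LSpace d C, InL2C f → f ∈ closure (R : Set (LSpace d C)) from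
    closure_minimal h isClosed_closure (dense_inL2C hC f)
  intro f hf
  let F : ℕ → FinConf d → ℝ := fun n => (neumannOp z a b μ)^[n] f
  have hF0 : F 0 = f := rfl
  have hFs : ∀ n, F (n + 1) = neumannOp z a b μ (F n) := fun n =>
    Function.iterate_succ_apply' _ _ _
  have hFm : ∀ n, Measurable (F n) := by
    intro n
    induction n with
    | zero => exact measurable_LSpace f
    | succ n ih => rw [hFs]; exact measurable_neumannOp hk z μ ih
  have hbound : ∀ c, 0 < c → ∀ n, ∫⁻ η, ‖F n η‖ₑ ∂weightedMeasure d c ≤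
      ENNReal.ofReal (z * Real.exp (c * β) / c) ^ n * ∫⁻ η, ‖f η‖ₑ ∂weightedMeasure d c := by
    intro c hc n
    induction n with
    | zero => rw [pow_zero, one_mul, hF0]
    | succ n ih =>
      rw [hFs, pow_succ', mul_assoc]
      exact (lintegral_enorm_neumannOp_le hφ hk hz hc hμ (hFm n)).trans (mul_le_mul_right ih _)
  have hfin : ∀ n, ∫⁻ η, ‖F n η‖ₑ ∂weightedMeasure d (2 * C) ≠ ∞ := fun n =>
    ne_top_of_le_ne_top (ENNReal.mul_ne_top (ENNReal.pow_ne_top ENNReal.ofReal_ne_top)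
      (inL2C_iff.1 hf)) (hbound (2 * C) (by positivity) n)
  have hmem : ∀ n, MemLp (F n) 1 (weightedMeasure d C) := fun n => by
    rw [memLp_one_iff_integrable]
    refine ⟨(hFm n).aestronglyMeasurable, lt_of_le_of_lt ?_ (hfin n).lt_top⟩
    exact lintegral_mono' (weightedMeasure_mono hC.le (by linarith)) le_rfl
  have hstep : ∀ n, (hmem n).toLp - (hmem (n + 1)).toLp ∈ R := by
    intro n
    obtain ⟨p, hp, hp1, hp2⟩ := exists_mem_coreGraph (z := z) hφ hk hz hC hκ
      (measurable_div_card (μ := μ) (hFm n)) (ne_top_of_le_ne_top (hfin n)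
        (lintegral_mono fun η => enorm_div_card_le hμ _ _))
    refine ⟨p, hp, ?_⟩
    change p.1 - μ⁻¹ • p.2 = _
    apply Lp.ext
    rw [Filter.EventuallyEq, ae_weighted_iff hC]
    filter_upwards [hp1, hp2, (ae_weighted_iff hC).1 (Lp.coeFn_sub p.1 (μ⁻¹ • p.2)),
      (ae_weighted_iff hC).1 (Lp.coeFn_smul μ⁻¹ p.2),
      (ae_weighted_iff hC).1 (Lp.coeFn_sub (hmem n).toLp (hmem (n + 1)).toLp),
      (ae_weighted_iff hC).1 (hmem n).coeFn_toLp,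
      (ae_weighted_iff hC).1 (hmem (n + 1)).coeFn_toLp] with η h1 h2 h3 h4 h5 h6 h7
    rw [h3, h5, Pi.sub_apply, Pi.sub_apply, h4, h6, h7, Pi.smul_apply, h1, h2, hFs, neumannOp,
      glauberOp, smul_eq_mul]
    have h8 : (0 : ℝ) < 1 + μ⁻¹ * η.card := by positivity
    have h9 : F n η = F n η / (1 + μ⁻¹ * η.card) * (1 + μ⁻¹ * η.card) :=
      (div_mul_cancel₀ _ h8.ne').symm
    linear_combination -h9
  have hsum : ∀ n, (hmem 0).toLp - (hmem n).toLp ∈ R := by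
    intro n
    induction n with
    | zero => rw [sub_self]; exact R.zero_mem
    | succ n ih =>
      have := R.add_mem ih (hstep n)
      rwa [sub_add_sub_cancel] at this
  have hf0 : (hmem 0).toLp = f := Lp.toLp_coeFn f (hmem 0)
  obtain ⟨c, hc1, hc2, hc3⟩ := hlt
  have hc := hC.trans_le hc1
  have hlim : Tendsto (fun n => (hmem n).toLp) atTop (𝓝 0) := by
    rw [tendsto_zero_iff_enorm_tendsto_zero]
    have h1 : ∀ n, ‖(hmem n).toLp‖ₑ ≤ ENNReal.ofReal (z * Real.exp (c * β) / c) ^ n *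
        ∫⁻ η, ‖f η‖ₑ ∂weightedMeasure d (2 * C) := by
      intro n
      rw [enorm_LSpace]
      calc _ = ∫⁻ η, ‖F n η‖ₑ ∂weightedMeasure d C := by
            refine lintegral_congr_ae ?_
            filter_upwards [(hmem n).coeFn_toLp] with η h2
            rw [h2]
        _ ≤ ∫⁻ η, ‖F n η‖ₑ ∂weightedMeasure d c :=
            lintegral_mono' (weightedMeasure_mono hC.le hc1) le_rfl
        _ ≤ _ := hbound c hc n
        _ ≤ _ := mul_le_mul_right (lintegral_mono' (weightedMeasure_mono hc.le hc2) le_rfl) _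
    have h2 : Tendsto (fun n : ℕ => ENNReal.ofReal (z * Real.exp (c * β) / c) ^ n *
        ∫⁻ η, ‖f η‖ₑ ∂weightedMeasure d (2 * C)) atTop (𝓝 0) := by
      have h3 := ENNReal.Tendsto.mul_const (b := ∫⁻ η, ‖f η‖ₑ ∂weightedMeasure d (2 * C))
        (ENNReal.tendsto_pow_atTop_nhds_zero_of_lt_one (r := ENNReal.ofReal
          (z * Real.exp (c * β) / c)) (by rwa [ENNReal.ofReal_lt_one]))
        (Or.inr (inL2C_iff.1 hf))
      rwa [zero_mul] at h3
    exact tendsto_of_tendsto_of_tendsto_of_le_of_le tendsto_const_nhds h2 (fun _ => zero_le) h1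
  refine mem_closure_of_tendsto (b := atTop) (f := fun n => (hmem 0).toLp - (hmem n).toLp) ?_
    (Eventually.of_forall hsum)
  have h4 := hlim.const_sub ((hmem 0).toLp)
  rw [sub_zero, hf0] at h4
  exact h4.congr fun n => by rw [hf0]

/-- The closure of `(L, L_{2C})` generates a contraction semigroup on `L_C`. -/
theorem exists_semigroup_coreGraph (hφ : IsPotential φ β) (hk : IsKernel φ a b) (hz : 0 < z)
    {C : ℝ} (hC : 0 < C) (hκ : z * Real.exp (C * β) / C ≤ 1)
    (hlt : ∃ c, C ≤ c ∧ c ≤ 2 * C ∧ z * Real.exp (c * β) / c < 1) :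
    ∃ (P : ℝ → LSpace d C →L[ℝ] LSpace d C) (T : ContractionSemigroup (LSpace d C)),
      IsResolvent (coreGraph hφ hk z hC).topologicalClosure P ∧ IsYosidaLimit P T ∧
      IsGeneratedByClosure T (glauberOp z a b) := by
  obtain ⟨P, hP⟩ := exists_resolvent_of_dissipative (coreGraph hφ hk z hC)
    (fun μ hμ p hp => by
      have := coreGraph_dissipative hφ hk hz hC le_rfl hκ hμ hp
      rwa [incl_self, incl_self] at this)
    (fun μ hμ f => coreGraph_range hφ hk hz hC hκ hlt hμ f)
  have hd : Dense (Prod.fst '' ((coreGraph hφ hk z hC).topologicalClosure :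
      Set (LSpace d C × LSpace d C))) := by
    refine (dense_inL2C hC).mono fun G hG => ?_
    obtain ⟨p, hp, hp1, -⟩ := exists_mem_coreGraph (z := z) hφ hk hz hC hκ (measurable_LSpace G)
      (inL2C_iff.1 hG)
    exact ⟨p, Submodule.le_topologicalClosure _ hp, Lp.ext ((ae_weighted_iff hC).2 hp1)⟩
  obtain ⟨T, hT, hY⟩ := hP.exists_semigroup hd
  refine ⟨P, T, hP, hY, fun G hG => ?_, hT⟩
  exact memLp_glauberOp hφ hk hz hC hκ (measurable_LSpace G) (inL2C_iff.1 hG)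

theorem norm_le_mul_norm_of_enorm_le {E F : Type*} [NormedAddCommGroup E] [NormedAddCommGroup F]
    {x : E} {y : F} {K : ℝ} (hK : 0 ≤ K) (h : ‖x‖ₑ ≤ ENNReal.ofReal K * ‖y‖ₑ) :
    ‖x‖ ≤ K * ‖y‖ := by
  rw [← ofReal_norm, ← ofReal_norm, ← ENNReal.ofReal_mul hK] at h
  exact (ENNReal.ofReal_le_ofReal_iff (by positivity)).1 h

theorem norm_incl_snd_le (hφ : IsPotential φ β) (hk : IsKernel φ a b) (hz : 0 < z) {c C : ℝ}
    (hc : 0 < c) (hcC : c < C) (hκ : z * Real.exp (c * β) / c ≤ 1)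
    {p : LSpace d C × LSpace d C} (hp : p ∈ coreGraph hφ hk z (hc.trans hcC)) :
    ‖incl d hc hcC.le p.2‖ ≤ 2 * (1 - c / C)⁻¹ * ‖p.1‖ := by
  have hC := hc.trans hcC
  have h0 : 0 ≤ (1 - c / C)⁻¹ := inv_nonneg.2 (sub_nonneg.2 ((div_le_one hC).2 hcC.le))
  refine norm_le_mul_norm_of_enorm_le (by positivity) ?_
  rw [enorm_incl, enorm_LSpace]
  calc _ = ∫⁻ η, ‖glauberOp z a b p.1 η‖ₑ ∂weightedMeasure d c := by
        refine lintegral_congr_ae ?_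
        filter_upwards [(ae_weighted_iff hc).2 hp.2] with η h1
        rw [h1]
    _ ≤ _ := lintegral_enorm_glauberOp_le hφ hk hz hc hκ (measurable_LSpace p.1)
    _ ≤ _ := mul_le_mul_right (lintegral_card_mul_le hc.le hcC (measurable_LSpace p.1).enorm) _
    _ = _ := by
        rw [ENNReal.ofReal_mul zero_le_two, mul_assoc]
        simp

/-- The kernel difference brings one factor `|η|`, paid for between `c` and `c'`; the key estimate
at `c'` brings another, paid for between `c'` and `C`. The condition `z e^{c'β}/c' ≤ 1` removes `z`
and `β` from the constant. -/
theorem exists_mem_coreGraph_norm_sub_le {b' : Space d → ℝ} {δ : ℝ} (hφ : IsPotential φ β)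
    (hk : IsKernel φ a b) (hk' : IsKernel φ 1 b') (had : ∀ x, |a x - 1| ≤ δ)
    (hbd : ∀ x, |b x - b' x| ≤ δ * φ x) (hz : 0 < z) {c c' C : ℝ} (hc : 0 < c) (hcc' : c < c')
    (hc'C : c' < C) (hκ : z * Real.exp (C * β) / C ≤ 1) (hκ' : z * Real.exp (c' * β) / c' ≤ 1)
    {p : LSpace d C × LSpace d C}
    (hp : p ∈ coreGraph hφ hk' z (hc.trans (hcc'.trans hc'C))) :
    ∃ y, (p.1, y) ∈ coreGraph hφ hk z (hc.trans (hcc'.trans hc'C)) ∧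
      ‖incl d hc (hcc'.trans hc'C).le (y - p.2)‖ ≤
        δ * ((1 - c / c')⁻¹ * (1 - c' / C)⁻¹) * ‖p.1‖ := by
  have hc' := hc.trans hcc'
  have hC := hc'.trans hc'C
  have hδ : 0 ≤ δ := (abs_nonneg _).trans (had 0)
  have h0 : 0 ≤ (1 - c / c')⁻¹ := inv_nonneg.2 (sub_nonneg.2 ((div_le_one hc').2 hcc'.le))
  have h0' : 0 ≤ (1 - c' / C)⁻¹ := inv_nonneg.2 (sub_nonneg.2 ((div_le_one hC).2 hc'C.le))
  have hm := measurable_LSpace p.1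
  have hfin := inL2C_iff.1 hp.1
  obtain ⟨q, hq, hq1, hq2⟩ := exists_mem_coreGraph (z := z) hφ hk hz hC hκ hm hfin
  have hq1' : q.1 = p.1 := Lp.ext ((ae_weighted_iff hC).2 hq1)
  refine ⟨q.2, by rw [← hq1']; exact hq, ?_⟩
  refine norm_le_mul_norm_of_enorm_le (by positivity) ?_
  rw [enorm_incl, enorm_LSpace]
  set u : FinConf d → ℝ≥0∞ := posOp (fun x => ENNReal.ofReal (φ x)) (fun η => ‖p.1 η‖ₑ) with hu
  have hum : Measurable u := measurable_posOp hφ.measurable.ennreal_ofReal hm.enorm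
  have hfinC := lintegral_card_ne_top hC hm.enorm hfin
  calc ∫⁻ η, ‖(q.2 - p.2) η‖ₑ ∂weightedMeasure d c
      ≤ ∫⁻ η, ENNReal.ofReal (z * δ) * (η.card * u η) ∂weightedMeasure d c := by
        refine lintegral_mono_ae ?_
        rw [ae_weighted_iff hc]
        filter_upwards [hq2, hp.2, (ae_weighted_iff hC).1 (Lp.coeFn_sub q.2 p.2),
          hφ.ae_posOp_lt_top hC hm.enorm hfinC] with η h1 h2 h3 h4
        have h5 : (q.2 - p.2) η = z * (kernelOp a b p.1 η - kernelOp 1 b' p.1 η) := by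
          rw [h3, Pi.sub_apply, h1, h2, glauberOp, glauberOp]
          ring
        rw [h5, enorm_mul, Real.enorm_of_nonneg hz.le, ENNReal.ofReal_mul hz.le, mul_assoc]
        exact mul_le_mul_right (enorm_kernelOp_sub_le hφ.nonneg hk hk' had hbd hm h4) _
    _ = ENNReal.ofReal (z * δ) * ∫⁻ η, η.card * u η ∂weightedMeasure d c :=
        lintegral_const_mul' _ _ ENNReal.ofReal_ne_top
    _ ≤ ENNReal.ofReal (z * δ) * (ENNReal.ofReal (1 - c / c')⁻¹ *
          (ENNReal.ofReal (Real.exp (c' * β) / c') * (ENNReal.ofReal (1 - c' / C)⁻¹ *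
            ∫⁻ η, ‖p.1 η‖ₑ ∂weightedMeasure d C))) := by
        refine mul_le_mul_right ((lintegral_card_mul_le hc.le hcc' hum).trans ?_) _
        refine mul_le_mul_right ((hφ.lintegral_posOp_le hc' hm.enorm).trans ?_) _
        exact mul_le_mul_right (lintegral_card_mul_le hc'.le hc'C hm.enorm) _
    _ ≤ _ := by
        rw [← mul_assoc, ← mul_assoc, ← mul_assoc, ← ENNReal.ofReal_mul (by positivity),
          ← ENNReal.ofReal_mul (by positivity), ← ENNReal.ofReal_mul (by positivity)]
        refine mul_le_mul_left (ENNReal.ofReal_le_ofReal ?_) _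
        calc z * δ * (1 - c / c')⁻¹ * (Real.exp (c' * β) / c') * (1 - c' / C)⁻¹
            = z * Real.exp (c' * β) / c' * (δ * ((1 - c / c')⁻¹ * (1 - c' / C)⁻¹)) := by ring
          _ ≤ 1 * (δ * ((1 - c / c')⁻¹ * (1 - c' / C)⁻¹)) := by gcongr
          _ = _ := one_mul _

end Generators

/-! ### `K_C` as the dual of `L_C` -/

section Dual

variable {d : ℕ}

theorem ae_abs_scaled_le {c : ℝ} {k : FinConf d →ₘ[lebesguePoisson d] ℝ}
    (hk : MemLp (scaled c k) ∞ (lebesguePoisson d)) :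
    ∀ᵐ η ∂lebesguePoisson d, |scaled c k η| ≤ kNorm c k := by
  have h := ae_le_eLpNormEssSup (f := scaled c k) (μ := lebesguePoisson d)
  have hfin := hk.2.ne
  rw [eLpNorm_exponent_top] at hfin
  filter_upwards [h] with η hη
  rw [kNorm, eLpNorm_exponent_top, ← Real.norm_eq_abs, ← toReal_enorm]
  exact ENNReal.toReal_mono hfin hη

theorem kNorm_le_of_ae {c M : ℝ} (hM : 0 ≤ M) {k : FinConf d →ₘ[lebesguePoisson d] ℝ}
    (h : ∀ᵐ η ∂lebesguePoisson d, |scaled c k η| ≤ M) : kNorm c k ≤ M := by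
  rw [kNorm, eLpNorm_exponent_top]
  refine ENNReal.toReal_le_of_le_ofReal hM ?_
  exact eLpNormEssSup_le_of_ae_bound h

theorem aestronglyMeasurable_scaled (c : ℝ) (k : FinConf d →ₘ[lebesguePoisson d] ℝ) :
    AEStronglyMeasurable (scaled c k) (lebesguePoisson d) := by
  have : Measurable fun η : FinConf d => (c ^ η.card)⁻¹ :=
    (measurable_from_top (f := fun n : ℕ => (c ^ n)⁻¹)).comp measurable_card
  exact this.aestronglyMeasurable.mul k.aestronglyMeasurable

theorem integral_weighted {c : ℝ} (hc : 0 < c) (f : FinConf d → ℝ) :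
    ∫ η, f η ∂weightedMeasure d c = ∫ η, c ^ η.card * f η ∂lebesguePoisson d := by
  rw [weightedMeasure, integral_withDensity_eq_integral_toReal_smul (measurable_weight c)
    (Eventually.of_forall fun _ => ENNReal.ofReal_lt_top)]
  refine integral_congr_ae (Eventually.of_forall fun η => ?_)
  simp only [ENNReal.toReal_ofReal (pow_nonneg hc.le _), smul_eq_mul]

theorem lintegral_enorm_mul_le {c C : ℝ} (hc : 0 < c) (hcC : c ≤ C) (G : LSpace d C)
    {k : FinConf d →ₘ[lebesguePoisson d] ℝ} (hk : MemLp (scaled c k) ∞ (lebesguePoisson d)) :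
    ∫⁻ η, ‖G η * k η‖ₑ ∂lebesguePoisson d ≤
      ENNReal.ofReal (kNorm c k) * ‖incl d hc hcC G‖ₑ := by
  rw [enorm_incl, lintegral_weighted_eq c (measurable_LSpace G).enorm,
    ← lintegral_const_mul' _ _ ENNReal.ofReal_ne_top]
  refine lintegral_mono_ae ?_
  filter_upwards [ae_abs_scaled_le hk] with η hη
  have h1 : k η = scaled c k η * c ^ η.card := by
    rw [scaled, mul_right_comm, inv_mul_cancel₀ (pow_ne_zero _ hc.ne'), one_mul]
  rw [enorm_mul, h1, enorm_mul, Real.enorm_of_nonneg (pow_nonneg hc.le η.card), mul_comm, mul_assoc]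
  refine mul_le_mul_left ?_ _
  rw [Real.enorm_eq_ofReal_abs]
  exact ENNReal.ofReal_le_ofReal hη

theorem integrable_mul {C : ℝ} (hC : 0 < C) (G : LSpace d C) (k : KSpace d C) :
    Integrable (fun η => G η * k.1 η) (lebesguePoisson d) := by
  refine ⟨(measurable_LSpace G).aestronglyMeasurable.mul k.1.aestronglyMeasurable, ?_⟩
  exact lt_of_le_of_lt (lintegral_enorm_mul_le hC le_rfl G k.2)
    (ENNReal.mul_lt_top ENNReal.ofReal_lt_top enorm_lt_top)

theorem abs_pairing_le {c C : ℝ} (hc : 0 < c) (hcC : c ≤ C) (G : LSpace d C)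
    {k : FinConf d →ₘ[lebesguePoisson d] ℝ} (hk : MemLp (scaled c k) ∞ (lebesguePoisson d)) :
    |∫ η, G η * k η ∂lebesguePoisson d| ≤ kNorm c k * ‖incl d hc hcC G‖ := by
  rw [← Real.norm_eq_abs]
  refine norm_le_mul_norm_of_enorm_le ENNReal.toReal_nonneg ?_
  exact (enorm_integral_le_lintegral_enorm _).trans (lintegral_enorm_mul_le hc hcC G hk)

theorem norm_incl_eq {c C : ℝ} (hc : 0 < c) (hcC : c ≤ C) (G : LSpace d C) :
    ‖incl d hc hcC G‖ = ∫ η, |G η| * (c / C) ^ η.card ∂weightedMeasure d C := by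
  have hC := hc.trans_le hcC
  rw [L1.norm_eq_integral_norm, integral_weighted hc, integral_weighted hC]
  refine integral_congr_ae ?_
  filter_upwards [coeFn_incl hc hcC G] with η hη
  rw [hη, Real.norm_eq_abs, div_pow]
  have := pow_pos hC η.card
  field_simp

theorem integral_mul_scaled {C : ℝ} (hC : 0 < C) (G k : FinConf d → ℝ) :
    ∫ η, G η * scaled C k η ∂weightedMeasure d C = ∫ η, G η * k η ∂lebesguePoisson d := by
  rw [integral_weighted hC]
  refine integral_congr_ae (Eventually.of_forall fun η => ?_)
  have := pow_pos hC η.card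
  simp only [scaled]
  field_simp

/-- Converse of `abs_pairing_le`, which characterizes `K_c` inside `K_C` by duality. In `L_C` the
norm of `L_c` is the integral of `|G|` against `(c/C)^{|η|}`, so the pairing bound forces `|C^{-|η|}
k| ≤ M (c/C)^{|η|}`. -/
theorem ae_abs_scaled_le_of_pairing (hd : 1 ≤ d) {c C M : ℝ} (hc : 0 < c) (hcC : c ≤ C)
    (hM : 0 ≤ M) (k : KSpace d C)
    (h : ∀ G : LSpace d C, |∫ η, G η * k.1 η ∂lebesguePoisson d| ≤ M * ‖incl d hc hcC G‖) :
    ∀ᵐ η ∂lebesguePoisson d, |scaled c k.1 η| ≤ M := by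
  have hC := hc.trans_le hcC
  obtain ⟨p, hp, hp0⟩ := exists_pos_memLp_two hd C
  have hpow : ∀ n : ℕ, 0 ≤ (c / C) ^ n ∧ (c / C) ^ n ≤ 1 := fun n =>
    ⟨by positivity, pow_le_one₀ (by positivity) ((div_le_one hC).2 hcC)⟩
  have hm : Measurable fun η : FinConf d => M * (c / C) ^ η.card :=
    (measurable_from_top (f := fun n : ℕ => M * (c / C) ^ n)).comp measurable_card
  have h1 := abs_le_of_pairing_le (w := weightedMeasure d C) hp hp0 (κ := scaled C k.1)
    (m := fun η => M * (c / C) ^ η.card) (K := max (kNorm C k.1) M)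
    ((aestronglyMeasurable_scaled C k.1).mono_ac (withDensity_absolutelyContinuous _ _))
    hm.aestronglyMeasurable
    ((ae_weighted_iff hC).2 (by
      filter_upwards [ae_abs_scaled_le k.2] with η hη
      exact hη.trans (le_max_left _ _)))
    (Eventually.of_forall fun η => (mul_le_of_le_one_right hM (hpow _).2).trans (le_max_right _ _))
    (Eventually.of_forall fun η => mul_nonneg hM (hpow _).1)
    (fun G => by
      rw [integral_mul_scaled hC]
      refine ((le_abs_self _).trans (h G)).trans (le_of_eq ?_)
      rw [norm_incl_eq, ← integral_const_mul]
      congr 1 with η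
      ring)
  rw [ae_weighted_iff hC] at h1
  filter_upwards [h1] with η hη
  have h2 : scaled c k.1 η = scaled C k.1 η * (C / c) ^ η.card := by
    have := pow_pos hC η.card
    rw [scaled, scaled, div_pow]
    field_simp
  rw [h2, abs_mul, abs_of_nonneg (by positivity : (0 : ℝ) ≤ (C / c) ^ η.card)]
  calc _ ≤ M * (c / C) ^ η.card * (C / c) ^ η.card := by gcongr
    _ = M * (c / C * (C / c)) ^ η.card := by rw [mul_pow, mul_assoc]
    _ = M := by
      rw [div_mul_div_cancel₀ hC.ne', div_self hc.ne', one_pow, mul_one]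

/-- If `κ` represents the functional with respect to `λ_C`, then `C^{|·|} κ` represents it with
respect to `λ`. -/
theorem exists_kSpace_of_functional (hd : 1 ≤ d) {C : ℝ} (hC : 0 < C) (ℓ : LSpace d C →L[ℝ] ℝ) :
    ∃ k : KSpace d C, ∀ G : LSpace d C, ∫ η, G η * k.1 η ∂lebesguePoisson d = ℓ G := by
  obtain ⟨p, hp, hp0⟩ := exists_pos_memLp_two hd C
  obtain ⟨κ, hκm, hκb, hκ⟩ := exists_density_of_functional hp hp0 ℓ
  have hac : lebesguePoisson d ≪ weightedMeasure d C :=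
    withDensity_absolutelyContinuous' (measurable_weight C).aemeasurable
      (Eventually.of_forall fun η => (ENNReal.ofReal_pos.2 (pow_pos hC _)).ne')
  have hw : Measurable fun η : FinConf d => C ^ η.card :=
    (measurable_from_top (f := fun n : ℕ => C ^ n)).comp measurable_card
  have hm : AEStronglyMeasurable (fun η : FinConf d => C ^ η.card * κ η) (lebesguePoisson d) :=
    hw.aestronglyMeasurable.mul (hκm.mono_ac hac)
  let k : FinConf d →ₘ[lebesguePoisson d] ℝ := AEEqFun.mk _ hm
  have hk : ∀ᵐ η ∂lebesguePoisson d, scaled C k η = κ η := by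
    filter_upwards [AEEqFun.coeFn_mk _ hm] with η hη
    rw [scaled, hη, inv_mul_cancel_left₀ (pow_ne_zero _ hC.ne')]
  have hkmem : MemLp (scaled C k) ∞ (lebesguePoisson d) :=
    memLp_top_of_bound (aestronglyMeasurable_scaled C k) ‖ℓ‖ (by
      filter_upwards [hk, (ae_weighted_iff hC).1 hκb] with η h1 h2
      rw [h1]
      exact h2)
  refine ⟨⟨k, hkmem⟩, fun G => ?_⟩
  rw [← hκ, ← integral_mul_scaled hC]
  refine integral_congr_ae ?_
  filter_upwards [(ae_weighted_iff hC).2 hk] with η hη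
  rw [hη]

variable {C : ℝ} [hCf : Fact (1 < C)]

theorem pos_of_fact : 0 < C := zero_lt_one.trans hCf.out

/-- The functional `G ↦ ∫ G k dλ` on `L_C`. -/
def pairing (k : KSpace d C) : LSpace d C →L[ℝ] ℝ :=
  LinearMap.mkContinuous
    { toFun := fun G => ∫ η, G η * k.1 η ∂lebesguePoisson d
      map_add' := fun G H => by
        rw [← integral_add (integrable_mul pos_of_fact G k) (integrable_mul pos_of_fact H k)]
        refine integral_congr_ae ?_
        filter_upwards [(ae_weighted_iff pos_of_fact).1 (Lp.coeFn_add G H)] with η hη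
        rw [hη, Pi.add_apply, add_mul]
      map_smul' := fun r G => by
        rw [RingHom.id_apply, smul_eq_mul, ← integral_const_mul]
        refine integral_congr_ae ?_
        filter_upwards [(ae_weighted_iff pos_of_fact).1 (Lp.coeFn_smul r G)] with η hη
        rw [hη, Pi.smul_apply, smul_eq_mul, mul_assoc] }
    ‖k‖ (fun G => by
      have := abs_pairing_le pos_of_fact le_rfl G k.2
      rw [incl_self, ← KSpace.norm_eq] at this
      exact this)

theorem pairing_apply (k : KSpace d C) (G : LSpace d C) :
    pairing k G = ∫ η, G η * k.1 η ∂lebesguePoisson d := rfl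

theorem norm_pairing (hd : 1 ≤ d) (k : KSpace d C) : ‖pairing k‖ = ‖k‖ := by
  refine le_antisymm (LinearMap.mkContinuous_norm_le _ (norm_nonneg k) fun G => ?_) ?_
  · have := abs_pairing_le pos_of_fact le_rfl G k.2
    rw [incl_self, ← KSpace.norm_eq] at this
    exact this
  · rw [KSpace.norm_eq]
    refine kNorm_le_of_ae (norm_nonneg _) ?_
    refine ae_abs_scaled_le_of_pairing hd pos_of_fact le_rfl (norm_nonneg _) k fun G => ?_
    rw [incl_self, ← pairing_apply, ← Real.norm_eq_abs]
    exact (pairing k).le_opNorm G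

/-- `K_C` is the dual of `L_C`. -/
def dualEquiv (hd : 1 ≤ d) : KSpace d C ≃ₗᵢ[ℝ] (LSpace d C →L[ℝ] ℝ) :=
  LinearIsometryEquiv.ofSurjective
    { toFun := pairing
      map_add' := fun k l => by
        ext G
        rw [add_apply, pairing_apply, pairing_apply, pairing_apply,
          ← integral_add (integrable_mul pos_of_fact G k) (integrable_mul pos_of_fact G l)]
        refine integral_congr_ae ?_
        filter_upwards [AEEqFun.coeFn_add k.1 l.1] with η hη
        rw [Submodule.coe_add, hη, Pi.add_apply, mul_add]
      map_smul' := fun r k => by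
        ext G
        rw [RingHom.id_apply, smul_apply, pairing_apply, pairing_apply, smul_eq_mul,
          ← integral_const_mul]
        refine integral_congr_ae ?_
        filter_upwards [AEEqFun.coeFn_smul r k.1] with η hη
        rw [Submodule.coe_smul, hη, Pi.smul_apply, smul_eq_mul, mul_left_comm]
      norm_map' := norm_pairing hd }
    (fun ℓ => by
      obtain ⟨k, hk⟩ := exists_kSpace_of_functional hd pos_of_fact ℓ
      exact ⟨k, ContinuousLinearMap.ext hk⟩)

theorem dualEquiv_apply (hd : 1 ≤ d) (k : KSpace d C) (G : LSpace d C) :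
    dualEquiv hd k G = ∫ η, G η * k.1 η ∂lebesguePoisson d := rfl

end Dual

/-! ### Restricting a dual semigroup to a space of strong continuity -/

section DualSemigroup

variable {E K : Type*} [NormedAddCommGroup E] [NormedSpace ℝ E] [NormedAddCommGroup K]
  [NormedSpace ℝ K]

/-- The restriction of a dual semigroup to the closure of an invariant subspace on which it is
strongly continuous. -/
theorem ContractionSemigroup.exists_dual_restriction (T : ContractionSemigroup E)
    (Φ : K ≃ₗᵢ[ℝ] (E →L[ℝ] ℝ)) (V : Submodule ℝ K)
    (hinv : ∀ (t : ℝ≥0), ∀ k ∈ V, Φ.symm ((Φ k).comp (T.op t)) ∈ V)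
    (hcont : ∀ k ∈ V, ∃ M : ℝ, 0 ≤ M ∧ ∀ (t : ℝ≥0) (x : E), |Φ k (T.op t x - x)| ≤ t * M * ‖x‖) :
    ∃ S : ContractionSemigroup V.topologicalClosure,
      ∀ (t : ℝ≥0) (k : V.topologicalClosure) (x : E),
        Φ (S.op t k : K) x = Φ (k : K) (T.op t x) := by
  let D : ℝ≥0 → K →L[ℝ] K := fun t =>
    (Φ.symm.toContinuousLinearEquiv : (E →L[ℝ] ℝ) →L[ℝ] K).comp
      ((((ContinuousLinearMap.compL ℝ E E ℝ).flip (T.op t))).comp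
        (Φ.toContinuousLinearEquiv : K →L[ℝ] (E →L[ℝ] ℝ)))
  have hD : ∀ t k, D t k = Φ.symm ((Φ k).comp (T.op t)) := fun t k => rfl
  have hΦD : ∀ t k x, Φ (D t k) x = Φ k (T.op t x) := fun t k x => by
    rw [hD, Φ.apply_symm_apply]
    rfl
  have hnorm : ∀ t k, ‖D t k‖ ≤ ‖k‖ := fun t k => by
    rw [hD, Φ.symm.norm_map, ← Φ.norm_map k]
    refine ((Φ k).opNorm_comp_le (T.op t)).trans ?_
    exact mul_le_of_le_one_right (norm_nonneg _) (T.norm_le t)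
  have hmaps : ∀ t, ∀ k ∈ V.topologicalClosure, D t k ∈ V.topologicalClosure := fun t k hk =>
    map_mem_closure (D t).continuous hk fun l hl => hinv t l hl
  have hext : ∀ {k l : K}, (∀ x, Φ k x = Φ l x) → k = l := fun h =>
    Φ.injective (ContinuousLinearMap.ext h)
  let S : ℝ≥0 → V.topologicalClosure →L[ℝ] V.topologicalClosure := fun t =>
    ((D t).comp V.topologicalClosure.subtypeL).codRestrict _ fun k => hmaps t k.1 k.2
  have hS : ∀ t k, ((S t k : V.topologicalClosure) : K) = D t k := fun t k => rfl
  have hSn : ∀ t k, ‖S t k‖ ≤ ‖k‖ := fun t k => hnorm t k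
  have hdense : Dense {k : V.topologicalClosure | (k : K) ∈ V} := by
    intro k
    rw [closure_subtype]
    refine closure_mono ?_ k.2
    intro l hl
    exact ⟨⟨l, V.le_topologicalClosure hl⟩, hl, rfl⟩
  refine ⟨⟨S, ?_, ?_, ?_, ?_⟩, fun t k x => hΦD t k x⟩
  · ext k
    refine hext fun x => ?_
    rw [hS, hΦD, T.op_zero]
    rfl
  · intro s t
    ext k
    refine hext fun x => ?_
    -- Passing to adjoints reverses the order of composition, hence the exchange of `s` and `t`.
    rw [hS, hΦD, add_comm s t, T.op_add]
    change _ = Φ (D s (D t k)) x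
    rw [hΦD, hΦD]
    rfl
  · exact fun t => ContinuousLinearMap.opNorm_le_bound _ zero_le_one
      (fun k => by rw [one_mul]; exact hSn t k)
  · intro k
    -- On the dense subspace `V` orbits are Lipschitz at `0` in the dual norm; contractivity extends
    -- continuity to the closure.
    have h0 : Tendsto (fun t : ℝ≥0 => (S t - 1) k) (𝓝 0) (𝓝 0) := by
      refine tendsto_zero_of_dense (K := 2) (Eventually.of_forall fun t k => ?_) hdense ?_ k
      · calc ‖S t k - k‖ ≤ ‖S t k‖ + ‖k‖ := norm_sub_le _ _
          _ ≤ 2 * ‖k‖ := by linarith [hSn t k]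
      · intro k hk
        obtain ⟨M, hM, hk'⟩ := hcont k hk
        have h1 : Tendsto (fun t : ℝ≥0 => (t : ℝ) * M) (𝓝 0) (𝓝 0) := by
          have : Tendsto (fun t : ℝ≥0 => (t : ℝ)) (𝓝 0) (𝓝 0) :=
            NNReal.continuous_coe.tendsto' 0 0 NNReal.coe_zero
          simpa using this.mul_const M
        refine squeeze_zero_norm (fun t => ?_) h1
        change ‖D t k - k‖ ≤ _
        rw [← Φ.norm_map]
        refine ContinuousLinearMap.opNorm_le_bound _ (by positivity) fun x => ?_
        rw [map_sub, sub_apply, hΦD, ← map_sub]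
        exact hk' t x
    simpa using h0.add_const k

end DualSemigroup

/-! ### The threshold `α₁` -/

section Threshold

variable {z β C α : ℝ}

theorem exists_root (hz : 0 < z) (hC : 0 < C) (h : z ≤ C * Real.exp (-C * β)) :
    ∃ r, 0 ≤ r ∧ r ≤ C ∧ r * Real.exp (-β * r) = z := by
  have hc : ContinuousOn (fun r : ℝ => r * Real.exp (-β * r)) (Set.Icc 0 C) := by fun_prop
  have h1 := intermediate_value_Icc hC.le hc
  have h2 : z ∈ Set.Icc ((0 : ℝ) * Real.exp (-β * 0)) (C * Real.exp (-β * C)) := by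
    rw [zero_mul]
    refine ⟨hz.le, h.trans (le_of_eq ?_)⟩
    congr 2
    ring
  obtain ⟨r, hr, hr'⟩ := h1 h2
  exact ⟨r, hr.1, hr.2, hr'⟩

theorem smallestRoot_le {r : ℝ} (hr : 0 ≤ r) (h : r * Real.exp (-β * r) = z) :
    smallestRoot z β ≤ r :=
  csInf_le ⟨0, fun _ hs => hs.1⟩ ⟨hr, h⟩

/-- When `Cβ ≤ 1` the smallest root is at most some root `r ≤ C`, and `r = C` would mean `z = C
e^{-Cβ}`. -/
theorem alphaOne_mem_Ioo (hz : 0 < z) (hC : 1 < C) (h : z ≤ C * Real.exp (-C * β))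
    (hne : z ≠ C * Real.exp (-C * β)) : alphaOne z β C ∈ Set.Ioo (0 : ℝ) 1 := by
  have hC0 : 0 < C := zero_lt_one.trans hC
  have h1C : 1 / C < 1 := (div_lt_one hC0).2 hC
  rw [alphaOne]
  split_ifs with hcb
  · refine ⟨lt_max_of_lt_left (lt_max_of_lt_left (by norm_num)),
      max_lt (max_lt (by norm_num) ?_) h1C⟩
    rwa [div_lt_one (zero_lt_one.trans hcb)]
  · refine ⟨lt_max_of_lt_left (lt_max_of_lt_left (by norm_num)),
      max_lt (max_lt (by norm_num) ?_) h1C⟩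
    obtain ⟨r, hr0, hrC, hr⟩ := exists_root hz hC0 h
    rw [div_lt_one hC0]
    refine (smallestRoot_le hr0 hr).trans_lt (lt_of_le_of_ne hrC ?_)
    rintro rfl
    apply hne
    rw [← hr]
    congr 2
    ring

theorem mul_exp_div_le_one {c : ℝ} (hc : 0 < c) (h : z ≤ c * Real.exp (-c * β)) :
    z * Real.exp (c * β) / c ≤ 1 := by
  rw [div_le_one hc]
  calc z * Real.exp (c * β) ≤ c * Real.exp (-c * β) * Real.exp (c * β) := by gcongr
    _ = c := by rw [mul_assoc, ← Real.exp_add]; simp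

theorem half_lt_of_alphaOne_lt (h : alphaOne z β C < α) : 1 / 2 < α := by
  rw [alphaOne] at h
  split_ifs at h <;>
    exact lt_of_le_of_lt ((le_max_left _ _).trans (le_max_left _ _)) h

/-- The threshold is chosen so that the contraction condition persists at the weight `αC`. The
function `s e^{-βs}` is compared with its value at `C` on the decreasing branch and with its value
`z` at a root on the increasing one; both monotonicities come from `1 + x ≤ e^x`. -/
theorem le_mul_exp_of_alphaOne_lt (hz : 0 < z) (hβ : 0 ≤ β) (hC : 0 < C)
    (h : z ≤ C * Real.exp (-C * β)) (hα : alphaOne z β C < α) (hα1 : α < 1) :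
    z ≤ α * C * Real.exp (-(α * C) * β) := by
  have hα0 : 0 < α := by linarith [half_lt_of_alphaOne_lt hα]
  have hs : 0 < α * C := by positivity
  have hsC : α * C < C := mul_lt_of_lt_one_left hC hα1
  rw [alphaOne] at hα
  split_ifs at hα with hcb
  · -- `s e^{-βs}` decreases for `βs ≥ 1`
    have h1 : 1 / (C * β) < α :=
      lt_of_le_of_lt ((le_max_right _ _).trans (le_max_left _ _)) hα
    rw [div_lt_iff₀ (zero_lt_one.trans hcb)] at h1
    refine h.trans ?_
    have h2 : -(α * C) * β = -C * β + (C - α * C) * β := by ring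
    rw [h2, Real.exp_add, mul_left_comm, mul_comm C]
    refine mul_le_mul_of_nonneg_left ?_ (Real.exp_pos _).le
    have h3 := Real.add_one_le_exp ((C - α * C) * β)
    nlinarith [mul_le_mul_of_nonneg_left h3 hs.le]
  · -- `s e^{-βs}` increases for `βs ≤ 1`
    have h1 : smallestRoot z β / C < α :=
      lt_of_le_of_lt ((le_max_right _ _).trans (le_max_left _ _)) hα
    rw [div_lt_iff₀ hC, smallestRoot] at h1
    obtain ⟨r₀, hr₀, -, hr₀'⟩ := exists_root hz hC h
    -- Any root below `αC` suffices, so attainment of the infimum is not needed.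
    obtain ⟨r, ⟨hr0, hr⟩, hrs⟩ := exists_lt_of_csInf_lt
      (show {r : ℝ | 0 ≤ r ∧ r * Real.exp (-β * r) = z}.Nonempty from ⟨r₀, hr₀, hr₀'⟩) h1
    rw [← hr]
    have h2 : -β * r = -(α * C) * β + (α * C - r) * β := by ring
    have h3 : Real.exp (-(α * C) * β) = Real.exp (-β * r) * Real.exp (-((α * C - r) * β)) := by
      rw [← Real.exp_add]; congr 1; ring
    rw [h3, mul_left_comm, mul_comm r]
    refine mul_le_mul_of_nonneg_left ?_ (Real.exp_pos _).le
    have h4 := Real.add_one_le_exp (-((α * C - r) * β))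
    have h5 : α * C * β ≤ 1 := by nlinarith
    nlinarith [mul_le_mul_of_nonneg_left h4 hs.le]

end Threshold

/-! ### Dual semigroups and the Vlasov limit -/

section VlasovScaling

variable {d : ℕ} {φ a b : Space d → ℝ} {β z C α : ℝ}

theorem isPotential_of_integrable (hd : 1 ≤ d) (hm : Measurable φ) (h0 : ∀ x, 0 ≤ φ x)
    (hi : Integrable φ) (hβ : β = ∫ x, φ x) : IsPotential φ β where
  one_le := hd
  measurable := hm
  nonneg := h0
  lintegral_eq := by rw [hβ, ofReal_integral_eq_lintegral_ofReal hi (Eventually.of_forall h0)]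
  integral_nonneg := hβ ▸ integral_nonneg h0

/-- Equality at both weights, `z e^{Cβ} = C` and `z e^{2Cβ} = 2C`, gives `e^{Cβ} = 2` and `z = C/2`,
which the extra hypothesis rules out. -/
theorem exists_mul_exp_div_lt_one (hC : 0 < C)
    (h : z ≤ min (C * Real.exp (-C * β)) (2 * C * Real.exp (-2 * C * β)))
    (hlog : C * β = Real.log 2 → z < C / 2) :
    ∃ c, C ≤ c ∧ c ≤ 2 * C ∧ z * Real.exp (c * β) / c < 1 := by
  by_cases h1 : z * Real.exp (C * β) / C < 1
  · exact ⟨C, le_rfl, by linarith, h1⟩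
  refine ⟨2 * C, by linarith, le_rfl, ?_⟩
  have h2C : 0 < 2 * C := by positivity
  have h2 : z * Real.exp (2 * C * β) / (2 * C) ≤ 1 :=
    mul_exp_div_le_one h2C ((h.trans (min_le_right _ _)).trans_eq (by rw [neg_mul]))
  refine lt_of_le_of_ne h2 fun h3 => ?_
  have h4 : z * Real.exp (C * β) = C := by
    have h5 := (mul_exp_div_le_one hC (h.trans (min_le_left _ _))).antisymm (not_lt.1 h1)
    rwa [div_eq_one_iff_eq hC.ne'] at h5
  rw [div_eq_one_iff_eq h2C.ne', mul_assoc 2 C β, two_mul (C * β), Real.exp_add, ← mul_assoc, h4,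
    mul_comm, mul_left_inj' hC.ne'] at h3
  have h5 := hlog (by rw [← h3, Real.log_exp])
  rw [h3] at h4
  linarith

theorem memLp_scaled_of_ae_abs_le {c M : ℝ} {k : FinConf d →ₘ[lebesguePoisson d] ℝ}
    (h : ∀ᵐ η ∂lebesguePoisson d, |scaled c k η| ≤ M) : MemLp (scaled c k) ∞ (lebesguePoisson d) :=
  memLp_top_of_bound (aestronglyMeasurable_scaled c k) M h

variable [hCf : Fact (1 < C)] {P P' : ℝ → LSpace d C →L[ℝ] LSpace d C}
  {T T' : ContractionSemigroup (LSpace d C)}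

theorem mul_lt_of_fact (hα1 : α < 1) : α * C < C := mul_lt_of_lt_one_left pos_of_fact hα1

theorem IsResolvent.norm_incl_le {c : ℝ} (hφ : IsPotential φ β) (hk : IsKernel φ a b) (hz : 0 < z)
    (hc : 0 < c) (hcC : c ≤ C) (hκ : z * Real.exp (c * β) / c ≤ 1)
    (hP : IsResolvent (coreGraph hφ hk z (C := C) pos_of_fact).topologicalClosure P) {μ : ℝ}
    (hμ : 0 < μ) (x : LSpace d C) : ‖incl d hc hcC (P μ x)‖ ≤ ‖incl d hc hcC x‖ :=
  hP.norm_apply_le_of_dissipative _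
    (fun _ hμ _ hp => coreGraph_dissipative hφ hk hz hc hcC hκ hμ hp) hμ x

/-- Contractivity of `T` in the norm of `L_{αC}` makes the dual preserve `K_{αC}`. Boundedness of
the generator from `L_C` to `L_{αC}` bounds `T(t)G - G` there by a multiple of `t ‖G‖`, which gives
the continuity required on `K_{αC}`. -/
theorem exists_isDualRestriction (hφ : IsPotential φ β) (hk : IsKernel φ a b) (hz : 0 < z)
    (hα0 : 0 < α) (hα1 : α < 1) (hκ : z * Real.exp (α * C * β) / (α * C) ≤ 1)
    (hP : IsResolvent (coreGraph hφ hk z (C := C) pos_of_fact).topologicalClosure P)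
    (hT : IsYosidaLimit P T) : ∃ S : ContractionSemigroup (KBar d C α), IsDualRestriction T S := by
  have hc : 0 < α * C := mul_pos hα0 pos_of_fact
  have hcC : α * C < C := mul_lt_of_fact hα1
  have h0 : 0 ≤ (1 - α * C / C)⁻¹ :=
    inv_nonneg.2 (sub_nonneg.2 ((div_le_one pos_of_fact).2 hcC.le))
  have hj : ∀ μ, 0 < μ → ∀ x, ‖incl d hc hcC.le (P μ x)‖ ≤ ‖incl d hc hcC.le x‖ := fun μ hμ x =>
    hP.norm_incl_le hφ hk hz hc hcC.le hκ hμ x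
  have hkn : ∀ k : FinConf d →ₘ[lebesguePoisson d] ℝ, 0 ≤ kNorm (α * C) k :=
    fun k => ENNReal.toReal_nonneg
  obtain ⟨S, hS⟩ := T.exists_dual_restriction (dualEquiv hφ.one_le) (KSub d C (α * C))
    (fun t k hk' => memLp_scaled_of_ae_abs_le
      (ae_abs_scaled_le_of_pairing hφ.one_le hc hcC.le (hkn k.1) _ fun G => by
        rw [← dualEquiv_apply hφ.one_le, LinearIsometryEquiv.apply_symm_apply]
        refine (abs_pairing_le hc hcC.le (T.op t G) hk').trans ?_
        exact mul_le_mul_of_nonneg_left (hT.norm_apply_op_le _ hj t G) (hkn _)))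
    (fun k hk' => ⟨kNorm (α * C) k.1 * (2 * (1 - α * C / C)⁻¹),
      mul_nonneg (hkn _) (by positivity), fun t x => by
        refine (abs_pairing_le hc hcC.le (T.op t x - x) hk').trans ?_
        have h1 := hT.norm_apply_op_sub_le (incl d hc hcC.le) (K := 2 * (1 - α * C / C)⁻¹)
          (by positivity) hj (fun μ hμ x => hP.norm_apply_sub_le _ (by positivity)
            (fun p hp => norm_incl_snd_le hφ hk hz hc hcC hκ hp) hμ x) t x
        refine (mul_le_mul_of_nonneg_left h1 (hkn k.1)).trans (le_of_eq ?_)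
        ring⟩)
  exact ⟨S, fun t G k => (hS t k G).symm⟩

/-- By duality it suffices to bound `(T - T')G` in `L_{αC}` by the norm of `G` in `L_C`. The
comparison uses weak-norm contractivity of `T` and only the strong one of `T'`. -/
theorem norm_dual_sub_le {b' : Space d → ℝ} {δ c' : ℝ} (hφ : IsPotential φ β)
    (hk : IsKernel φ a b) (hk' : IsKernel φ 1 b') (had : ∀ x, |a x - 1| ≤ δ)
    (hbd : ∀ x, |b x - b' x| ≤ δ * φ x) (hz : 0 < z) (hα0 : 0 < α) (hcc' : α * C < c')
    (hc'C : c' < C) (hκ_C : z * Real.exp (C * β) / C ≤ 1)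
    (hκ : z * Real.exp (α * C * β) / (α * C) ≤ 1) (hκ' : z * Real.exp (c' * β) / c' ≤ 1)
    (hP : IsResolvent (coreGraph hφ hk z (C := C) pos_of_fact).topologicalClosure P)
    (hP' : IsResolvent (coreGraph hφ hk' z (C := C) pos_of_fact).topologicalClosure P')
    (hT : IsYosidaLimit P T) (hT' : IsYosidaLimit P' T') {S S' : ContractionSemigroup (KBar d C α)}
    (hS : IsDualRestriction T S) (hS' : IsDualRestriction T' S') (t : ℝ≥0) (k : KBar d C α)
    (hkα : (k : KSpace d C) ∈ KSub d C (α * C)) :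
    ‖S.op t k - S'.op t k‖ ≤ δ * t * ((1 - α * C / c')⁻¹ * (1 - c' / C)⁻¹) *
      kNorm (α * C) (k : KSpace d C).1 := by
  have hc : 0 < α * C := mul_pos hα0 pos_of_fact
  have hcC := hcc'.trans hc'C
  have hδ : 0 ≤ δ := (abs_nonneg _).trans (had 0)
  have h0 : 0 ≤ (1 - α * C / c')⁻¹ :=
    inv_nonneg.2 (sub_nonneg.2 ((div_le_one (hc.trans hcc')).2 hcc'.le))
  have h0' : 0 ≤ (1 - c' / C)⁻¹ := inv_nonneg.2 (sub_nonneg.2 ((div_le_one pos_of_fact).2 hc'C.le))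
  have hkn : 0 ≤ kNorm (α * C) (k : KSpace d C).1 := ENNReal.toReal_nonneg
  have hK : 0 ≤ δ * ((1 - α * C / c')⁻¹ * (1 - c' / C)⁻¹) := by positivity
  have hΦ : ∀ G : LSpace d C, dualEquiv hφ.one_le (S.op t k - S'.op t k : KSpace d C) G =
      dualEquiv hφ.one_le (k : KSpace d C) (T.op t G - T'.op t G) := fun G => by
    rw [map_sub, map_sub, sub_apply, dualEquiv_apply, dualEquiv_apply, dualEquiv_apply,
      dualEquiv_apply, hS t G k, hS' t G k]
  change ‖(S.op t k - S'.op t k : KSpace d C)‖ ≤ _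
  rw [← (dualEquiv hφ.one_le).norm_map]
  refine ContinuousLinearMap.opNorm_le_bound _ (by positivity) fun G => ?_
  rw [hΦ, dualEquiv_apply, Real.norm_eq_abs]
  refine (abs_pairing_le hc hcC.le _ hkα).trans ?_
  have h1 := hT.norm_apply_op_sub_op_le hT' (incl d hc hcC.le) hK
    (fun μ hμ x => hP.norm_incl_le hφ hk hz hc hcC.le hκ hμ x)
    (fun μ hμ x => hP'.norm_apply_le hμ x)
    (fun μ hμ x => hP.norm_apply_sub_apply_le hP' _ hK
      (fun μ hμ p hp => coreGraph_dissipative hφ hk hz hc hcC.le hκ hμ hp)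
      (fun p hp => exists_mem_coreGraph_norm_sub_le hφ hk hk' had hbd hz hc hcc' hc'C hκ_C hκ' hp)
      hμ x) t G
  refine (mul_le_mul_of_nonneg_left h1 hkn).trans (le_of_eq ?_)
  ring

end VlasovScaling

end GlauberVlasov

end

/-! ### The theorem -/

open GlauberVlasov

theorem theorem3p10 :
    ∃ A : ℝ → ℝ → ℝ → ℝ,
      ∀ (d : ℕ) (_ : 1 ≤ d) (φ : GlauberVlasov.Space d → ℝ) (C z β : ℝ) [Fact (1 < C)],
        Measurable φ → (∀ x, 0 ≤ φ x) → (∀ x, φ (-x) = φ x) →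
        Integrable φ → β = ∫ x, φ x → BddAbove (Set.range φ) →
        0 < z → z ≤ min (C * Real.exp (-C * β)) (2 * C * Real.exp (-2 * C * β)) →
        (C * β = Real.log 2 → z < C / 2) →
        (z ≠ C * Real.exp (-C * β) → GlauberVlasov.alphaOne z β C ∈ Set.Ioo (0 : ℝ) 1) ∧
        ∃ (TV : GlauberVlasov.ContractionSemigroup (GlauberVlasov.LSpace d C))
          (Tren : ℝ → GlauberVlasov.ContractionSemigroup (GlauberVlasov.LSpace d C)),
          GlauberVlasov.IsGeneratedByClosure TV (GlauberVlasov.vlasovOp z φ) ∧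
          (∀ ε : ℝ, 0 < ε →
            GlauberVlasov.IsGeneratedByClosure (Tren ε) (GlauberVlasov.renOp z φ ε)) ∧
          ∀ α : ℝ, GlauberVlasov.alphaOne z β C < α → α < 1 →
            ∃ (SV : GlauberVlasov.ContractionSemigroup (GlauberVlasov.KBar d C α))
              (Sren : ℝ → GlauberVlasov.ContractionSemigroup (GlauberVlasov.KBar d C α)),
              GlauberVlasov.IsDualRestriction TV SV ∧
              (∀ ε : ℝ, 0 < ε → GlauberVlasov.IsDualRestriction (Tren ε) (Sren ε)) ∧
              ∀ (ε : ℝ) (_ : 0 < ε) (t : ℝ≥0) (k : GlauberVlasov.KBar d C α),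
                (k : GlauberVlasov.KSpace d C) ∈ GlauberVlasov.KSub d C (α * C) →
                ‖(Sren ε).op t k - SV.op t k‖ ≤
                  ε * t * A α C (⨆ x, φ x) *
                    GlauberVlasov.kNorm (α * C) (k : GlauberVlasov.KSpace d C).1 := by
  -- The intermediate weight is the midpoint `c' = (1 + α)C/2` of `αC` and `C`; since `(1 + α)/2`
  -- also lies in `(α₁, 1)`, the contraction condition holds there. For `α` in this range the
  -- constant equals `2M(1 + α)/(1 - α)²`.
  refine ⟨fun α C M => M * ((1 - α * C / ((1 + α) / 2 * C))⁻¹ * (1 - (1 + α) / 2 * C / C)⁻¹), ?_⟩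
  intro d hd φ C z β hCf hm h0 _ hi hβ hb hz hle hlog
  have hC : 0 < C := zero_lt_one.trans hCf.out
  have hφ := isPotential_of_integrable hd hm h0 hi hβ
  have hzC := hle.trans (min_le_left _ _)
  have hκ := mul_exp_div_le_one hC hzC
  have hlt := exists_mul_exp_div_lt_one hC hle hlog
  refine ⟨alphaOne_mem_Ioo hz hCf.out hzC, ?_⟩
  have hkV := isKernel_vlasov hm h0
  have hkr := fun {ε : ℝ} (hε : 0 < ε) => isKernel_ren hm h0 hε
  obtain ⟨PV, TV, hPV, hTV, hgV⟩ := exists_semigroup_coreGraph hφ hkV hz hC hκ hlt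
  -- The family is indexed by all real `ε`; for `ε ≤ 0` the Vlasov semigroup serves as an arbitrary
  -- default.
  have hren : ∀ ε : ℝ, ∃ (P : ℝ → LSpace d C →L[ℝ] LSpace d C)
      (T : ContractionSemigroup (LSpace d C)), ∀ hε : 0 < ε,
        IsResolvent (coreGraph hφ (hkr hε) z hC).topologicalClosure P ∧ IsYosidaLimit P T ∧
          IsGeneratedByClosure T (renOp z φ ε) := fun ε => by
    by_cases hε : 0 < ε
    · obtain ⟨P, T, h⟩ := exists_semigroup_coreGraph hφ (hkr hε) hz hC hκ hlt
      exact ⟨P, T, fun _ => h⟩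
    · exact ⟨PV, TV, fun h => absurd h hε⟩
  choose Pren Tren hPTren using hren
  refine ⟨TV, Tren, vlasovOp_eq z φ ▸ hgV, fun ε hε => (hPTren ε hε).2.2, fun α hα hα1 => ?_⟩
  have hα2 := half_lt_of_alphaOne_lt hα
  have hα0 : 0 < α := by linarith
  have hα'1 : (1 + α) / 2 < 1 := by linarith
  have hκα := mul_exp_div_le_one (mul_pos hα0 hC)
    (le_mul_exp_of_alphaOne_lt hz hφ.integral_nonneg hC hzC hα hα1)
  have hκα' := mul_exp_div_le_one (mul_pos (by linarith) hC)
    (le_mul_exp_of_alphaOne_lt hz hφ.integral_nonneg hC hzC (α := (1 + α) / 2) (by linarith) hα'1)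
  obtain ⟨SV, hSV⟩ := exists_isDualRestriction hφ hkV hz hα0 hα1 hκα hPV hTV
  have hren : ∀ ε : ℝ, ∃ S : ContractionSemigroup (KBar d C α), 0 < ε →
      IsDualRestriction (Tren ε) S := fun ε => by
    by_cases hε : 0 < ε
    · obtain ⟨S, hS⟩ := exists_isDualRestriction hφ (hkr hε) hz hα0 hα1 hκα (hPTren ε hε).1
        (hPTren ε hε).2.1
      exact ⟨S, fun _ => hS⟩
    · exact ⟨SV, fun h => absurd h hε⟩
  choose Sren hSren using hren
  refine ⟨SV, Sren, hSV, hSren, fun ε hε t k hk => ?_⟩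
  have hM : ∀ x, φ x ≤ ⨆ x, φ x := le_ciSup hb
  have h := norm_dual_sub_le hφ (hkr hε) hkV (ren_sub_vlasov_left h0 hε hM)
    (ren_sub_vlasov_right h0 hε hM) hz hα0
    (mul_lt_mul_of_pos_right (by linarith : α < (1 + α) / 2) hC)
    (mul_lt_of_lt_one_left hC hα'1) hκ hκα hκα' (hPTren ε hε).1 hPV (hPTren ε hε).2.1 hTV
    (hSren ε hε) hSV t k hk
  refine h.trans (le_of_eq ?_)
  ring
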